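/- **Conventions.** Write $f\doteq g$ if $f=\pm t^kg$ for some $k\in\mathbb Z$. For an oriented knot diagram with arcs $x_1,\dots,x_n$ and crossings $\mathfrak c_1,\dots,\mathfrak c_n$, let $r_i=xyx^{-1}z^{-1}$ if $\mathfrak c_i$ is positive and $r_i=x^{-1}yxz^{-1}$ if it is negative, where $x,y,z$ are the over-arc, the incoming under-arc and the outgoing under-arc at $\mathfrak c_i$. Let $\Phi$ send every arc to $t$ (so an arc directed against the orientation has image $t^{-1}$). The Alexander polynomial $\Delta_L$ is, up to $\doteq$, the determinant of the matrix obtained from $\big(\Phi(\partial r_i/\partial x_j)\big)_{i,j}$ (Fox derivatives) by deleting one row and one column; the choice of these does not matter. Tangles have four ends NW, NE, SW, SE; $S+T$ is the horizontal composition ($S$ on the left), $S\ast T$ the vertical one ($S$ on top), and $D(T)$ is the link obtained by joining NW to SW and NE to SE. The tangles $[1]$ and $[-1]$ are single crossings; the over-strand joins NW to SE in $[1]$ and NE to SW in $[-1]$. For $k\neq0$, $[k]$ is the horizontal composite of $|k|$ copies of $[\pm1]$, $\pm$ the sign of $k$ (and $T+[0]=T$). Let $\sigma$ denote the reflection along the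 NW–SE diagonal, which keeps the over-strands, together with the reversal of all orientations. For a continued fraction $p/q=k_s+1/(k_{s-1}+1/(\cdots+1/k_1))$ with integers $k_j$, all of whose denominators are nonzero (with $k_1\ne0$ if $s=1$), the rational tangle $[p/q]$ is $H_s$, where $H_1=[k_1]$ and $H_j=\sigma(H_{j-1})+[k_j]$. Fractions $p/q$ are in lowest terms with $q>0$. For an oriented tangle $S$ let $S^{\rm ne},S^{\rm se},S^{\rm sw}$ be its arcs at these ends, directed outward. For $k\in\mathbb Z$ put $[k]_a=1+a+\cdots+a^{k-1}$ if $k\ge0$ and $[k]_a=-a^k(1+a+\cdots+a^{|k|-1})$ if $k<0$. For an oriented rational tangle, $z_h$ and $z_v$ are defined by $$z_h([k])=1,\qquad z_v([k])=\begin{cases}t_{\rm ne}(t_{\rm se}-1)[h]_{t_{\rm ne}t_{\rm se}},&k=2h\\(1-t_{\rm se})[h]_{t_{\rm ne}t_{\rm se}}-1,&k=2h-1\end{cases}$$ with $t_{\rm ne}=\Phi([k]^{\rm ne})$, $t_{\rm se}=\Phi([k]^{\rm se})$ (for $k=0$ this reads $z_v([0])=0$), and, for $S=\sigma(H)$ oriented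 as a part of $S+[k]$, $$z_h(S)=z_v(H),\quad z_v(S)=z_h(H),\quad z_h(S+[k])=z_h(S),$$ $$z_v(S+[k])=z_v(S)+\frac{1-t_{\rm sw}}{1-t_{\rm se}^{-1}}z_h(S)z_v([k])+\frac{t_{\rm ne}^{-1}-t_{\rm se}}{1-t_{\rm se}}z_v(S)z_v([k])$$ with $t_{\rm ne}=\Phi(S^{\rm ne})$, $t_{\rm se}=\Phi(S^{\rm se})$, $t_{\rm sw}=\Phi(S^{\rm sw})$. **Theorem.** Let $r\ge1$ and let $L=D([p_1/q_1]\ast\cdots\ast[p_r/q_r])$ be a Montesinos knot, each tangle being drawn by means of any continued fraction of $p_i/q_i$ as above. Orient $L$ so that at the NE end of $[p_1/q_1]$ it runs into this tangle. Let $z_h(p_i/q_i),z_v(p_i/q_i)$ be the functions of the $i$-th tangle with the induced orientation. Let $n_1$ be the number of $i$ with $p_i,q_i$ both odd, and $n_0$ the number of $i$ with $p_i$ even. (a) If $n_0=0$ and $n_1$ is odd, then $$\Delta_L\doteq\frac1{t+1}\left(\prod_{i=1}^r\big((t+1)z_h(p_i/q_i)+z_v(p_i/q_i)\big)-\prod_{i=1}^rz_v(p_i/q_i)\right).$$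 (b) If $n_0=1$, the tangles being numbered so that $p_r$ is even, and $p_r\ne0$, then with $\epsilon_i=(-1)^{q_1+\cdots+q_{i-1}}$, $$\Delta_L\doteq(1-t)\left(\prod_{i=1}^rz_v(p_i/q_i)\right)\sum_{i=1}^r\frac{z_h(p_i/q_i)}{(1-t^{\epsilon_i})\,z_v(p_i/q_i)}.$$ -/

import Mathlib

/-!
# Montesinos knots, their Alexander polynomials, and the functions of rational tangles

Links are given by (unoriented) diagrams.  A crossing has four corners and two straight strands,
one joining NW to SE and one joining NE to SW.  A pair `(c, e)` of a crossing and a corner is a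
half-edge of the diagram.
-/

namespace MontesinosKnot

open LaurentPolynomial

/-- The four corners of a crossing, also used for the four ends of a tangle. -/
inductive Corner
  | nw | ne | sw | se
  deriving DecidableEq

namespace Corner

/-- The other corner on the same strand of a crossing. -/
def opp : Corner → Corner
  | nw => se | se => nw | ne => sw | sw => ne

/-- Reflection along the NW-SE diagonal. -/
def diag : Corner → Corner
  | nw => nw | se => se | ne => sw | sw => ne

/-- Exchange of north and south. -/
def flip : Corner → Corner
  | nw => sw | sw => nw | ne => se | se => ne

/-- The next corner in counterclockwise direction. -/
def ccw : Corner → Corner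
  | nw => sw | sw => se | se => ne | ne => nw

/-- The corner lies on the strand joining NW to SE. -/
def onNWSE : Corner → Bool
  | nw => true | se => true | ne => false | sw => false

@[simp] theorem diag_diag (e : Corner) : e.diag.diag = e := by cases e <;> rfl

@[simp] theorem flip_flip (e : Corner) : e.flip.flip = e := by cases e <;> rfl

end Corner

/-! ### Link diagrams -/

/-- A link diagram, recorded by its crossings, the information which strand is the over-strand at
each crossing, and the edges, which join the half-edges in pairs. -/
structure LinkDiagram where
  /-- the crossings -/
  C : Type
  finite : Finite C
  /-- `true` when the strand joining NW to SE is the over-strand, `false` when the other one is -/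
  overNWSE : C → Bool
  /-- the other half of the edge that a half-edge belongs to -/
  glue : C × Corner → C × Corner
  glue_glue : ∀ h, glue (glue h) = h
  glue_ne : ∀ h, glue h ≠ h

namespace LinkDiagram

variable (D : LinkDiagram)

/-- The diagram is a diagram of a knot: it has a crossing, and going straight through the crossings
one gets from each half-edge to every other one, that is, there is one component. -/
def IsKnot : Prop :=
  Nonempty D.C ∧ ∀ h h' : D.C × Corner,
    Relation.EqvGen (fun a b => b = D.glue a ∨ b = (a.1, a.2.opp)) h h'

/-- The (Wirtinger) arcs: maximal pieces of the link which run between undercrossings.  Two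
half-edges are on the same arc when one gets from one to the other along edges and over-strands. -/
def Arc : Type :=
  Quot (fun a b : D.C × Corner =>
    b = D.glue a ∨ (a.2.onNWSE = D.overNWSE a.1 ∧ b = (a.1, a.2.opp)))

/-- The arc that contains a half-edge. -/
def arc (h : D.C × Corner) : D.Arc := Quot.mk _ h

/-- An orientation of the link: `out h` says that the strand through the half-edge `h = (c, e)` is
directed away from the crossing `c`. -/
structure Orientation where
  out : D.C × Corner → Bool
  out_glue : ∀ h, out (D.glue h) = !out h
  out_opp : ∀ c e, out (c, e.opp) = !out (c, e)

variable {D}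

namespace Orientation

variable (o : D.Orientation)

/-- The corner at which the strand NW-SE (for `true`) or NE-SW (for `false`) leaves the
crossing. -/
def outCorner (c : D.C) : Bool → Corner
  | true => if o.out (c, .nw) then .nw else .se
  | false => if o.out (c, .ne) then .ne else .sw

/-- The corner at which the over-strand leaves the crossing. -/
def overOut (c : D.C) : Corner := o.outCorner c (D.overNWSE c)

/-- The corner at which the under-strand leaves the crossing. -/
def underOut (c : D.C) : Corner := o.outCorner c (!D.overNWSE c)

/-- The crossing is positive: a counterclockwise quarter turn takes the direction of the
over-strand to that of the under-strand. -/
def Positive (c : D.C) : Prop := o.underOut c = (o.overOut c).ccw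

open Classical in
/-- The Wirtinger relator of a crossing.  With `x`, `y`, `z` the over-arc, the incoming under-arc
and the outgoing under-arc it is `x y x⁻¹ z⁻¹` at a positive crossing and `x⁻¹ y x z⁻¹` at a
negative one. -/
noncomputable def relator (c : D.C) : FreeGroup D.Arc :=
  let x := FreeGroup.of (D.arc (c, o.overOut c))
  let y := FreeGroup.of (D.arc (c, (o.underOut c).opp))
  let z := FreeGroup.of (D.arc (c, o.underOut c))
  if o.Positive c then x * y * x⁻¹ * z⁻¹ else x⁻¹ * y * x * z⁻¹

end Orientation

end LinkDiagram

/-! ### Fox calculus and the Alexander polynomial -/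

section Fox

variable {α : Type}

open Classical in
/-- The unit upper triangular matrix with rows `(x, ∂x/∂a)` and `(0, 1)` for a generator `x`. -/
noncomputable def foxUnit (a x : α) :
    (Matrix (Fin 2) (Fin 2) (MonoidAlgebra ℤ (FreeGroup α)))ˣ where
  val := !![MonoidAlgebra.of ℤ _ (FreeGroup.of x), if x = a then 1 else 0; 0, 1]
  inv := !![MonoidAlgebra.of ℤ _ (FreeGroup.of x)⁻¹,
    if x = a then - MonoidAlgebra.of ℤ _ (FreeGroup.of x)⁻¹ else 0; 0, 1]
  val_inv := by
    ext i j
    fin_cases i <;> fin_cases j <;>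
      simp [Matrix.mul_apply, Fin.sum_univ_two, MonoidAlgebra.one_def,
        MonoidAlgebra.single_mul_single]
    split_ifs <;> simp [MonoidAlgebra.one_def, MonoidAlgebra.single_mul_single]
  inv_val := by
    ext i j
    fin_cases i <;> fin_cases j <;>
      simp [Matrix.mul_apply, Fin.sum_univ_two, MonoidAlgebra.one_def,
        MonoidAlgebra.single_mul_single]
    split_ifs <;> simp [MonoidAlgebra.one_def, MonoidAlgebra.single_mul_single]

/-- The homomorphism `w ↦ ((w, ∂w/∂a), (0, 1))`. -/
noncomputable def foxHom (a : α) :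
    FreeGroup α →* (Matrix (Fin 2) (Fin 2) (MonoidAlgebra ℤ (FreeGroup α)))ˣ :=
  FreeGroup.lift (foxUnit a)

/-- The Fox derivative `∂w/∂a`.  It is the map with `∂a/∂a = 1`, with `∂x/∂a = 0` for the other
generators `x`, and with `∂(vw)/∂a = ∂v/∂a + v ∂w/∂a`, as is proved below. -/
noncomputable def foxDeriv (a : α) (w : FreeGroup α) : MonoidAlgebra ℤ (FreeGroup α) :=
  (foxHom a w : Matrix (Fin 2) (Fin 2) (MonoidAlgebra ℤ (FreeGroup α))) 0 1

open Classical in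
theorem foxDeriv_of (a x : α) : foxDeriv a (FreeGroup.of x) = if x = a then 1 else 0 := by
  simp [foxDeriv, foxHom, foxUnit]

theorem foxHom_row (a : α) (w : FreeGroup α) :
    (foxHom a w : Matrix (Fin 2) (Fin 2) (MonoidAlgebra ℤ (FreeGroup α))) 0 0
        = MonoidAlgebra.of ℤ _ w ∧
      (foxHom a w : Matrix (Fin 2) (Fin 2) (MonoidAlgebra ℤ (FreeGroup α))) 1 0 = 0 ∧
      (foxHom a w : Matrix (Fin 2) (Fin 2) (MonoidAlgebra ℤ (FreeGroup α))) 1 1 = 1 := by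
  induction w using FreeGroup.induction_on with
  | C1 => simp [MonoidAlgebra.one_def]
  | of x => simp [foxHom, foxUnit]
  | inv_of x _ => 
    rw [map_inv]
    simp only [foxHom, FreeGroup.lift_apply_of]
    refine ⟨?_, ?_, ?_⟩ <;> simp [foxUnit, Units.inv_mk]
  | mul v w hv hw =>
    obtain ⟨a1, a2, a3⟩ := hv
    obtain ⟨b1, b2, b3⟩ := hw
    simp [Matrix.mul_apply, Fin.sum_univ_two, a1, a2, a3, b1, b2, b3,
      MonoidAlgebra.single_mul_single]

theorem foxDeriv_mul (a : α) (v w : FreeGroup α) :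
    foxDeriv a (v * w) = foxDeriv a v + MonoidAlgebra.of ℤ _ v * foxDeriv a w := by
  have h1 := (foxHom_row a v).1
  have h2 := (foxHom_row a w).2.2
  simp only [foxDeriv, map_mul, Units.val_mul, Matrix.mul_apply, Fin.sum_univ_two, h1, h2, mul_one]
  rw [add_comm]

/-- The unit `t` of `ℤ[t, t⁻¹]`. -/
noncomputable def tUnit : (ℤ[T;T⁻¹])ˣ where
  val := T 1
  inv := T (-1)
  val_inv := by rw [← T_add]; simp
  inv_val := by rw [← T_add]; simp

/-- The ring homomorphism `Φ : ℤ[F] → ℤ[t, t⁻¹]` that sends every generator to `t`. -/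
noncomputable def Phi : MonoidAlgebra ℤ (FreeGroup α) →ₐ[ℤ] ℤ[T;T⁻¹] :=
  MonoidAlgebra.lift ℤ ℤ[T;T⁻¹] (FreeGroup α)
    ((Units.coeHom _).comp (FreeGroup.lift fun _ => tUnit))

end Fox

/-- The field of fractions of `ℤ[t, t⁻¹]`. -/
abbrev K : Type := FractionRing ℤ[T;T⁻¹]

/-- The variable `t`, as an element of the field of fractions. -/
noncomputable def t : K := algebraMap ℤ[T;T⁻¹] K (T 1)

/-- Equality up to a factor `± t ^ k`. -/
def DotEq (f g : K) : Prop := ∃ k : ℤ, f = t ^ k * g ∨ f = -(t ^ k * g)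

/-- `f` is the Alexander polynomial, up to a factor `± t ^ k`, of the oriented knot given by the
diagram `D` with the orientation `o`: there are as many arcs as crossings, and for all numberings
`x` of the arcs and `c` of the crossings, the matrix that one obtains from
`(Φ (∂ rᵢ / ∂ xⱼ))ᵢⱼ` by deleting any row `i₀` and any column `j₀` has the determinant `f`, up to
such a factor. -/
def IsAlexanderPolynomial (D : LinkDiagram) (o : D.Orientation) (f : K) : Prop :=
  Nat.card D.Arc = Nat.card D.C ∧
  ∀ (n : ℕ) (x : Fin (n + 1) ≃ D.Arc) (c : Fin (n + 1) ≃ D.C) (i₀ j₀ : Fin (n + 1)),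
    DotEq f (algebraMap ℤ[T;T⁻¹] K
      ((Matrix.of fun i j => Phi (foxDeriv (x j) (o.relator (c i)))).submatrix
        i₀.succAbove j₀.succAbove).det)

/-! ### Tangles -/

/-- A diagram of a tangle with the four ends NW, NE, SW, SE (and at least one crossing on each
strand that has an end).  A half-edge is either joined to another half-edge or it leads to an
end. -/
structure Tangle where
  /-- the crossings -/
  C : Type
  finite : Finite C
  /-- `true` when the strand joining NW to SE is the over-strand, `false` when the other one is -/
  overNWSE : C → Bool
  /-- the other half of the edge that a half-edge belongs to, or the end to which it leads -/
  glue : C × Corner → (C × Corner) ⊕ Corner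
  /-- the half-edge that leads to an end -/
  ends : Corner → C × Corner
  glue_symm : ∀ h h', glue h = .inl h' → glue h' = .inl h
  glue_ne : ∀ h, glue h ≠ .inl h
  glue_eq_inr : ∀ h e, glue h = .inr e ↔ ends e = h

namespace Tangle

theorem glue_ends (T : Tangle) (e : Corner) : T.glue (T.ends e) = .inr e :=
  (T.glue_eq_inr _ _).2 rfl

/-- The tangles `[1]` (for `true`) and `[-1]` (for `false`): one crossing, with the over-strand
joining NW to SE in `[1]` and NE to SW in `[-1]`. -/
def cross (s : Bool) : Tangle where
  C := Unit
  finite := inferInstance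
  overNWSE _ := s
  glue h := .inr h.2
  ends e := ((), e)
  glue_symm := by simp
  glue_ne := by simp
  glue_eq_inr := by
    rintro ⟨⟨⟩, e'⟩ e
    simp [Prod.ext_iff, eq_comm]

/-- The horizontal composition `S + T`, with `S` on the left. -/
def horiz (S T : Tangle) : Tangle where
  C := S.C ⊕ T.C
  finite := by
    have := S.finite
    have := T.finite
    infer_instance
  overNWSE := Sum.elim S.overNWSE T.overNWSE
  glue h :=
    match h with
    | (.inl c, e) =>
      match S.glue (c, e) with
      | .inl h' => .inl (.inl h'.1, h'.2)
      | .inr .nw => .inr .nw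
      | .inr .sw => .inr .sw
      | .inr .ne => .inl (.inr (T.ends .nw).1, (T.ends .nw).2)
      | .inr .se => .inl (.inr (T.ends .sw).1, (T.ends .sw).2)
    | (.inr c, e) =>
      match T.glue (c, e) with
      | .inl h' => .inl (.inr h'.1, h'.2)
      | .inr .ne => .inr .ne
      | .inr .se => .inr .se
      | .inr .nw => .inl (.inl (S.ends .ne).1, (S.ends .ne).2)
      | .inr .sw => .inl (.inl (S.ends .se).1, (S.ends .se).2)
  ends e :=
    match e with
    | .nw => (.inl (S.ends .nw).1, (S.ends .nw).2)
    | .sw => (.inl (S.ends .sw).1, (S.ends .sw).2)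
    | .ne => (.inr (T.ends .ne).1, (T.ends .ne).2)
    | .se => (.inr (T.ends .se).1, (T.ends .se).2)
  glue_symm := by
    have aux : ∀ (U : Tangle) e h, U.glue h = .inr e → h = U.ends e :=
      fun U e h hh => ((U.glue_eq_inr h e).1 hh).symm
    rintro ⟨c | c, e⟩ ⟨c' | c', e'⟩ h
    · rcases hS : S.glue (c, e) with h1 | (_ | _ | _ | _) <;> simp [hS] at h
      obtain ⟨rfl, rfl⟩ := h
      simp [S.glue_symm _ _ hS]
    · rcases hS : S.glue (c, e) with h1 | (_ | _ | _ | _) <;> simp [hS] at h <;>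
        obtain ⟨rfl, rfl⟩ := h <;> simp [glue_ends, ← aux _ _ _ hS]
    · rcases hS : T.glue (c, e) with h1 | (_ | _ | _ | _) <;> simp [hS] at h <;>
        obtain ⟨rfl, rfl⟩ := h <;> simp [glue_ends, ← aux _ _ _ hS]
    · rcases hS : T.glue (c, e) with h1 | (_ | _ | _ | _) <;> simp [hS] at h
      obtain ⟨rfl, rfl⟩ := h
      simp [T.glue_symm _ _ hS]
  glue_ne := by
    rintro ⟨c | c, e⟩ h
    · rcases hS : S.glue (c, e) with h1 | (_ | _ | _ | _) <;> simp [hS] at h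
      obtain ⟨rfl, rfl⟩ := h
      exact S.glue_ne _ hS
    · rcases hS : T.glue (c, e) with h1 | (_ | _ | _ | _) <;> simp [hS] at h
      obtain ⟨rfl, rfl⟩ := h
      exact T.glue_ne _ hS
  glue_eq_inr := by
    rintro ⟨c | c, e⟩ e'
    · have h1 := S.glue_eq_inr (c, e) e'
      rcases hS : S.glue (c, e) with h2 | (_ | _ | _ | _) <;> cases e' <;>
        simp_all [Prod.ext_iff]
    · have h1 := T.glue_eq_inr (c, e) e'
      rcases hS : T.glue (c, e) with h2 | (_ | _ | _ | _) <;> cases e' <;>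
        simp_all [Prod.ext_iff]

/-- The reflection of a tangle along its NW-SE diagonal, without change of the over-strands. -/
def sigma (T : Tangle) : Tangle where
  C := T.C
  finite := T.finite
  overNWSE := T.overNWSE
  glue h := (T.glue (h.1, h.2.diag)).map (fun h' => (h'.1, h'.2.diag)) Corner.diag
  ends e := ((T.ends e.diag).1, (T.ends e.diag).2.diag)
  glue_symm := by
    rintro ⟨c, e⟩ ⟨c', e'⟩ h
    rcases hS : T.glue (c, e.diag) with h1 | h1 <;> simp [hS] at h
    obtain ⟨rfl, rfl⟩ := h
    simp [T.glue_symm _ _ hS]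
  glue_ne := by
    rintro ⟨c, e⟩ h
    rcases hS : T.glue (c, e.diag) with ⟨h1, h2⟩ | h1 <;> simp [hS] at h
    obtain ⟨rfl, rfl⟩ := h
    exact T.glue_ne _ (by simpa using hS)
  glue_eq_inr := by
    rintro ⟨c, e⟩ e'
    have h1 := T.glue_eq_inr (c, e.diag) e'.diag
    have h3 : ∀ a b : Corner, a.diag = b ↔ a = b.diag := by
      intro a b; cases a <;> cases b <;> simp [Corner.diag]
    rcases hS : T.glue (c, e.diag) with h2 | h2 <;> simp_all [Prod.ext_iff]

/-- The horizontal composite of `n + 1` copies of `[1]` (for `true`) or `[-1]` (for `false`). -/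
def twist (s : Bool) : ℕ → Tangle
  | 0 => cross s
  | n + 1 => (twist s n).horiz (cross s)

/-- The tangle `[k]` for a nonzero integer `k`.  The value at `0` is never used. -/
def int : ℤ → Tangle
  | .ofNat 0 => cross true
  | .ofNat (n + 1) => twist true n
  | .negSucc n => twist false n

/-- The tangle `T + [k]`; adding `[0]` does not change `T`. -/
def addInt (T : Tangle) : ℤ → Tangle
  | .ofNat 0 => T
  | .ofNat (n + 1) => T.horiz (int (.ofNat (n + 1)))
  | .negSucc n => T.horiz (int (.negSucc n))

/-- The inclusion of the crossings of `T` into those of `T + [k]`. -/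
def inclAddInt (T : Tangle) : (k : ℤ) → T.C → (T.addInt k).C
  | .ofNat 0 => id
  | .ofNat (_ + 1) => Sum.inl
  | .negSucc _ => Sum.inl

/-- The rational tangle `[[k₁], …, [kₛ]]`, where the list is `[kₛ, …, k₁]`: it is `[k₁]` for
`s = 1`, and in general it is obtained from `H = [[k₁], …, [kₛ₋₁]]` as `σ(H) + [kₛ]`.  Hence it is
`[k₁] ∗ [1/k₂] + [k₃] ∗ ⋯ + [kₛ]` for odd `s` and `[1/k₁] + [k₂] ∗ [1/k₃] + ⋯ + [kₛ]` for even
`s`.  The value at the empty list is never used. -/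
def rational : List ℤ → Tangle
  | [] => cross true
  | [k] => int k
  | k :: k' :: l => (rational (k' :: l)).sigma.addInt k

/-- A half-edge of the tangle `T i`, as a half-edge of a union of the tangles `T i`. -/
def port {m : ℕ} (T : Fin (m + 1) → Tangle) (i : Fin (m + 1)) (h : (T i).C × Corner) :
    (Σ i, (T i).C) × Corner :=
  (⟨i, h.1⟩, h.2)

theorem ends_injective {m : ℕ} (T : Fin (m + 1) → Tangle) {i j : Fin (m + 1)} {a b : Corner}
    (h : port T i ((T i).ends a) = port T j ((T j).ends b)) : i = j ∧ a = b := by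
  obtain rfl : i = j := congrArg (fun h => h.1.1) h
  simp only [port, Prod.mk.injEq, Sigma.mk.injEq, heq_eq_eq, true_and] at h
  have h1 := (T i).glue_ends a
  rw [Prod.ext h.1 h.2, (T i).glue_ends b] at h1
  exact ⟨rfl, (Sum.inr.inj h1).symm⟩

/-- The vertical composition `T 0 ∗ T 1 ∗ ⋯ ∗ T m`, with `T 0` at the top: the ends SW and SE of
`T i` are joined to the ends NW and NE of `T (i + 1)` for `i < m`. -/
def vertProd {m : ℕ} (T : Fin (m + 1) → Tangle) : Tangle where
  C := Σ i, (T i).C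
  finite := by
    have := fun i => (T i).finite
    infer_instance
  overNWSE c := (T c.1).overNWSE c.2
  glue h :=
    match (T h.1.1).glue (h.1.2, h.2) with
    | .inl h' => .inl (port T h.1.1 h')
    | .inr .nw =>
      if h.1.1 = 0 then .inr .nw else .inl (port T (h.1.1 - 1) ((T (h.1.1 - 1)).ends .sw))
    | .inr .ne =>
      if h.1.1 = 0 then .inr .ne else .inl (port T (h.1.1 - 1) ((T (h.1.1 - 1)).ends .se))
    | .inr .sw =>
      if h.1.1 = Fin.last m then .inr .sw
      else .inl (port T (h.1.1 + 1) ((T (h.1.1 + 1)).ends .nw))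
    | .inr .se =>
      if h.1.1 = Fin.last m then .inr .se
      else .inl (port T (h.1.1 + 1) ((T (h.1.1 + 1)).ends .ne))
  ends e :=
    match e with
    | .nw => port T 0 ((T 0).ends .nw)
    | .ne => port T 0 ((T 0).ends .ne)
    | .sw => port T (Fin.last m) ((T (Fin.last m)).ends .sw)
    | .se => port T (Fin.last m) ((T (Fin.last m)).ends .se)
  glue_symm := by
    have hend : ∀ i j e, i = j → port T i ((T i).ends e) = port T j ((T j).ends e) := by
      rintro i _ e rfl; rfl
    have hlast : ∀ i : Fin (m + 1), i ≠ 0 → i - 1 ≠ Fin.last m := by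
      intro i hi h
      apply hi
      have := congrArg (· + 1) h
      simpa using this
    have hzero : ∀ i : Fin (m + 1), i ≠ Fin.last m → i + 1 ≠ 0 := by
      intro i hi h
      apply hi
      have := congrArg (· - 1) h
      simp only [add_sub_cancel_right] at this
      rw [this, zero_sub]
      exact neg_eq_of_add_eq_zero_left (Fin.last_add_one m)
    rintro ⟨⟨i, c⟩, e⟩ h' h
    rcases hS : (T i).glue (c, e) with h1 | (_ | _ | _ | _) <;> simp only [hS] at h
    · cases h
      simp [port, (T i).glue_symm _ _ hS]
    all_goals
      split_ifs at h with hi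
      cases h
      have h2 := ((T i).glue_eq_inr _ _).1 hS
      simp only [port, glue_ends, Prod.mk.eta, hlast i, hzero i, hi, if_false, ne_eq,
        not_false_eq_true]
      have h3 : ((⟨i, c⟩, e) : (Σ i, (T i).C) × Corner) = port T i (c, e) := rfl
      rw [h3, ← h2]
      refine congrArg Sum.inl (hend _ _ _ ?_)
      simp
  glue_ne := by
    rintro ⟨⟨i, c⟩, e⟩ h
    rcases hS : (T i).glue (c, e) with h1 | (_ | _ | _ | _) <;> simp only [hS] at h
    · simp only [port, Sum.inl.injEq, Prod.mk.injEq, Sigma.mk.injEq, heq_eq_eq, true_and] at h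
      obtain ⟨rfl, rfl⟩ := h
      exact (T i).glue_ne _ hS
    all_goals
      split_ifs at h with hi
      have h2 := ((T i).glue_eq_inr _ _).1 hS
      have h3 : ((⟨i, c⟩, e) : (Σ i, (T i).C) × Corner) = port T i (c, e) := rfl
      rw [h3, ← h2] at h
      cases (ends_injective T (Sum.inl.inj h)).2
  glue_eq_inr := by
    rintro ⟨⟨i, c⟩, e⟩ e'
    have h3 : ((⟨i, c⟩, e) : (Σ i, (T i).C) × Corner) = port T i (c, e) := rfl
    rcases hS : (T i).glue (c, e) with h1 | e1
    · simp only [hS, reduceCtorEq, false_iff]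
      intro h
      have key : ∀ j a, port T j ((T j).ends a) = port T i (c, e) → False := by
        intro j a hja
        obtain rfl : j = i := congrArg (fun h => h.1.1) hja
        simp only [port, Prod.mk.injEq, Sigma.mk.injEq, heq_eq_eq, true_and] at hja
        have := ((T j).glue_eq_inr (c, e) a).2 (Prod.ext hja.1 hja.2)
        simp [hS] at this
      cases e' <;> exact key _ _ h
    · have h2 := ((T i).glue_eq_inr _ _).1 hS
      have h4 : port T i ((T i).ends e1) = (⟨i, c⟩, e) := by rw [h3, ← h2]
      cases e1 <;> cases e' <;> simp only [hS]
      all_goals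
        constructor
        · intro h
          split_ifs at h with hi
          all_goals first | (subst hi; exact h4) | cases h
        · intro h
          rw [← h4] at h
          obtain ⟨h5, h6⟩ := ends_injective T h
          first | (cases h6; done) | simp [← h5]

/-- The denominator `D(T)`: the ends NW and SW are joined, and so are NE and SE. -/
def denominator (T : Tangle) : LinkDiagram where
  C := T.C
  finite := T.finite
  overNWSE := T.overNWSE
  glue h :=
    match T.glue h with
    | .inl h' => h'
    | .inr e => T.ends e.flip
  glue_glue := by
    intro h
    rcases hT : T.glue h with h1 | h1
    · simp [T.glue_symm _ _ hT]
    · simp [glue_ends, (T.glue_eq_inr _ _).1 hT]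
  glue_ne := by
    intro h hh
    rcases hT : T.glue h with h1 | h1 <;> simp [hT] at hh
    · exact T.glue_ne _ (hh ▸ hT)
    · rw [← hh, glue_ends] at hT
      cases h1 <;> simp [Corner.flip] at hT

end Tangle

/-- `[kₛ, …, k₁]` is a continued fraction of the rational number `x`, that is,
`x = kₛ + 1 / (kₛ₋₁ + 1 / (⋯ + 1 / k₁))`, with no denominator equal to `0`. -/
def IsContFrac : List ℤ → ℚ → Prop
  | [], _ => False
  | [k], x => k ≠ 0 ∧ x = k
  | k :: k' :: l, x => ∃ y : ℚ, y ≠ 0 ∧ IsContFrac (k' :: l) y ∧ x = k + 1 / y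

/-! ### The functions of rational tangles -/

/-- The image under `Φ` of the arc at a half-edge `(c, e)`, directed away from the crossing `c`:
it is `t` when this direction agrees with the orientation, and `t⁻¹` otherwise.  In particular this
applies to the outward directed arcs at the four ends of a tangle. -/
noncomputable def phi {H : Type} (out : H → Bool) (h : H) : K := if out h then t else t⁻¹

/-- `[k]_a`, which is `1 + a + ⋯ + a ^ (k - 1)` for `k ≥ 0` and
`-a ^ k (1 + a + ⋯ + a ^ (|k| - 1))` for `k < 0`. -/
noncomputable def qInt (a : K) : ℤ → K
  | .ofNat n => ∑ i ∈ Finset.range n, a ^ i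
  | .negSucc n => -a ^ (Int.negSucc n) * ∑ i ∈ Finset.range (n + 1), a ^ i

/-- The value `z_v([k])` when the arcs at the ends NE and SE have the images `ne` and `se`: for
`k = 2h` it is `ne (se - 1) [h]_{ne se}`, for `k = 2h - 1` it is `(1 - se) [h]_{ne se} - 1`. -/
noncomputable def zvInt (k : ℤ) (ne se : K) : K :=
  if Even k then ne * (se - 1) * qInt (ne * se) (k / 2)
  else (1 - se) * qInt (ne * se) ((k + 1) / 2) - 1

/-- The pair `(z_h, z_v)` of the rational tangle with the list `[kₛ, …, k₁]`, oriented by `out`.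
For a one-term list it is `(1, z_v([k]))`.  Otherwise the tangle is `S + [k]` with `S = σ(H)`,
where `H` is the tangle of the remaining list, with the orientation for which the reflection with
reversal of all arcs `σ` takes it to `S`.  Then `z_h(S) = z_v(H)` and `z_v(S) = z_h(H)`, and
`z_h(S + [k]) = z_h(S) z_h([k])` and
`z_v(S + [k]) / z_h(S + [k]) = c₁ + (1 - sw) / (1 - se⁻¹) c₂ + (ne⁻¹ - se) / (1 - se) c₁ c₂`
with `c₁ = z_v(S) / z_h(S)`, `c₂ = z_v([k]) / z_h([k])`, and `ne`, `se`, `sw` the images of the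
outward directed arcs at the ends of `S`.  Here `z_h([k]) = 1`, and the last equation is multiplied
by `z_h(S + [k]) = z_h(S)`. -/
noncomputable def zPair : (l : List ℤ) → ((Tangle.rational l).C × Corner → Bool) → K × K
  | [], _ => (1, 1)
  | [k], out =>
    (1, zvInt k (phi out ((Tangle.rational [k]).ends .ne)) (phi out ((Tangle.rational [k]).ends .se)))
  | k :: k' :: l, out =>
    let H := Tangle.rational (k' :: l)
    let T := Tangle.rational (k :: k' :: l)
    let S := H.sigma
    let outS : S.C × Corner → Bool := fun h => out (S.inclAddInt k h.1, h.2)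
    let z := zPair (k' :: l) fun h => !outS (h.1, h.2.diag)
    let b := zvInt k (phi out (T.ends .ne)) (phi out (T.ends .se))
    let ne := phi outS (S.ends .ne)
    let se := phi outS (S.ends .se)
    let sw := phi outS (S.ends .sw)
    (z.2, z.1 + (1 - sw) / (1 - se⁻¹) * (z.2 * b) + (ne⁻¹ - se) / (1 - se) * (z.1 * b))

/-! ### Montesinos links -/

/-- The tangles `[p₁/q₁], …, [pᵣ/qᵣ]` (for `r = m + 1`) given by the lists `k i`. -/
abbrev tangles {m : ℕ} (k : Fin (m + 1) → List ℤ) (i : Fin (m + 1)) : Tangle :=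
  Tangle.rational (k i)

/-- The Montesinos link `D([p₁/q₁] ∗ ⋯ ∗ [pᵣ/qᵣ])`. -/
def montesinos {m : ℕ} (k : Fin (m + 1) → List ℤ) : LinkDiagram :=
  (Tangle.vertProd (tangles k)).denominator

/-- The orientation that an orientation of the Montesinos link induces on its `i`-th tangle. -/
def outOn {m : ℕ} {k : Fin (m + 1) → List ℤ} (o : (montesinos k).Orientation) (i : Fin (m + 1)) :
    (tangles k i).C × Corner → Bool :=
  fun h => o.out (Tangle.port (tangles k) i h)

/-- The function `z_h(pᵢ/qᵢ)` of the `i`-th tangle of an oriented Montesinos link. -/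
noncomputable def zh {m : ℕ} {k : Fin (m + 1) → List ℤ} (o : (montesinos k).Orientation)
    (i : Fin (m + 1)) : K :=
  (zPair (k i) (outOn o i)).1

/-- The function `z_v(pᵢ/qᵢ)` of the `i`-th tangle of an oriented Montesinos link. -/
noncomputable def zv {m : ℕ} {k : Fin (m + 1) → List ℤ} (o : (montesinos k).Orientation)
    (i : Fin (m + 1)) : K :=
  (zPair (k i) (outOn o i)).2

/-- The number of tangles with odd `p` and odd `q`. -/
def n₁ {m : ℕ} (x : Fin (m + 1) → ℚ) : ℕ :=
  (Finset.univ.filter fun i => Odd (x i).num ∧ Odd (x i).den).card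

/-- The number of tangles with even `p` (and odd `q`). -/
def n₀ {m : ℕ} (x : Fin (m + 1) → ℚ) : ℕ :=
  (Finset.univ.filter fun i => Even (x i).num).card

end MontesinosKnot

/-! The proof replaces Fox matrices by colourings. A colouring gives each half-edge an element of a
module over `ℤ[T;T⁻¹]`, constant along arcs, with one linear relation per crossing; that relation is
the Wirtinger relation up to a unit (`foxSum_relator_eq_zero_iff`). An Alexander minor then presents
the module of universal colourings in which one chosen arc has the colour `0`.

The clockwise product of the four outward arcs of a tangle is trivial in the group of the tangle.
Its Fox derivative is a relation between the colours of the ends. It follows from the relations of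
the crossings and can replace any one of them (`BoundaryRel`). Up to constants, the colourings of a
rational tangle are the multiples of one colouring `lam` that is `0` at NW (`IsGen`). Its values at
SW and NE are `z_h` and `-z_v` (`exists_isRatGen`): the reflection exchanges these two ends, adding
`[k]` extends the colouring in a forced way, and the colour at SE is eliminated by the relation
between the ends. This produces exactly the recursion that defines `z_h` and `z_v`.

A colouring of the knot is therefore one colour together with one coefficient `u i` for each tangle.
Closing up along the left-hand ends gives `∑ z_h u = 0`. Matching at the right-hand ends gives, for
`i < m`, relations with the coefficients `d i * z_v - c * z_h` at `u i` and `-(d (i + 1) * z_v)` at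
`u (i + 1)`, where the `d i` are units and `c` does not depend on `i`. The matching at the last
tangle is redundant. The determinant of this `chainMatrix` is elementary: `-c` times it is `∏ (d z_v
- c z_h) - ∏ d z_v`, and for `c = 0` it is `(∏ d z_v) * ∑ z_h / (d z_v)`.

Square matrices that present the same module have determinants dividing each other
(`det_dvd_det_of_relations`), and the units of `ℤ[T;T⁻¹]` are `± t ^ k`. It remains to find `c` and
`d` from the directions of the strands, which are governed by the parities of `p` and `q`
(`EndsCompatible`). In (a) both strands enter every tangle from above and `c = -t⁻²(t + 1)`. In (b)
they are antiparallel, `c = 0` and `d i = (1 - t ^ ε i) / (1 - t)`. Division by `z_v` is legitimate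
because at `t = -1` the quotient `z_v / z_h` becomes `p / q`. -/

namespace MontesinosKnot

open LaurentPolynomial

/-! ### Determinants of square presentation matrices -/

/-- If the rows of `B` generate the relations of the family `β`, the rows of `A` are relations
of the family `α`, and the two families span the same module, then `det B ∣ det A`. -/
theorem det_dvd_det_of_relations {R X ι κ : Type*} [CommRing R] [AddCommGroup X] [Module R X]
    [Fintype ι] [DecidableEq ι] [Fintype κ] [DecidableEq κ]
    (A : Matrix ι ι R) (B : Matrix κ κ R) (α : ι → X) (β : κ → X)
    (hA : ∀ i, ∑ j, A i j • α j = 0)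
    (hB : ∀ w : κ → R, ∑ j, w j • β j = 0 → ∃ y : κ → R, ∀ j, w j = ∑ i, y i * B i j)
    (hα : ∀ i, ∃ c : κ → R, α i = ∑ j, c j • β j)
    (hβ : ∀ i, ∃ c : ι → R, β i = ∑ j, c j • α j) : B.det ∣ A.det := by
  choose P hP using hα
  choose Q hQ using hβ
  have comp : ∀ (w : ι → R), ∑ i, w i • α i = ∑ j, (∑ i, w i * P i j) • β j := by
    intro w
    simp_rw [Finset.sum_smul, mul_smul]
    rw [Finset.sum_comm]
    simp_rw [← Finset.smul_sum, ← hP]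
  have h1 : ∀ i, ∃ y : κ → R, ∀ j, ∑ l, A i l * P l j = ∑ l, y l * B l j := by
    intro i
    exact hB _ (by rw [← comp, hA])
  choose Z hZ using h1
  -- Going from the `β` to the `α` and back expresses each `β i` through the `β j`, so the rows of
  -- `Q * P - 1` are relations of `β`.
  have h2 : ∀ i, ∃ y : κ → R, ∀ j, ∑ l, Q i l * P l j - (if i = j then 1 else 0)
      = ∑ l, y l * B l j := by
    intro i
    apply hB
    simp_rw [sub_smul, Finset.sum_sub_distrib, ← comp, ← hQ]
    simp
  choose V hV using h2
  have hZ' : A * Matrix.of P = Matrix.of Z * B := by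
    ext i j; simp [Matrix.mul_apply, hZ]
  have hV' : Matrix.of Q * Matrix.of P - 1 = Matrix.of V * B := by
    ext i j; simp [Matrix.mul_apply, ← hV, Matrix.one_apply]
  generalize Matrix.of P = P', Matrix.of Q = Q', Matrix.of V = V', Matrix.of Z = Z' at hZ' hV'
  -- The left side has determinant `det A`, the second factor on the right has determinant `det B`.
  have key : Matrix.fromBlocks A 0 (-Q') 1
      = Matrix.fromBlocks A Z' (-Q') (-V') * Matrix.fromBlocks 1 (-P') 0 B := by
    rw [Matrix.fromBlocks_multiply]
    congr 1
    · simp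
    · simp [hZ']
    · simp
    · simp [← hV']
  have := congrArg Matrix.det key
  rw [Matrix.det_mul, Matrix.det_fromBlocks_zero₁₂, Matrix.det_fromBlocks_zero₂₁] at this
  simp only [Matrix.det_one, one_mul, mul_one] at this
  exact ⟨_, by rw [this, mul_comm]⟩

/-- The quotient of `R ^ ι` by the rows of `A`. -/
abbrev RowQuotient {R ι κ : Type*} [CommRing R] (A : Matrix κ ι R) : Type _ :=
  (ι → R) ⧸ Submodule.span R (Set.range fun k : κ => A k)

/-- The generators of the quotient of `R ^ ι` by the rows of `A`. -/
def RowQuotient.gen {R ι κ : Type*} [CommRing R] [DecidableEq ι] (A : Matrix κ ι R) (i : ι) :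
    RowQuotient A :=
  Submodule.Quotient.mk (Pi.single i 1)

namespace RowQuotient

variable {R ι κ : Type*} [CommRing R] [Fintype ι] [DecidableEq ι] (A : Matrix κ ι R)

theorem sum_smul_gen (w : ι → R) :
    ∑ i, w i • gen A i = Submodule.Quotient.mk w := by
  have h : w = ∑ i, w i • (Pi.single i 1 : ι → R) := by
    ext j; simp [Finset.sum_apply, Pi.single_apply]
  conv_rhs => rw [h]
  change _ = Submodule.mkQ _ _
  rw [map_sum]
  rfl

theorem sum_row (k : κ) : ∑ i, A k i • gen A i = 0 := by
  rw [sum_smul_gen, Submodule.Quotient.mk_eq_zero]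
  exact Submodule.subset_span ⟨k, rfl⟩

theorem exists_eq_sum (z : RowQuotient A) : ∃ c : ι → R, z = ∑ i, c i • gen A i := by
  obtain ⟨w, rfl⟩ := Submodule.Quotient.mk_surjective _ z
  exact ⟨w, (sum_smul_gen A w).symm⟩

theorem relation_of_sum_eq_zero [Fintype κ] (w : ι → R) (hw : ∑ i, w i • gen A i = 0) :
    ∃ y : κ → R, ∀ j, w j = ∑ i, y i * A i j := by
  rw [sum_smul_gen, Submodule.Quotient.mk_eq_zero, Submodule.mem_span_range_iff_exists_fun] at hw
  obtain ⟨y, hy⟩ := hw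
  exact ⟨y, fun j => by rw [← hy]; simp [Finset.sum_apply]⟩

end RowQuotient

/-! ### Units of the ring of Laurent polynomials -/

/-- The units of `ℤ[t, t⁻¹]` are `± t ^ k`. -/
theorem eq_T_or_neg_of_isUnit {f : ℤ[T;T⁻¹]} (hf : IsUnit f) : ∃ k : ℤ, f = T k ∨ f = -T k := by
  obtain ⟨g, hg⟩ := hf.exists_right_inv
  obtain ⟨a, p, hp⟩ := exists_T_pow f
  obtain ⟨b, q, hq⟩ := exists_T_pow g
  -- After clearing denominators, a unit and its inverse become polynomials whose product is a power
  -- of the prime `X`. Hence `p` is a power of `X` times a unit of `ℤ[X]`, that is, up to sign.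
  have hpq : p * q = Polynomial.X ^ (a + b) := by
    apply Polynomial.toLaurent_injective
    rw [map_mul, hp, hq, Polynomial.toLaurent_X_pow, mul_mul_mul_comm, hg, ← T_add]
    push_cast
    rw [one_mul]
  obtain ⟨i, -, hi⟩ := (dvd_prime_pow Polynomial.prime_X (a + b)).1 ⟨q, hpq.symm⟩
  obtain ⟨u, hu⟩ := hi.symm
  obtain ⟨r, hr, hru⟩ := Polynomial.isUnit_iff.1 u.isUnit
  have hf' : f = Polynomial.toLaurent p * T (-a) := by
    rw [hp, mul_assoc, ← T_add]; simp
  rw [← hu, ← hru, map_mul, Polynomial.toLaurent_X_pow, Polynomial.toLaurent_C] at hf'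
  refine ⟨i - a, ?_⟩
  rw [sub_eq_add_neg, T_add]
  rcases Int.isUnit_iff.1 hr with rfl | rfl
  · left; rw [hf', map_one, mul_one]
  · right; rw [hf', map_neg, map_one, mul_neg, mul_one, neg_mul]

theorem algebraMap_T (k : ℤ) : algebraMap ℤ[T;T⁻¹] K (T k) = t ^ k := by
  have hu : ∀ k : ℤ, (T k : ℤ[T;T⁻¹]) = ((tUnit ^ k : ℤ[T;T⁻¹]ˣ) : ℤ[T;T⁻¹]) := by
    intro k
    induction k with
    | zero => simp
    | succ n ih => rw [zpow_add_one, T_add, ih]; rfl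
    | pred n ih => rw [zpow_sub_one, sub_eq_add_neg, T_add, ih]; rfl
  rw [hu]
  have := map_zpow (Units.map (algebraMap ℤ[T;T⁻¹] K).toMonoidHom) tUnit k
  have h2 := congrArg Units.val this
  rw [Units.val_zpow_eq_zpow_val] at h2
  exact h2

theorem t_ne_zero : t ≠ 0 := by
  intro h0
  have := algebraMap_T 1
  rw [h0, zpow_one] at this
  have h3 := FaithfulSMul.algebraMap_injective ℤ[T;T⁻¹] K (this.trans (map_zero _).symm)
  exact (isUnit_T (R := ℤ) 1).ne_zero h3

theorem dotEq_of_associated {f : K} {a b : ℤ[T;T⁻¹]} (h : Associated a b)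
    (hf : DotEq f (algebraMap _ K b)) : DotEq f (algebraMap _ K a) := by
  obtain ⟨u, rfl⟩ := h
  obtain ⟨k, hk⟩ := hf
  obtain ⟨j, hj | hj⟩ := eq_T_or_neg_of_isUnit u.isUnit
  all_goals
    rw [hj] at hk
    simp only [map_mul, map_neg, algebraMap_T] at hk
    refine ⟨k + j, ?_⟩
    have ht := t_ne_zero
    rw [zpow_add₀ ht]
    rcases hk with rfl | rfl
  · left; ring
  · right; ring
  · right; ring
  · left; ring

/-! ### The determinant of the presentation matrix of a Montesinos knot -/

/-- The matrix with the rows `p i • e i - v (i + 1) • e (i + 1)` for `i < m` and the last row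
`h`. -/
def chainMatrix {R : Type*} [CommRing R] {m : ℕ} (p v h : Fin (m + 1) → R) :
    Matrix (Fin (m + 1)) (Fin (m + 1)) R :=
  Matrix.of fun i j =>
    if i = Fin.last m then h j
    else (if j = i then p i else 0) - (if j = i + 1 then v j else 0)

section
variable {R : Type*} [CommRing R] {m : ℕ}

theorem chainMatrix_map {S : Type*} [CommRing S] (e : R →+* S) (p v h : Fin (m + 1) → R) :
    (chainMatrix p v h).map e = chainMatrix (e ∘ p) (e ∘ v) (e ∘ h) := by
  ext i j
  simp only [chainMatrix, Matrix.map_apply, Matrix.of_apply, Function.comp]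
  split_ifs <;> simp

/-- Laplace expansion along the first column, which is zero except at the top and at the bottom.
Deleting the last row leaves a lower triangular matrix with the diagonal `-v i.succ`, whose sign
cancels that of the cofactor. -/
theorem det_chainMatrix_succ (p v h : Fin (m + 2) → R) :
    (chainMatrix p v h).det = p 0 * (chainMatrix (fun i => p i.succ) (fun i => v i.succ)
      (fun i => h i.succ)).det + h 0 * ∏ i : Fin (m + 1), v i.succ := by
  rw [Matrix.det_succ_column_zero, Fin.sum_univ_succ, Fin.sum_univ_castSucc]
  have hz : ∀ i : Fin m, chainMatrix p v h (i.castSucc).succ 0 = 0 := by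
    intro i
    have h1 : (i.castSucc).succ ≠ Fin.last (m + 1) := by
      rw [← Fin.succ_last]; intro h; exact (Fin.castSucc_lt_last i).ne (Fin.succ_injective _ h)
    have h2 : (0 : Fin (m + 2)) ≠ (i.castSucc).succ + 1 := by
      rw [Fin.succ_castSucc, Fin.coeSucc_eq_succ]
      exact (Fin.succ_ne_zero _).symm
    simp [chainMatrix, h1, h2, (Fin.succ_ne_zero _).symm]
  have h0 : (0 : Fin (m + 2)) ≠ Fin.last (m + 1) := Fin.last_pos.ne
  have hlast : chainMatrix p v h (Fin.last m).succ 0 = h 0 := by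
    simp [chainMatrix]
  have hfirst : chainMatrix p v h 0 0 = p 0 := by
    simp [chainMatrix, h0]
  have hsub0 : (chainMatrix p v h).submatrix (Fin.succAbove 0) Fin.succ
      = chainMatrix (fun i => p i.succ) (fun i => v i.succ) (fun i => h i.succ) := by
    ext i j
    simp only [Fin.zero_succAbove, Matrix.submatrix_apply, chainMatrix, Matrix.of_apply,
      ← Fin.succ_last, Fin.succ_inj]
    by_cases hi : i = Fin.last m
    · simp [hi]
    · obtain ⟨i, rfl⟩ := Fin.exists_castSucc_eq.2 hi
      simp only [if_neg hi, Fin.coeSucc_eq_succ, Fin.succ_castSucc, Fin.succ_inj]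
  have hsub1 : ((chainMatrix p v h).submatrix (Fin.succAbove (Fin.last m).succ) Fin.succ).det
      = ∏ i : Fin (m + 1), - v i.succ := by
    rw [Matrix.det_of_isLowerTriangular]
    · refine Finset.prod_congr rfl fun i _ => ?_
      simp [Fin.succ_last, Fin.succAbove_last, chainMatrix, Fin.coeSucc_eq_succ,
        (Fin.castSucc_lt_last i).ne, (Fin.castSucc_lt_succ (i := i)).ne']
    · intro i j hij
      have hij' : i < j := hij
      have h1 : j.succ ≠ i.castSucc := fun h => by
        have := congrArg Fin.val h
        simp at this
        omega
      simp [Fin.succ_last, Fin.succAbove_last, chainMatrix, Fin.coeSucc_eq_succ,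
        (Fin.castSucc_lt_last i).ne, h1, hij'.ne']
  rw [hsub0, hsub1, hlast, hfirst, Finset.prod_neg]
  simp only [hz, mul_zero, zero_mul, Finset.sum_const_zero, zero_add, Finset.card_univ,
    Fintype.card_fin, Fin.val_zero, pow_zero, one_mul, Fin.val_succ, Fin.val_last]
  have : (-1 : R) ^ (m + 1) * (-1) ^ (m + 1) = 1 := by
    rw [← mul_pow]; simp
  linear_combination (h 0 * ∏ i : Fin (m + 1), v i.succ) * this

/-- Since `c * h 0 = p 0 - v 0`, the expansion along the first column telescopes. Multiplying by `c`
avoids any division in `R`. -/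
theorem mul_det_chainMatrix (c : R) (p v h : Fin (m + 1) → R) (hp : ∀ i, p i = v i + c * h i) :
    c * (chainMatrix p v h).det = ∏ i, p i - ∏ i, v i := by
  induction m with
  | zero => simp [chainMatrix, hp]
  | succ m ih =>
    rw [det_chainMatrix_succ, mul_add, mul_left_comm, ih _ _ _ fun i => hp i.succ,
      Fin.prod_univ_succ p, Fin.prod_univ_succ v]
    linear_combination -(∏ i : Fin (m + 1), v i.succ) * hp 0

/-- The degenerate case `p = v`, in which the difference quotient of the products turns into a
logarithmic derivative. -/
theorem det_chainMatrix_self {F : Type*} [Field F] (v h : Fin (m + 1) → F) (hv : ∀ i, v i ≠ 0) :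
    (chainMatrix v v h).det = (∏ i, v i) * ∑ i, h i / v i := by
  induction m with
  | zero => simp [chainMatrix, mul_div_cancel₀, hv]
  | succ m ih =>
    rw [det_chainMatrix_succ, ih _ _ fun i => hv i.succ, Fin.prod_univ_succ v,
      Fin.sum_univ_succ fun i => h i / v i]
    have := hv 0
    generalize ∑ i : Fin (m + 1), h i.succ / v i.succ = s
    field_simp
    ring

end

/-! ### Fox derivatives of the Wirtinger relators -/

section Fox

variable {α : Type}

theorem Phi_of_mul (v w : FreeGroup α) : Phi (MonoidAlgebra.of ℤ _ (v * w))
    = Phi (MonoidAlgebra.of ℤ _ v) * Phi (MonoidAlgebra.of ℤ _ w) := by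
  rw [map_mul, map_mul]

theorem Phi_of_of (x : α) :
    Phi (MonoidAlgebra.of ℤ (FreeGroup α) (FreeGroup.of x)) = ((tUnit : ℤ[T;T⁻¹]ˣ) : ℤ[T;T⁻¹]) := by
  simp [Phi]

theorem Phi_of_inv (x : α) :
    Phi (MonoidAlgebra.of ℤ (FreeGroup α) (FreeGroup.of x)⁻¹) = ((tUnit⁻¹ : ℤ[T;T⁻¹]ˣ) : ℤ[T;T⁻¹]) := by
  simp [Phi]

variable {X : Type} [AddCommGroup X] [Module ℤ[T;T⁻¹] X] {ι : Type} [Fintype ι]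

/-- The linear combination of the elements `f a` with the coefficients `Φ (∂w/∂a)`. -/
noncomputable def foxSum (x : ι ≃ α) (f : α → X) (w : FreeGroup α) : X :=
  ∑ j, Phi (foxDeriv (x j) w) • f (x j)

theorem foxSum_mul (x : ι ≃ α) (f : α → X) (v w : FreeGroup α) :
    foxSum x f (v * w) = foxSum x f v + Phi (MonoidAlgebra.of ℤ _ v) • foxSum x f w := by
  simp only [foxSum, foxDeriv_mul, map_add, map_mul, add_smul, mul_smul, Finset.sum_add_distrib,
    Finset.smul_sum]

theorem foxSum_of (x : ι ≃ α) (f : α → X) (a : α) : foxSum x f (FreeGroup.of a) = f a := by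
  classical
  simp only [foxSum, foxDeriv_of]
  rw [Finset.sum_eq_single (x.symm a)]
  · simp
  · intro j _ hj
    rw [if_neg, map_zero, zero_smul]
    rintro rfl
    simp at hj
  · simp

theorem foxSum_one (x : ι ≃ α) (f : α → X) : foxSum x f 1 = 0 := by
  have := foxSum_mul x f 1 1
  rw [mul_one, map_one, map_one, one_smul] at this
  exact left_eq_add.1 this

theorem foxSum_inv (x : ι ≃ α) (f : α → X) (a : α) :
    foxSum x f (FreeGroup.of a)⁻¹ = -((tUnit⁻¹ : ℤ[T;T⁻¹]ˣ) : ℤ[T;T⁻¹]) • f a := by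
  have := foxSum_mul x f (FreeGroup.of a)⁻¹ (FreeGroup.of a)
  rw [inv_mul_cancel, foxSum_one, foxSum_of, Phi_of_inv] at this
  rw [neg_smul]
  exact eq_neg_of_add_eq_zero_left this.symm

end Fox

/-! ### Colourings of tangles -/

section Boundary

variable {R : Type} [CommRing R] (τ : Rˣ)

/-- The image `τ` or `τ⁻¹` of an outward directed arc. -/
def mer (b : Bool) : Rˣ := bif b then τ else τ⁻¹

/-- The Fox derivative of an outward directed arc, that is, `(mer τ b - 1) / (τ - 1)`. -/
def foxEnd (b : Bool) : Rˣ := bif b then 1 else -τ⁻¹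

theorem mer_not (b : Bool) : mer τ (!b) = (mer τ b)⁻¹ := by cases b <;> simp [mer]

theorem foxEnd_not (b : Bool) : foxEnd τ (!b) = -((mer τ b)⁻¹ * foxEnd τ b) := by
  cases b <;> simp [mer, foxEnd]

/-- The fundamental formula of Fox calculus for a single letter. It converts Fox coefficients into
the factors `1 - t_e` of the recursion for `z_v`. -/
theorem sub_one_mul_foxEnd (b : Bool) : ((τ : R) - 1) * foxEnd τ b = mer τ b - 1 := by
  cases b <;> simp [mer, foxEnd, sub_mul]

variable {X : Type} [AddCommGroup X] [Module R X]

/-- The value, for a colouring `f` of four ends, of the Fox derivative of the product of the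
outward directed arcs in clockwise order. -/
def boundarySum (out : Corner → Bool) (f : Corner → X) : X :=
  (foxEnd τ (out .nw) : R) • f .nw + (mer τ (out .nw) * foxEnd τ (out .ne) : R) • f .ne
    + (mer τ (out .nw) * mer τ (out .ne) * foxEnd τ (out .se) : R) • f .se
    + (mer τ (out .nw) * mer τ (out .ne) * mer τ (out .se) * foxEnd τ (out .sw) : R) • f .sw

/-- The image of the product of the outward directed arcs. -/
def boundaryProd (out : Corner → Bool) : Rˣ :=
  mer τ (out .nw) * mer τ (out .ne) * mer τ (out .se) * mer τ (out .sw)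

/-- Write `w₁ = nw ne se sw` and `w₂` for the boundary words of the summands. The letters at the
seam are inverse to each other, so the boundary word of the sum is `nw ne · w₂ · se sw`. Since `w₂`
has image `1`, the product rule gives the derivative of `w₁` plus the image of `nw ne` times that of
`w₂`. -/
theorem boundarySum_horiz (o₁ o₂ o : Corner → Bool) (f₁ f₂ f : Corner → X)
    (hn : o₂ .nw = !o₁ .ne) (hs : o₂ .sw = !o₁ .se) (fn : f₁ .ne = f₂ .nw) (fs : f₁ .se = f₂ .sw)
    (h₂ : boundaryProd τ o₂ = 1)
    (o1 : o .nw = o₁ .nw) (o2 : o .sw = o₁ .sw) (o3 : o .ne = o₂ .ne) (o4 : o .se = o₂ .se)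
    (f1 : f .nw = f₁ .nw) (f2 : f .sw = f₁ .sw) (f3 : f .ne = f₂ .ne) (f4 : f .se = f₂ .se) :
    boundarySum τ o f
      = boundarySum τ o₁ f₁ + (mer τ (o₁ .nw) * mer τ (o₁ .ne) : R) • boundarySum τ o₂ f₂ := by
  simp only [boundarySum, boundaryProd, o1, o2, o3, o4, f1, f2, f3, f4, hn, hs, fn, fs, mer_not,
    foxEnd_not] at h₂ ⊢
  have h1 : ((mer τ (o₁ .ne) : Rˣ) : R) * ((mer τ (o₁ .ne))⁻¹ : Rˣ) = 1 := Units.mul_inv _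
  have h3 : ((mer τ (o₁ .se) : Rˣ) : R) * ((mer τ (o₁ .se))⁻¹ : Rˣ) = 1 := Units.mul_inv _
  have h4 := congrArg Units.val h₂
  push_cast at h4 ⊢
  generalize ((mer τ (o₁ .ne))⁻¹ : Rˣ).val = a' at *
  generalize ((mer τ (o₁ .se))⁻¹ : Rˣ).val = b' at *
  generalize (mer τ (o₁ .ne)).val = a at *
  generalize (mer τ (o₁ .se)).val = b at *
  generalize (mer τ (o₂ .ne)).val = c at *
  generalize (mer τ (o₂ .se)).val = d at *
  generalize (mer τ (o₁ .nw)).val = p at *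
  generalize (foxEnd τ (o₁ .sw)).val = q at *
  generalize (foxEnd τ (o₁ .se)).val = r at *
  generalize (foxEnd τ (o₂ .se)).val = s at *
  generalize (foxEnd τ (o₁ .ne)).val = u at *
  generalize (foxEnd τ (o₂ .ne)).val = v at *
  have e1 : c * d = a * b := by linear_combination (a * b) * h4 - c * d * h1 - a * a' * c * d * h3
  match_scalars
  · ring
  · linear_combination (-p * v) * h1
  · linear_combination (-p * c * s) * h1
  · linear_combination p * q * e1
  · linear_combination (p * u) * h1
  · linear_combination (p * a * r) * h4

/-- Reflection reverses the cyclic order and reversal of the arcs inverts the letters. The new word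
is `nw⁻¹ w⁻¹ nw` for the old word `w`, and `w` has image `1`; so the derivative only acquires a unit
factor. -/
theorem boundarySum_diag (out : Corner → Bool) (f : Corner → X) (h : boundaryProd τ out = 1) :
    boundarySum τ (fun e => !out e.diag) (fun e => f e.diag)
      = (-((mer τ (out .nw))⁻¹ : Rˣ) : R) • boundarySum τ out f := by
  simp only [boundarySum, boundaryProd, Corner.diag, mer_not, foxEnd_not] at h ⊢
  have h1 : ((mer τ (out .ne) : Rˣ) : R) * ((mer τ (out .ne))⁻¹ : Rˣ) = 1 := Units.mul_inv _
  have h2 : ((mer τ (out .se) : Rˣ) : R) * ((mer τ (out .se))⁻¹ : Rˣ) = 1 := Units.mul_inv _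
  have h3 : ((mer τ (out .nw) : Rˣ) : R) * ((mer τ (out .nw))⁻¹ : Rˣ) = 1 := Units.mul_inv _
  have h5 : ((mer τ (out .sw) : Rˣ) : R) * ((mer τ (out .sw))⁻¹ : Rˣ) = 1 := Units.mul_inv _
  have h4 := congrArg Units.val h
  push_cast at h4 ⊢
  generalize ((mer τ (out .ne))⁻¹ : Rˣ).val = b' at *
  generalize ((mer τ (out .se))⁻¹ : Rˣ).val = c' at *
  generalize ((mer τ (out .sw))⁻¹ : Rˣ).val = d' at *
  generalize ((mer τ (out .nw))⁻¹ : Rˣ).val = a' at *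
  generalize (mer τ (out .ne)).val = b at *
  generalize (mer τ (out .se)).val = c at *
  generalize (mer τ (out .sw)).val = d at *
  generalize (mer τ (out .nw)).val = a at *
  have e1 : d' = a * b * c := by linear_combination -d' * h4 + a * b * c * h5
  have e2 : a' * d' * c' = b := by
    rw [e1]; linear_combination b * c * c' * h3 + b * h2
  match_scalars
  · ring
  · linear_combination (-a' * foxEnd τ (out .sw)) * e1
  · linear_combination (-foxEnd τ (out .se) : R) * (e2 - b * h3)
  · linear_combination (-foxEnd τ (out .ne) : R) * (b' * e2 + h1 - h3)

/-- The relation of a crossing with over-strand NW-SE. -/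
theorem boundarySum_of_se_eq_nw (out : Corner → Bool) (f : Corner → X)
    (h1 : out .se = !out .nw) (h2 : out .sw = !out .ne) (hf : f .se = f .nw) :
    boundarySum τ out f = (mer τ (out .nw) * foxEnd τ (out .ne) : R) •
      (f .ne - f .nw - (mer τ (out .se) : R) • (f .sw - f .nw)) := by
  simp only [boundarySum, h1, h2, hf]
  have h : (τ : R) * ((τ⁻¹ : Rˣ) : R) = 1 := Units.mul_inv _
  cases out .nw <;> cases out .ne <;> simp [mer, foxEnd] <;> generalize (τ⁻¹ : Rˣ).val = a at * <;>
    generalize (τ : Rˣ).val = b at * <;> match_scalars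
  all_goals first
    | ring1
    | linear_combination h
    | linear_combination -h
    | linear_combination a * h
    | linear_combination -a * h

/-- The relation of a crossing with over-strand NE-SW. -/
theorem boundarySum_of_sw_eq_ne (out : Corner → Bool) (f : Corner → X)
    (h1 : out .se = !out .nw) (h2 : out .sw = !out .ne) (hf : f .sw = f .ne) :
    boundarySum τ out f = (foxEnd τ (out .nw) : R) •
      (f .nw - f .ne - (mer τ (out .ne) : R) • (f .se - f .ne)) := by
  simp only [boundarySum, h1, h2, hf]
  have h : (τ : R) * ((τ⁻¹ : Rˣ) : R) = 1 := Units.mul_inv _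
  cases out .nw <;> cases out .ne <;> simp [mer, foxEnd] <;> generalize (τ⁻¹ : Rˣ).val = a at * <;>
    generalize (τ : Rˣ).val = b at * <;> match_scalars
  all_goals first
    | ring1
    | linear_combination h
    | linear_combination -h

end Boundary

namespace Tangle

variable {T S U : Tangle}

/-- An orientation of a tangle: `out h` says that the strand through the half-edge `h = (c, e)` is
directed away from the crossing `c`. -/
structure IsOri (T : Tangle) (out : T.C × Corner → Bool) : Prop where
  glue : ∀ h h', T.glue h = .inl h' → out h' = !out h
  opp : ∀ c e, out (c, e.opp) = !out (c, e)

/-- A function on the half-edges that is constant on the arcs. -/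
structure PreCol {X : Type} (T : Tangle) (f : T.C × Corner → X) : Prop where
  glue : ∀ h h', T.glue h = .inl h' → f h' = f h
  strand : ∀ c e, e.onNWSE = T.overNWSE c → f (c, e.opp) = f (c, e)

section

variable {R : Type} [CommRing R] (τ : Rˣ) {X : Type} [AddCommGroup X] [Module R X]

/-- The relation of the crossing `c` holds for the function `f` on the half-edges. -/
def RelAt {C : Type} (out : C × Corner → Bool) (f : C × Corner → X) (c : C) : Prop :=
  boundarySum τ (fun e => out (c, e)) (fun e => f (c, e)) = 0

/-- An Alexander colouring of an oriented tangle. -/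
structure IsCol (T : Tangle) (out : T.C × Corner → Bool) (f : T.C × Corner → X) : Prop
    extends PreCol T f where
  rel : ∀ c, RelAt τ out f c

/-- The relation between the four ends of a tangle is a consequence of the relations of the
crossings, and it can replace any of them. -/
structure BoundaryRel (T : Tangle) (out : T.C × Corner → Bool) : Prop where
  prod : boundaryProd τ (fun e => out (T.ends e)) = 1
  sum : ∀ (X : Type) [AddCommGroup X] [Module R X] (f : T.C × Corner → X), PreCol T f →
    (∀ c, RelAt τ out f c) → boundarySum τ (fun e => out (T.ends e)) (fun e => f (T.ends e)) = 0
  rel : ∀ (X : Type) [AddCommGroup X] [Module R X] (f : T.C × Corner → X) (c₀ : T.C), PreCol T f →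
    (∀ c, c ≠ c₀ → RelAt τ out f c) →
    boundarySum τ (fun e => out (T.ends e)) (fun e => f (T.ends e)) = 0 → RelAt τ out f c₀

end

/-! #### Half-edges of horizontal compositions and reflections -/

/-- A half-edge of `S` as a half-edge of `S + U`. -/
def inL (S U : Tangle) (h : S.C × Corner) : (S.horiz U).C × Corner := (.inl h.1, h.2)

/-- A half-edge of `U` as a half-edge of `S + U`. -/
def inR (S U : Tangle) (h : U.C × Corner) : (S.horiz U).C × Corner := (.inr h.1, h.2)

/-- The half-edge of `T` that is reflected to a half-edge of `σ(T)`. -/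
def mirror (T : Tangle) (h : T.C × Corner) : T.C × Corner := (h.1, h.2.diag)

theorem glue_inL {h h' : S.C × Corner} (hh : S.glue h = .inl h') :
    (S.horiz U).glue (inL S U h) = .inl (inL S U h') := by
  simp [horiz, inL, hh]

theorem glue_inR {h h' : U.C × Corner} (hh : U.glue h = .inl h') :
    (S.horiz U).glue (inR S U h) = .inl (inR S U h') := by
  simp [horiz, inR, hh]

theorem glue_inL_ne : (S.horiz U).glue (inL S U (S.ends .ne)) = .inl (inR S U (U.ends .nw)) := by
  simp [horiz, inL, inR, glue_ends]

theorem glue_inL_se : (S.horiz U).glue (inL S U (S.ends .se)) = .inl (inR S U (U.ends .sw)) := by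
  simp [horiz, inL, inR, glue_ends]

/-- Up to symmetry, an inner edge of a sum is an inner edge of a summand or one of the two edges at
the seam. -/
theorem horiz_induction {P : (S.horiz U).C × Corner → (S.horiz U).C × Corner → Prop}
    (hsymm : ∀ a b, P a b → P b a)
    (hL : ∀ h h', S.glue h = .inl h' → P (inL S U h) (inL S U h'))
    (hR : ∀ h h', U.glue h = .inl h' → P (inR S U h) (inR S U h'))
    (hn : P (inL S U (S.ends .ne)) (inR S U (U.ends .nw)))
    (hs : P (inL S U (S.ends .se)) (inR S U (U.ends .sw)))
    (h h') (hh : (S.horiz U).glue h = .inl h') : P h h' := by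
  have aux : ∀ (V : Tangle) e h, V.glue h = .inr e → h = V.ends e :=
    fun V e h hh => ((V.glue_eq_inr h e).1 hh).symm
  obtain ⟨c | c, e⟩ := h
  · rcases hS : S.glue (c, e) with h1 | e1
    · have := glue_inL (U := U) hS
      rw [show inL S U (c, e) = (.inl c, e) from rfl, hh] at this
      cases this
      exact hL _ _ hS
    · have h2 := aux _ _ _ hS
      have h3 : ((Sum.inl c, e) : (S.horiz U).C × Corner) = inL S U (S.ends e1) := by
        rw [← h2]; rfl
      replace hh : (S.horiz U).glue (inL S U (S.ends e1)) = .inl h' := h3 ▸ hh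
      change P ((Sum.inl c, e) : (S.horiz U).C × Corner) h'
      rw [h3]
      cases e1
      · simp [horiz, inL, glue_ends] at hh
      · rw [glue_inL_ne] at hh; cases hh; exact hn
      · simp [horiz, inL, glue_ends] at hh
      · rw [glue_inL_se] at hh; cases hh; exact hs
  · rcases hS : U.glue (c, e) with h1 | e1
    · have := glue_inR (S := S) hS
      rw [show inR S U (c, e) = (.inr c, e) from rfl, hh] at this
      cases this
      exact hR _ _ hS
    · have h2 := aux _ _ _ hS
      have h3 : ((Sum.inr c, e) : (S.horiz U).C × Corner) = inR S U (U.ends e1) := by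
        rw [← h2]; rfl
      replace hh : (S.horiz U).glue (inR S U (U.ends e1)) = .inl h' := h3 ▸ hh
      change P ((Sum.inr c, e) : (S.horiz U).C × Corner) h'
      rw [h3]
      cases e1
      · rw [(S.horiz U).glue_symm _ _ glue_inL_ne] at hh; cases hh; exact hsymm _ _ hn
      · simp [horiz, inR, glue_ends] at hh
      · rw [(S.horiz U).glue_symm _ _ glue_inL_se] at hh; cases hh; exact hsymm _ _ hs
      · simp [horiz, inR, glue_ends] at hh

theorem isOri_horiz {out : (S.horiz U).C × Corner → Bool} :
    IsOri (S.horiz U) out ↔ IsOri S (fun h => out (inL S U h)) ∧ IsOri U (fun h => out (inR S U h)) ∧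
      out (inR S U (U.ends .nw)) = !out (inL S U (S.ends .ne)) ∧
      out (inR S U (U.ends .sw)) = !out (inL S U (S.ends .se)) := by
  constructor
  · intro h
    exact ⟨⟨fun a b hab => h.glue _ _ (glue_inL hab), fun c e => h.opp (.inl c) e⟩,
      ⟨fun a b hab => h.glue _ _ (glue_inR hab), fun c e => h.opp (.inr c) e⟩,
      h.glue _ _ glue_inL_ne, h.glue _ _ glue_inL_se⟩
  · rintro ⟨h1, h2, h3, h4⟩
    refine ⟨horiz_induction ?_ h1.glue h2.glue h3 h4, ?_⟩
    · intro a b hab; rw [hab]; simp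
    · rintro (c | c) e
      · exact h1.opp c e
      · exact h2.opp c e

theorem preCol_horiz {X : Type} {f : (S.horiz U).C × Corner → X} :
    PreCol (S.horiz U) f ↔ PreCol S (fun h => f (inL S U h)) ∧ PreCol U (fun h => f (inR S U h)) ∧
      f (inR S U (U.ends .nw)) = f (inL S U (S.ends .ne)) ∧
      f (inR S U (U.ends .sw)) = f (inL S U (S.ends .se)) := by
  constructor
  · intro h
    exact ⟨⟨fun a b hab => h.glue _ _ (glue_inL hab), fun c e => h.strand (.inl c) e⟩,
      ⟨fun a b hab => h.glue _ _ (glue_inR hab), fun c e => h.strand (.inr c) e⟩,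
      h.glue _ _ glue_inL_ne, h.glue _ _ glue_inL_se⟩
  · rintro ⟨h1, h2, h3, h4⟩
    refine ⟨horiz_induction ?_ h1.glue h2.glue h3 h4, ?_⟩
    · intro a b hab; rw [hab]
    · rintro (c | c) e
      · exact h1.strand c e
      · exact h2.strand c e

theorem glue_mirror {h h' : T.C × Corner} (hh : T.glue h = .inl h') :
    T.sigma.glue (mirror T h) = .inl (mirror T h') := by
  simp [sigma, mirror, hh]

theorem mirror_mirror (h : T.C × Corner) : mirror T (mirror T h) = h := by
  simp [mirror]

theorem sigma_glue {h h' : T.C × Corner} (hh : T.sigma.glue h = .inl h') :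
    T.glue (mirror T h) = .inl (mirror T h') := by
  have : T.sigma.glue h = (T.glue (mirror T h)).map (mirror T) Corner.diag := rfl
  rw [this] at hh
  rcases hT : T.glue (mirror T h) with h1 | h1
  · rw [hT] at hh
    cases hh
    rw [mirror_mirror]
  · rw [hT] at hh
    cases hh

theorem diag_opp (e : Corner) : e.opp.diag = e.diag.opp := by cases e <;> rfl

theorem IsOri.sigma {out : T.C × Corner → Bool} (h : IsOri T.sigma out) :
    IsOri T (fun a => !out (mirror T a)) := by
  refine ⟨fun a b hab => ?_, fun c e => ?_⟩
  · rw [h.glue _ _ (glue_mirror hab)]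
  · have := h.opp c e.diag
    simp only [mirror, diag_opp]
    exact congrArg _ this

theorem diag_onNWSE (e : Corner) : e.diag.onNWSE = e.onNWSE := by cases e <;> rfl

theorem preCol_sigma {X : Type} {f : T.C × Corner → X} :
    PreCol T.sigma f ↔ PreCol T (fun a => f (mirror T a)) := by
  constructor
  · intro h
    refine ⟨fun a b hab => h.glue _ _ (glue_mirror hab), fun c e he => ?_⟩
    simp only [mirror, diag_opp]
    exact h.strand c e.diag (by rw [diag_onNWSE]; exact he)
  · intro h
    refine ⟨fun a b hab => ?_, fun c e he => ?_⟩
    · have := h.glue _ _ (sigma_glue hab)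
      exact (congrArg f (mirror_mirror (T := T) b)).symm.trans
        (this.trans (congrArg f (mirror_mirror (T := T) a)))
    · have := h.strand c e.diag (by rw [diag_onNWSE]; exact he)
      simp only [mirror, diag_opp, Corner.diag_diag] at this
      exact this

/-! #### The relation between the ends -/

section

variable {R : Type} [CommRing R] (τ : Rˣ) {X : Type} [AddCommGroup X] [Module R X]

theorem boundaryProd_crossing {out : T.C × Corner → Bool} (h : IsOri T out) (c : T.C) :
    boundaryProd τ (fun e => out (c, e)) = 1 := by
  have h1 := h.opp c .nw
  have h2 := h.opp c .ne
  simp only [Corner.opp] at h1 h2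
  simp only [boundaryProd, h1, h2, mer_not]
  rw [mul_right_comm _ _ (mer τ (out (c, .nw)))⁻¹, mul_inv_cancel, one_mul, mul_inv_cancel]

theorem relAt_sigma {out : T.C × Corner → Bool} (h : IsOri T.sigma out) (f : T.C × Corner → X)
    (c : T.C) : RelAt τ (fun a => !out (mirror T a)) (fun a => f (mirror T a)) c ↔ RelAt τ out f c := by
  have := boundarySum_diag τ (fun e => out (c, e)) (fun e => f (c, e))
    (boundaryProd_crossing τ (T := T.sigma) h c)
  simp only [RelAt, mirror, this]
  rw [← Units.val_neg, ← Units.smul_def, smul_eq_zero_iff_eq]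

theorem isCol_sigma {out : T.C × Corner → Bool} (h : IsOri T.sigma out) (f : T.C × Corner → X) :
    IsCol τ T.sigma out f ↔ IsCol τ T (fun a => !out (mirror T a)) (fun a => f (mirror T a)) :=
  ⟨fun hf => ⟨preCol_sigma.1 hf.toPreCol, fun c => (relAt_sigma τ h f c).2 (hf.rel c)⟩,
    fun hf => ⟨preCol_sigma.2 hf.toPreCol, fun c => (relAt_sigma τ h f c).1 (hf.rel c)⟩⟩

theorem isCol_horiz (out : (S.horiz U).C × Corner → Bool) (f : (S.horiz U).C × Corner → X) :
    IsCol τ (S.horiz U) out f ↔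
      IsCol τ S (fun h => out (inL S U h)) (fun h => f (inL S U h)) ∧
      IsCol τ U (fun h => out (inR S U h)) (fun h => f (inR S U h)) ∧
      f (inR S U (U.ends .nw)) = f (inL S U (S.ends .ne)) ∧
      f (inR S U (U.ends .sw)) = f (inL S U (S.ends .se)) := by
  constructor
  · intro h
    obtain ⟨h1, h2, h3, h4⟩ := preCol_horiz.1 h.toPreCol
    exact ⟨⟨h1, fun c => h.rel (.inl c)⟩, ⟨h2, fun c => h.rel (.inr c)⟩, h3, h4⟩
  · rintro ⟨h1, h2, h3, h4⟩
    refine ⟨preCol_horiz.2 ⟨h1.toPreCol, h2.toPreCol, h3, h4⟩, ?_⟩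
    rintro (c | c)
    · exact h1.rel c
    · exact h2.rel c

theorem boundaryRel_cross (s : Bool) {out : (cross s).C × Corner → Bool} (h : IsOri (cross s) out) :
    BoundaryRel τ (cross s) out :=
  ⟨boundaryProd_crossing τ h (), fun _ _ _ _ _ hf => hf (), fun _ _ _ _ _ _ _ hf => hf⟩

/-- The boundary sum of `S + U` is that of `S` plus a unit times that of `U`, so each part of the
statement reduces to the summands. -/
theorem BoundaryRel.horiz {out : (S.horiz U).C × Corner → Bool} (h : IsOri (S.horiz U) out)
    (hS : BoundaryRel τ S (fun h => out (inL S U h)))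
    (hU : BoundaryRel τ U (fun h => out (inR S U h))) : BoundaryRel τ (S.horiz U) out := by
  obtain ⟨-, -, hn, hs⟩ := isOri_horiz.1 h
  have key : ∀ (X : Type) [AddCommGroup X] [Module R X] (f : (S.horiz U).C × Corner → X),
      PreCol (S.horiz U) f →
      boundarySum τ (fun e => out ((S.horiz U).ends e)) (fun e => f ((S.horiz U).ends e))
        = boundarySum τ (fun e => out (inL S U (S.ends e))) (fun e => f (inL S U (S.ends e)))
          + (mer τ (out (inL S U (S.ends .nw))) * mer τ (out (inL S U (S.ends .ne))) : R) •
            boundarySum τ (fun e => out (inR S U (U.ends e))) (fun e => f (inR S U (U.ends e))) := by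
    intro X _ _ f hf
    obtain ⟨-, -, h3, h4⟩ := preCol_horiz.1 hf
    exact boundarySum_horiz τ _ _ _ _ _ _ hn hs h3.symm h4.symm hU.prod rfl rfl rfl rfl rfl rfl rfl
      rfl
  refine ⟨?_, ?_, ?_⟩
  · have h1 := hS.prod
    have h2 := hU.prod
    simp only [boundaryProd, hn, hs, mer_not] at h1 h2
    have h3 : boundaryProd τ (fun e => out ((S.horiz U).ends e))
      = mer τ (out (inL S U (S.ends .nw))) * mer τ (out (inR S U (U.ends .ne)))
        * mer τ (out (inR S U (U.ends .se))) * mer τ (out (inL S U (S.ends .sw))) := rfl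
    rw [h3]
    have aux : ∀ n a b w c d : Rˣ,
        n * c * d * w = (n * a * b * w) * (a⁻¹ * c * d * b⁻¹) := by
      intro n a b w c d
      calc _ = (n * c * d * w) * (a * a⁻¹) * (b * b⁻¹) := by simp
        _ = _ := by ac_rfl
    rw [aux, h1, h2, one_mul]
  · intro X _ _ f hf hc
    obtain ⟨h1, h2, -, -⟩ := preCol_horiz.1 hf
    rw [key X f hf, hS.sum X _ h1 fun c => hc (.inl c), hU.sum X _ h2 fun c => hc (.inr c)]
    simp
  · intro X _ _ f c₀ hf hc hb
    obtain ⟨h1, h2, -, -⟩ := preCol_horiz.1 hf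
    -- The summand without `c₀` satisfies all its relations and contributes `0`, so the boundary sum
    -- of the other summand vanishes.
    rw [key X f hf] at hb
    obtain c₀ | c₀ := c₀
    · rw [hU.sum X _ h2 fun c => hc (.inr c) Sum.inr_ne_inl, smul_zero, add_zero] at hb
      exact hS.rel X _ c₀ h1 (fun c hcc => hc (.inl c) (Sum.inl_injective.ne hcc)) hb
    · rw [hS.sum X _ h1 fun c => hc (.inl c) Sum.inl_ne_inr, zero_add, ← Units.val_mul,
        ← Units.smul_def, smul_eq_zero_iff_eq] at hb
      exact hU.rel X _ c₀ h2 (fun c hcc => hc (.inr c) (Sum.inr_injective.ne hcc)) hb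

theorem BoundaryRel.sigma {out : T.C × Corner → Bool} (h : IsOri T.sigma out)
    (hT : BoundaryRel τ T (fun a => !out (mirror T a))) : BoundaryRel τ T.sigma out := by
  have hp : boundaryProd τ (fun e => out (T.sigma.ends e)) = 1 := by
    have h1 := hT.prod
    simp only [boundaryProd, mer_not] at h1 ⊢
    rw [← inv_inj, inv_one, ← h1]
    simp only [mul_inv]
    change (mer τ (out (mirror T (T.ends .nw))))⁻¹ * (mer τ (out (mirror T (T.ends .sw))))⁻¹
      * (mer τ (out (mirror T (T.ends .se))))⁻¹ * (mer τ (out (mirror T (T.ends .ne))))⁻¹ = _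
    ac_rfl
  have key : ∀ (X : Type) [AddCommGroup X] [Module R X] (f : T.C × Corner → X),
      boundarySum τ (fun e => !out (mirror T (T.ends e))) (fun e => f (mirror T (T.ends e))) = 0 ↔
        boundarySum τ (fun e => out (T.sigma.ends e)) (fun e => f (T.sigma.ends e)) = 0 := by
    intro X _ _ f
    have := boundarySum_diag τ (fun e => out (T.sigma.ends e)) (fun e => f (T.sigma.ends e)) hp
    have e1 : ∀ e : Corner, T.sigma.ends e.diag = mirror T (T.ends e) := by
      intro e; cases e <;> rfl
    simp only [e1] at this
    rw [this, ← Units.val_neg, ← Units.smul_def, smul_eq_zero_iff_eq]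
  refine ⟨hp, ?_, ?_⟩
  · intro X _ _ f hf hc
    exact (key X f).1 (hT.sum X _ (preCol_sigma.1 hf) fun c => (relAt_sigma τ h f c).2 (hc c))
  · intro X _ _ f c₀ hf hc hb
    exact (relAt_sigma τ h f c₀).1 (hT.rel X _ c₀ (preCol_sigma.1 hf)
      (fun c hcc => (relAt_sigma τ h f c).2 (hc c hcc)) ((key X f).2 hb))

theorem boundaryRel_twist (s : Bool) (n : ℕ) {out : (twist s n).C × Corner → Bool}
    (h : IsOri (twist s n) out) : BoundaryRel τ (twist s n) out := by
  induction n with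
  | zero => exact boundaryRel_cross τ s h
  | succ n ih =>
    have h1 := isOri_horiz.1 h
    exact BoundaryRel.horiz τ h (ih h1.1) (boundaryRel_cross τ s h1.2.1)

theorem boundaryRel_int (k : ℤ) {out : (int k).C × Corner → Bool}
    (h : IsOri (int k) out) : BoundaryRel τ (int k) out := by
  match k with
  | .ofNat 0 => exact boundaryRel_cross τ _ h
  | .ofNat (n + 1) => exact boundaryRel_twist τ _ _ h
  | .negSucc n => exact boundaryRel_twist τ _ _ h

theorem boundaryRel_addInt (hT : ∀ out, IsOri T out → BoundaryRel τ T out) (k : ℤ)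
    {out : (T.addInt k).C × Corner → Bool}
    (h : IsOri (T.addInt k) out) : BoundaryRel τ (T.addInt k) out := by
  match k with
  | .ofNat 0 => exact hT _ h
  | .ofNat (n + 1) =>
    have h1 := isOri_horiz.1 h
    exact BoundaryRel.horiz τ h (hT _ h1.1) (boundaryRel_int τ _ h1.2.1)
  | .negSucc n =>
    have h1 := isOri_horiz.1 h
    exact BoundaryRel.horiz τ h (hT _ h1.1) (boundaryRel_int τ _ h1.2.1)

theorem boundaryRel_rational (l : List ℤ) : ∀ {out : (rational l).C × Corner → Bool},
    IsOri (rational l) out → BoundaryRel τ (rational l) out := by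
  induction l with
  | nil => exact fun h => boundaryRel_cross τ _ h
  | cons k l ih =>
    cases l with
    | nil => exact fun h => boundaryRel_int τ _ h
    | cons k' l =>
      exact fun h => boundaryRel_addInt τ (fun _ h => BoundaryRel.sigma τ h (ih h.sigma)) k h

end

end Tangle

/-! ### Generating colourings of crossings, sums and reflections -/

namespace Tangle

variable {T S U : Tangle}

section

variable {R : Type} [CommRing R] (τ : Rˣ) {X : Type} [AddCommGroup X] [Module R X]

theorem boundarySum_add (out : Corner → Bool) (f g : Corner → X) :
    boundarySum τ out (fun e => f e + g e) = boundarySum τ out f + boundarySum τ out g := by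
  simp only [boundarySum]; module

theorem boundarySum_smul (out : Corner → Bool) (f : Corner → R) (u : X) :
    boundarySum τ out (fun e => f e • u) = boundarySum τ out f • u := by
  simp only [boundarySum, smul_eq_mul]; module

/-- The relation of a crossing involves only differences of colours. -/
theorem relAt_const {out : T.C × Corner → Bool} (h : IsOri T out) (a : X) (c : T.C) :
    RelAt τ out (fun _ => a) c := by
  rw [RelAt, boundarySum_of_se_eq_nw τ _ _ (h.opp c .nw) (h.opp c .ne) rfl]
  simp

theorem isCol_add_smul {out : T.C × Corner → Bool} (h : IsOri T out) {lam : T.C × Corner → R}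
    (hl : IsCol τ T out lam) (a u : X) : IsCol τ T out (fun h => a + lam h • u) := by
  refine ⟨⟨fun b b' hb => by rw [hl.glue _ _ hb], fun c e he => by rw [hl.strand c e he]⟩, ?_⟩
  intro c
  have h1 := relAt_const τ h a c
  have h2 := hl.rel c
  simp only [RelAt] at h1 h2 ⊢
  rw [boundarySum_add τ _ (fun _ => a) (fun e => lam (c, e) • u), h1,
    boundarySum_smul τ _ (fun e => lam (c, e)), h2, zero_smul, zero_add]

/-- The colouring `lam` generates all colourings, up to constants. -/
structure IsGen (T : Tangle) (out : T.C × Corner → Bool) (lam : T.C × Corner → R) : Prop where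
  col : IsCol τ T out lam
  nw : lam (T.ends .nw) = 0
  unit : ∃ h₁ h₂, lam h₁ - lam h₂ = 1
  gen : ∀ (X : Type) [AddCommGroup X] [Module R X] (f : T.C × Corner → X), IsCol τ T out f →
    ∃ u : X, ∀ h, f h = f (T.ends .nw) + lam h • u

theorem isCol_cross_true {out : (cross true).C × Corner → Bool} (h : IsOri (cross true) out)
    (f : (cross true).C × Corner → X) : IsCol τ (cross true) out f ↔
      f ((), .se) = f ((), .nw) ∧
      f ((), .ne) = f ((), .nw) + (mer τ (out ((), .se)) : R) • (f ((), .sw) - f ((), .nw)) := by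
  have key (hf : f ((), .se) = f ((), .nw)) := boundarySum_of_se_eq_nw τ (fun e => out ((), e))
    (fun e => f ((), e)) (h.opp () .nw) (h.opp () .ne) hf
  constructor
  · intro hf
    have h1 := hf.strand () .nw rfl
    have h2 : boundarySum τ (fun e => out ((), e)) (fun e => f ((), e)) = 0 := hf.rel ()
    refine ⟨h1, ?_⟩
    rw [key h1, ← Units.val_mul, ← Units.smul_def, smul_eq_zero_iff_eq, sub_eq_zero] at h2
    rw [← h2]; abel
  · rintro ⟨h1, h2⟩
    refine ⟨⟨fun a b hab => (by cases hab), ?_⟩, ?_⟩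
    · rintro ⟨⟩ (_ | _ | _ | _) he
      · exact h1
      · cases he
      · cases he
      · exact h1.symm
    · rintro ⟨⟩
      change boundarySum τ (fun e => out ((), e)) (fun e => f ((), e)) = 0
      rw [key h1, h2]
      simp

theorem isCol_cross_false {out : (cross false).C × Corner → Bool} (h : IsOri (cross false) out)
    (f : (cross false).C × Corner → X) : IsCol τ (cross false) out f ↔
      f ((), .sw) = f ((), .ne) ∧
      f ((), .nw) = f ((), .ne) + (mer τ (out ((), .ne)) : R) • (f ((), .se) - f ((), .ne)) := by
  have key (hf : f ((), .sw) = f ((), .ne)) := boundarySum_of_sw_eq_ne τ (fun e => out ((), e))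
    (fun e => f ((), e)) (h.opp () .nw) (h.opp () .ne) hf
  constructor
  · intro hf
    have h1 := hf.strand () .ne rfl
    have h2 : boundarySum τ (fun e => out ((), e)) (fun e => f ((), e)) = 0 := hf.rel ()
    refine ⟨h1, ?_⟩
    rw [key h1, ← Units.smul_def, smul_eq_zero_iff_eq, sub_eq_zero] at h2
    rw [← h2]; abel
  · rintro ⟨h1, h2⟩
    refine ⟨⟨fun a b hab => (by cases hab), ?_⟩, ?_⟩
    · rintro ⟨⟩ (_ | _ | _ | _) he
      · cases he
      · exact h1
      · exact h1.symm
      · cases he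
    · rintro ⟨⟩
      change boundarySum τ (fun e => out ((), e)) (fun e => f ((), e)) = 0
      rw [key h1, h2]
      simp

/-- The colours `0` at NW and `1` at SW leave no freedom: SE lies on the over-strand through NW, and
the relation of the crossing yields NE. -/
theorem exists_isGen_cross_true {out : (cross true).C × Corner → Bool} (h : IsOri (cross true) out) :
    ∃ lam : (cross true).C × Corner → R, IsGen τ (cross true) out lam ∧ lam ((), .sw) = 1 ∧
      lam ((), .ne) = mer τ (out ((), .se)) ∧ lam ((), .se) = 0 := by
  refine ⟨fun a => match a.2 with
    | .nw => 0 | .se => 0 | .sw => 1 | .ne => mer τ (out ((), .se)), ?_, rfl, rfl, rfl⟩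
  refine ⟨(isCol_cross_true τ h _).2 ?_, rfl, ⟨((), .sw), ((), .nw), by simp⟩, ?_⟩
  · simp
  · intro X _ _ f hf
    obtain ⟨h1, h2⟩ := (isCol_cross_true τ h _).1 hf
    refine ⟨f ((), .sw) - f ((), .nw), ?_⟩
    rintro ⟨⟨⟩, e⟩
    change f ((), e) = f ((), .nw) + _
    cases e
    · simp
    · simp [h2]
    · simp
    · simp [h1]

/-- Here NE lies on the over-strand through SW, and the relation of the crossing is solved for the
colour at SE. -/
theorem exists_isGen_cross_false {out : (cross false).C × Corner → Bool}
    (h : IsOri (cross false) out) :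
    ∃ lam : (cross false).C × Corner → R, IsGen τ (cross false) out lam ∧ lam ((), .sw) = 1 ∧
      lam ((), .ne) = 1 ∧ lam ((), .se) = 1 - ((mer τ (out ((), .ne)))⁻¹ : Rˣ) := by
  refine ⟨fun a => match a.2 with
    | .nw => 0 | .se => 1 - ((mer τ (out ((), .ne)))⁻¹ : Rˣ) | .sw => 1 | .ne => 1,
    ?_, rfl, rfl, rfl⟩
  refine ⟨(isCol_cross_false τ h _).2 ?_, rfl, ⟨((), .sw), ((), .nw), by simp⟩, ?_⟩
  · simp
  · intro X _ _ f hf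
    obtain ⟨h1, h2⟩ := (isCol_cross_false τ h _).1 hf
    refine ⟨f ((), .sw) - f ((), .nw), ?_⟩
    rintro ⟨⟨⟩, e⟩
    change f ((), e) = f ((), .nw) + _
    cases e
    · simp
    · simp [h1]
    · simp
    · simp only [h1]
      rw [h2]
      have : ((mer τ (out ((), .ne)) : Rˣ) : R) * ((mer τ (out ((), .ne)))⁻¹ : Rˣ) = 1 :=
        Units.mul_inv _
      match_scalars
      · linear_combination -this
      · linear_combination this

/-- A colouring of `U` is determined by its colours at NW and SW, because `lamU` takes the values
`0` and `1` there. The colours of `S` at NE and SE therefore prescribe it, and any values are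
admissible. -/
theorem IsGen.horiz {out : (S.horiz U).C × Corner → Bool} (h : IsOri (S.horiz U) out)
    {lamS : S.C × Corner → R} {lamU : U.C × Corner → R}
    (hS : IsGen τ S (fun a => out (inL S U a)) lamS)
    (hU : IsGen τ U (fun a => out (inR S U a)) lamU) (hsw : lamU (U.ends .sw) = 1) :
    ∃ lam : (S.horiz U).C × Corner → R, IsGen τ (S.horiz U) out lam ∧
      (∀ a, lam (inL S U a) = lamS a) ∧
      ∀ a, lam (inR S U a)
        = lamS (S.ends .ne) + lamU a * (lamS (S.ends .se) - lamS (S.ends .ne)) := by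
  obtain ⟨-, oU, -, -⟩ := isOri_horiz.1 h
  let lam : (S.horiz U).C × Corner → R := fun a => match a with
    | (.inl c, e) => lamS (c, e)
    | (.inr c, e) => lamS (S.ends .ne) + lamU (c, e) * (lamS (S.ends .se) - lamS (S.ends .ne))
  refine ⟨lam, ?_, fun a => rfl, fun a => rfl⟩
  refine ⟨(isCol_horiz τ _ _).2 ⟨hS.col, ?_, ?_, ?_⟩, hS.nw, ?_, ?_⟩
  · exact isCol_add_smul τ oU hU.col _ _
  · change lamS (S.ends .ne) + lamU (U.ends .nw) * _ = lamS (S.ends .ne)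
    rw [hU.nw]; ring
  · change lamS (S.ends .ne) + lamU (U.ends .sw) * _ = lamS (S.ends .se)
    rw [hsw]; ring
  · obtain ⟨h₁, h₂, h12⟩ := hS.unit
    exact ⟨inL S U h₁, inL S U h₂, h12⟩
  · intro X _ _ f hf
    obtain ⟨f1, f2, f3, f4⟩ := (isCol_horiz τ _ _).1 hf
    obtain ⟨u, hu⟩ := hS.gen X _ f1
    obtain ⟨v, hv⟩ := hU.gen X _ f2
    have hvu : v = (lamS (S.ends .se) - lamS (S.ends .ne)) • u := by
      have h1 := hv (U.ends .sw)
      rw [hsw, one_smul, f3, f4, hu (S.ends .se), hu (S.ends .ne)] at h1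
      rw [eq_sub_of_add_eq' h1.symm]
      module
    refine ⟨u, ?_⟩
    rintro ⟨c | c, e⟩
    · exact hu (c, e)
    · have h1 := hv (c, e)
      rw [f3, hu, hvu] at h1
      refine h1.trans ?_
      change _ = f (inL S U (S.ends .nw)) + (lamS (S.ends .ne)
        + lamU (c, e) * (lamS (S.ends .se) - lamS (S.ends .ne))) • u
      module

/-- The sign is chosen so that the values `z_h` at SW and `-z_v` at NE become `z_v` and `-z_h`. -/
theorem IsGen.sigma {out : T.C × Corner → Bool} (h : IsOri T.sigma out)
    {lam : T.C × Corner → R} (hT : IsGen τ T (fun a => !out (mirror T a)) lam) :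
    IsGen τ T.sigma out (fun a => - lam (mirror T a)) := by
  refine ⟨(isCol_sigma τ h _).2 ?_, ?_, ?_, ?_⟩
  · have := isCol_add_smul τ h.sigma hT.col (0 : R) (-1)
    convert this using 1
    funext a
    rw [show mirror T (mirror T a) = a from mirror_mirror a]
    simp
  · change -lam (mirror T (mirror T (T.ends .nw))) = 0
    rw [show mirror T (mirror T (T.ends .nw)) = T.ends .nw from mirror_mirror _, hT.nw, neg_zero]
  · obtain ⟨h₁, h₂, h12⟩ := hT.unit
    refine ⟨mirror T h₂, mirror T h₁, ?_⟩
    rw [show mirror T (mirror T h₁) = h₁ from mirror_mirror _,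
      show mirror T (mirror T h₂) = h₂ from mirror_mirror _, ← h12]
    ring
  · intro X _ _ f hf
    obtain ⟨u, hu⟩ := hT.gen X _ ((isCol_sigma τ h _).1 hf)
    refine ⟨-u, fun a => ?_⟩
    have := hu (mirror T a)
    rw [show mirror T (mirror T a) = a from mirror_mirror a] at this
    rw [this, neg_smul_neg]
    rfl

end

end Tangle

/-! ### The functions `z_h` and `z_v` as values of a generating colouring -/

/-- The evaluation of Laurent polynomials at `-1`. -/
noncomputable def evalNegOne : ℤ[T;T⁻¹] →+* ℤ := LaurentPolynomial.eval₂ (RingHom.id ℤ) (-1 : ℤˣ)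

theorem evalNegOne_tUnit : evalNegOne (tUnit : ℤ[T;T⁻¹]ˣ) = -1 := by
  simp [evalNegOne, tUnit, LaurentPolynomial.eval₂_T]

theorem evalNegOne_tUnit_inv : evalNegOne (tUnit⁻¹ : ℤ[T;T⁻¹]ˣ) = -1 := by
  have : ((tUnit⁻¹ : ℤ[T;T⁻¹]ˣ) : ℤ[T;T⁻¹]) = T (-1) := rfl
  rw [this, evalNegOne, LaurentPolynomial.eval₂_T]
  simp

theorem evalNegOne_mer (b : Bool) : evalNegOne (mer tUnit b) = -1 := by
  cases b
  · exact evalNegOne_tUnit_inv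
  · exact evalNegOne_tUnit

theorem evalNegOne_mer_inv (b : Bool) : evalNegOne ((mer tUnit b)⁻¹ : ℤ[T;T⁻¹]ˣ) = -1 := by
  rw [← mer_not]; exact evalNegOne_mer _

theorem evalNegOne_foxEnd (b : Bool) : evalNegOne (foxEnd tUnit b) = 1 := by
  cases b
  · simp [foxEnd, evalNegOne_tUnit_inv]
  · simp [foxEnd]

theorem algebraMap_tUnit : algebraMap ℤ[T;T⁻¹] K (tUnit : ℤ[T;T⁻¹]ˣ) = t := rfl

theorem algebraMap_unit_inv (u : ℤ[T;T⁻¹]ˣ) :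
    algebraMap ℤ[T;T⁻¹] K (u⁻¹ : ℤ[T;T⁻¹]ˣ) = (algebraMap ℤ[T;T⁻¹] K u)⁻¹ := by
  apply eq_inv_of_mul_eq_one_left
  rw [← map_mul, Units.inv_mul, map_one]

theorem algebraMap_mer {H : Type} (out : H → Bool) (h : H) :
    algebraMap ℤ[T;T⁻¹] K (mer tUnit (out h)) = phi out h := by
  unfold phi
  cases out h
  · simp [mer, algebraMap_tUnit]
  · simp [mer, algebraMap_tUnit]

theorem phi_ne_zero {H : Type} (out : H → Bool) (h : H) : phi out h ≠ 0 := by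
  unfold phi
  split_ifs
  · exact t_ne_zero
  · exact inv_ne_zero t_ne_zero

theorem algebraMap_injective : Function.Injective (algebraMap ℤ[T;T⁻¹] K) :=
  FaithfulSMul.algebraMap_injective _ _

theorem t_ne_one : t ≠ 1 := by
  intro h
  have : (tUnit : ℤ[T;T⁻¹]ˣ) = (1 : ℤ[T;T⁻¹]) :=
    algebraMap_injective (by rw [algebraMap_tUnit, h, map_one])
  have h2 := congrArg evalNegOne this
  rw [evalNegOne_tUnit, map_one] at h2
  norm_num at h2

theorem phi_ne_one {H : Type} (out : H → Bool) (h : H) : phi out h ≠ 1 := by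
  unfold phi
  split_ifs
  · exact t_ne_one
  · exact inv_ne_one.2 t_ne_one

/-! ### Closed forms for the end colours of integer tangles -/

theorem qInt_zero (a : K) : qInt a 0 = 0 := by
  change qInt a (.ofNat 0) = 0
  simp [qInt]

/-- The convention for negative `k` is the one that makes this recursion valid for all integers. -/
theorem qInt_add_one {a : K} (ha : a ≠ 0) (k : ℤ) : qInt a (k + 1) = 1 + a * qInt a k := by
  have key (n : ℕ) : ∑ i ∈ Finset.range (n + 1), a ^ i = 1 + a * ∑ i ∈ Finset.range n, a ^ i := by
    rw [Finset.sum_range_succ', Finset.mul_sum]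
    simp [pow_succ', add_comm]
  match k with
  | .ofNat n => exact key n
  | .negSucc 0 =>
    change qInt a 0 = _
    rw [qInt_zero]
    simp [qInt, ha]
  | .negSucc (n + 1) =>
    change qInt a (.negSucc n) = _
    simp only [qInt]
    rw [Finset.sum_range_succ _ (n + 1)]
    have e1 : a ^ (Int.negSucc (n + 1)) = a ^ (Int.negSucc n) * a⁻¹ := by
      rw [← zpow_sub_one₀ ha]; rfl
    have e2 : a ^ (Int.negSucc n) * a ^ (n + 1) = 1 := by
      rw [zpow_negSucc, inv_mul_cancel₀ (pow_ne_zero _ ha)]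
    rw [e1]
    have e3 : a * a⁻¹ = 1 := mul_inv_cancel₀ ha
    generalize a ^ (Int.negSucc n) = x at *
    generalize ∑ i ∈ Finset.range (n + 1), a ^ i = s at *
    linear_combination e2 + (x * s + x * a ^ (n + 1)) * e3

/-- The values at the ends NE and SE of the colouring of `[k]` with the values `0` at NW and `1` at
SW, where `ne` and `se` are the images of the arcs at NE and SE. -/
def TwistValues (k : ℤ) (ne se a b : K) : Prop :=
  (∀ h, k = 2 * h → a = -(ne * (se - 1) * qInt (ne * se) h) ∧ b = (ne - 1) * qInt (ne * se) h + 1) ∧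
  (∀ h, k = 2 * h - 1 →
    a = 1 - (1 - se) * qInt (ne * se) h ∧ b = (1 - ne⁻¹) * (1 - qInt (ne * se) h))

namespace TwistValues

variable {k : ℤ} {ne se a b : K}

theorem eq_neg_zvInt (h : TwistValues k ne se a b) : a = -zvInt k ne se := by
  unfold zvInt
  split_ifs with hk
  · exact (h.1 _ (by have := Int.even_iff.1 hk; omega)).1
  · rw [(h.2 ((k + 1) / 2) (by have := Int.not_even_iff.1 hk; omega)).1]
    ring

theorem one : TwistValues 1 ne se se 0 := by
  refine ⟨fun h hh => by omega, fun h hh => ?_⟩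
  obtain rfl : h = 1 := by omega
  have : qInt (ne * se) 1 = 1 := by
    change qInt _ (.ofNat 1) = 1
    simp [qInt]
  rw [this]
  constructor <;> ring

theorem neg_one : TwistValues (-1) ne se 1 (1 - ne⁻¹) := by
  refine ⟨fun h hh => by omega, fun h hh => ?_⟩
  obtain rfl : h = 0 := by omega
  rw [qInt_zero]
  constructor <;> ring

/-- Attaching `[1]` carries the colour at NE to SE along the over-strand and computes the new colour
at NE from the relation of the crossing. The strands change places, whence the exchange of `ne` and
`se`; the closed forms for even and odd `k` pass into each other. -/
theorem add_one (hne : ne ≠ 0) (hse : se ≠ 0) (h : TwistValues k ne se a b) :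
    TwistValues (k + 1) se ne (a + ne * (b - a)) a := by
  have e := qInt_add_one (mul_ne_zero hne hse)
  constructor
  · intro j hj
    obtain ⟨rfl, rfl⟩ := h.2 j (by omega)
    rw [mul_comm se ne]
    constructor
    · field_simp
      ring
    · ring
  · intro j hj
    obtain ⟨i, rfl⟩ : ∃ i, j = i + 1 := ⟨j - 1, by ring⟩
    obtain ⟨rfl, rfl⟩ := h.1 i (by omega)
    rw [mul_comm se ne, e]
    constructor
    · ring
    · field_simp
      ring

/-- The same for `[-1]`, whose over-strand carries the colour at SE to NE. -/
theorem sub_one (hne : ne ≠ 0) (hse : se ≠ 0) (h : TwistValues k ne se a b) :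
    TwistValues (k - 1) se ne b (a + (1 - se⁻¹) * (b - a)) := by
  have e := qInt_add_one (mul_ne_zero hne hse)
  constructor
  · intro j hj
    obtain ⟨rfl, rfl⟩ := h.2 (j + 1) (by omega)
    rw [mul_comm se ne, e]
    constructor
    · field_simp
      ring
    · field_simp
      ring
  · intro j hj
    obtain ⟨rfl, rfl⟩ := h.1 j (by omega)
    rw [mul_comm se ne]
    constructor
    · ring
    · field_simp
      ring

end TwistValues

/-! ### Generating colourings of integer and rational tangles -/

namespace Tangle

variable {S U : Tangle}

/-- The properties of the generating colouring of the tangle `[k]`. -/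
structure IsTwistGen (k : ℤ) (U : Tangle) (out : U.C × Corner → Bool)
    (lam : U.C × Corner → ℤ[T;T⁻¹]) : Prop extends IsGen tUnit U out lam where
  sw : lam (U.ends .sw) = 1
  values : TwistValues k (phi out (U.ends .ne)) (phi out (U.ends .se))
    (algebraMap _ K (lam (U.ends .ne))) (algebraMap _ K (lam (U.ends .se)))
  eval_ne : evalNegOne (lam (U.ends .ne)) = -k
  eval_se : evalNegOne (lam (U.ends .se)) = 1 - k

theorem exists_isTwistGen_true (n : ℕ) {out : (twist true n).C × Corner → Bool}
    (h : IsOri (twist true n) out) : ∃ lam, IsTwistGen (n + 1) (twist true n) out lam := by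
  induction n with
  | zero =>
    obtain ⟨lam, h1, h2, h3, h4⟩ := exists_isGen_cross_true tUnit h
    have h3' : lam ((twist true 0).ends .ne) = mer tUnit (out ((), .se)) := h3
    have h4' : lam ((twist true 0).ends .se) = 0 := h4
    refine ⟨lam, ⟨h1, h2, ?_, ?_, ?_⟩⟩
    · rw [h3', h4', algebraMap_mer, map_zero]
      exact TwistValues.one
    · rw [h3', evalNegOne_mer]; simp
    · rw [h4', map_zero]; simp
  | succ n ih =>
    obtain ⟨o1, o2, o3, o4⟩ := isOri_horiz.1 h
    obtain ⟨lamS, hS⟩ := ih o1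
    obtain ⟨lamU, u1, u2, u3, u4⟩ := exists_isGen_cross_true tUnit o2
    obtain ⟨lam, g1, g2, g3⟩ := IsGen.horiz tUnit h hS.toIsGen u1 u2
    have e2 := g3 ((), .ne)
    have e3 := g3 ((), .se)
    rw [u3] at e2
    rw [u4, zero_mul, add_zero] at e3
    -- The strands change places in the last crossing, so the outward directions at NE and SE are
    -- exchanged.
    have n1 : out ((twist true (n + 1)).ends .se) = out (inL _ _ ((twist true n).ends .ne)) := by
      have h1 := o2.opp () .nw
      change out (inR _ _ ((cross true).ends .se)) = !out (inR _ _ ((cross true).ends .nw)) at h1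
      rw [o3, Bool.not_not] at h1
      exact h1
    have n2 : out ((twist true (n + 1)).ends .ne) = out (inL _ _ ((twist true n).ends .se)) := by
      have h1 := o2.opp () .sw
      change out (inR _ _ ((cross true).ends .ne)) = !out (inR _ _ ((cross true).ends .sw)) at h1
      rw [o4, Bool.not_not] at h1
      exact h1
    have e2' : lam ((twist true (n + 1)).ends .ne) = lamS ((twist true n).ends .ne)
        + (mer tUnit (out ((twist true (n + 1)).ends .se))) * (lamS ((twist true n).ends .se)
          - lamS ((twist true n).ends .ne)) := e2
    have e3' : lam ((twist true (n + 1)).ends .se) = lamS ((twist true n).ends .ne) := e3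
    refine ⟨lam, ⟨g1, ?_, ?_, ?_, ?_⟩⟩
    · exact (g2 _).trans hS.sw
    · have := hS.values.add_one (phi_ne_zero _ _) (phi_ne_zero _ _)
      rw [e2', e3', map_add, map_mul, map_sub, algebraMap_mer]
      push_cast
      have n1' : phi out ((twist true (n + 1)).ends .se)
        = phi (fun a => out (inL (twist true n) (cross true) a)) ((twist true n).ends .ne) := by
        simp only [phi, n1]
      have n2' : phi out ((twist true (n + 1)).ends .ne)
        = phi (fun a => out (inL (twist true n) (cross true) a)) ((twist true n).ends .se) := by
        simp only [phi, n2]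
      rw [n1', n2']
      exact this
    · rw [e2', map_add, map_mul, map_sub, evalNegOne_mer, hS.eval_ne, hS.eval_se]
      push_cast; ring
    · rw [e3', hS.eval_ne]
      push_cast; ring

theorem exists_isTwistGen_false (n : ℕ) {out : (twist false n).C × Corner → Bool}
    (h : IsOri (twist false n) out) : ∃ lam, IsTwistGen (-(n + 1)) (twist false n) out lam := by
  induction n with
  | zero =>
    obtain ⟨lam, h1, h2, h3, h4⟩ := exists_isGen_cross_false tUnit h
    have h3' : lam ((twist false 0).ends .ne) = 1 := h3
    have h4' : lam ((twist false 0).ends .se) = 1 - ((mer tUnit (out ((), .ne)))⁻¹ : ℤ[T;T⁻¹]ˣ) := h4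
    refine ⟨lam, ⟨h1, h2, ?_, ?_, ?_⟩⟩
    · rw [h3', h4', map_sub, algebraMap_unit_inv, algebraMap_mer, map_one]
      exact TwistValues.neg_one
    · rw [h3']; simp
    · rw [h4', map_sub, evalNegOne_mer_inv]; simp
  | succ n ih =>
    obtain ⟨o1, o2, o3, o4⟩ := isOri_horiz.1 h
    obtain ⟨lamS, hS⟩ := ih o1
    obtain ⟨lamU, u1, u2, u3, u4⟩ := exists_isGen_cross_false tUnit o2
    obtain ⟨lam, g1, g2, g3⟩ := IsGen.horiz tUnit h hS.toIsGen u1 u2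
    have e2 := g3 ((), .ne)
    have e3 := g3 ((), .se)
    rw [u3, one_mul, add_sub_cancel] at e2
    rw [u4] at e3
    have n1 : out ((twist false (n + 1)).ends .se) = out (inL _ _ ((twist false n).ends .ne)) := by
      have h1 := o2.opp () .nw
      change out (inR _ _ ((cross false).ends .se)) = !out (inR _ _ ((cross false).ends .nw)) at h1
      rw [o3, Bool.not_not] at h1
      exact h1
    have n2 : out ((twist false (n + 1)).ends .ne) = out (inL _ _ ((twist false n).ends .se)) := by
      have h1 := o2.opp () .sw
      change out (inR _ _ ((cross false).ends .ne)) = !out (inR _ _ ((cross false).ends .sw)) at h1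
      rw [o4, Bool.not_not] at h1
      exact h1
    have e2' : lam ((twist false (n + 1)).ends .ne) = lamS ((twist false n).ends .se) := e2
    have e3' : lam ((twist false (n + 1)).ends .se) = lamS ((twist false n).ends .ne)
        + (1 - ((mer tUnit (out ((twist false (n + 1)).ends .ne)))⁻¹ : ℤ[T;T⁻¹]ˣ))
          * (lamS ((twist false n).ends .se) - lamS ((twist false n).ends .ne)) := e3
    refine ⟨lam, ⟨g1, ?_, ?_, ?_, ?_⟩⟩
    · exact (g2 _).trans hS.sw
    · have := hS.values.sub_one (phi_ne_zero _ _) (phi_ne_zero _ _)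
      rw [e2', e3', map_add, map_mul, map_sub, map_sub, map_one, algebraMap_unit_inv,
        algebraMap_mer]
      have n1' : phi out ((twist false (n + 1)).ends .se)
        = phi (fun a => out (inL (twist false n) (cross false) a)) ((twist false n).ends .ne) := by
        simp only [phi, n1]
      have n2' : phi out ((twist false (n + 1)).ends .ne)
        = phi (fun a => out (inL (twist false n) (cross false) a)) ((twist false n).ends .se) := by
        simp only [phi, n2]
      rw [n1', n2']
      rw [show (-(((n + 1 : ℕ) : ℤ) + 1)) = -((n : ℤ) + 1) - 1 by push_cast; ring]
      exact this
    · rw [e2', hS.eval_se]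
      push_cast; ring
    · rw [e3', map_add, map_mul, map_sub, map_sub, map_one, evalNegOne_mer_inv, hS.eval_ne,
        hS.eval_se]
      push_cast; ring

theorem exists_isTwistGen {k : ℤ} (hk : k ≠ 0) {out : (int k).C × Corner → Bool}
    (h : IsOri (int k) out) : ∃ lam, IsTwistGen k (int k) out lam := by
  match k with
  | .ofNat 0 => exact absurd rfl hk
  | .ofNat (n + 1) => exact exists_isTwistGen_true n h
  | .negSucc n => exact exists_isTwistGen_false n h

/-- The properties of the generating colouring of a rational tangle with the given values of
`z_h` and `z_v` and the given fraction. -/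
structure IsRatGen (S : Tangle) (out : S.C × Corner → Bool) (z : K × K) (x : ℚ)
    (lam : S.C × Corner → ℤ[T;T⁻¹]) : Prop extends IsGen tUnit S out lam where
  sw : algebraMap _ K (lam (S.ends .sw)) = z.1
  ne : algebraMap _ K (lam (S.ends .ne)) = -z.2
  eval_sw : evalNegOne (lam (S.ends .sw)) ≠ 0
  eval_ne : -(evalNegOne (lam (S.ends .ne)) : ℚ) = x * evalNegOne (lam (S.ends .sw))

/-- Reflection swaps `z_h` and `z_v` and inverts the fraction. The hypothesis `y ≠ 0` keeps the
value at SW nonzero at `t = -1`, which the next step of the continued fraction needs. -/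
theorem IsRatGen.sigma {H : Tangle} {out : H.C × Corner → Bool} (h : IsOri H.sigma out)
    {z : K × K} {y : ℚ} (hy : y ≠ 0) {lam : H.C × Corner → ℤ[T;T⁻¹]}
    (hl : IsRatGen H (fun a => !out (mirror H a)) z y lam) :
    IsRatGen H.sigma out (z.2, z.1) y⁻¹ (fun a => - lam (mirror H a)) := by
  have e1 : mirror H (H.sigma.ends .sw) = H.ends .ne := mirror_mirror _
  have e2 : mirror H (H.sigma.ends .ne) = H.ends .sw := mirror_mirror _
  have h1 := hl.eval_ne
  have h2 : (evalNegOne (lam (H.ends .sw)) : ℚ) ≠ 0 := by exact_mod_cast hl.eval_sw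
  refine ⟨IsGen.sigma tUnit h hl.toIsGen, ?_, ?_, ?_, ?_⟩
  · rw [e1, map_neg, hl.ne, neg_neg]
  · rw [e2, map_neg, hl.sw]
  · rw [e1, map_neg, neg_ne_zero]
    intro h0
    rw [h0, Int.cast_zero, neg_zero] at h1
    exact mul_ne_zero hy h2 h1.symm
  · rw [e1, e2, map_neg, map_neg]
    push_cast
    rw [h1, neg_neg]
    field_simp

/-- The colour at the new NE end is `lamS ne - b * (lamS se - lamS ne)`. The relation between the
ends of `S` expresses the difference in brackets through `z_h` and `z_v`, with the coefficients of
the recursion. -/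
theorem IsRatGen.horiz_int {k : ℤ} (hk : k ≠ 0) {out : (S.horiz (int k)).C × Corner → Bool}
    (h : IsOri (S.horiz (int k)) out) {z : K × K} {x : ℚ} {lamS : S.C × Corner → ℤ[T;T⁻¹]}
    (hb : BoundaryRel tUnit S (fun a => out (inL S (int k) a)))
    (hl : IsRatGen S (fun a => out (inL S (int k) a)) z x lamS) {b ne se sw : K}
    (hbv : b = zvInt k (phi out ((S.horiz (int k)).ends .ne)) (phi out ((S.horiz (int k)).ends .se)))
    (hne : ne = phi (fun a => out (inL S (int k) a)) (S.ends .ne))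
    (hse : se = phi (fun a => out (inL S (int k) a)) (S.ends .se))
    (hsw : sw = phi (fun a => out (inL S (int k) a)) (S.ends .sw)) :
    ∃ lam, IsRatGen (S.horiz (int k)) out (z.1, z.2 + (1 - sw) / (1 - se⁻¹) * (z.1 * b)
      + (ne⁻¹ - se) / (1 - se) * (z.2 * b)) (k + x) lam := by
  obtain ⟨o1, o2, o3, o4⟩ := isOri_horiz.1 h
  obtain ⟨lamU, hU⟩ := exists_isTwistGen hk o2
  obtain ⟨lam, g1, g2, g3⟩ := IsGen.horiz tUnit h hl.toIsGen hU.toIsGen hU.sw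
  have e1 : lam ((S.horiz (int k)).ends .sw) = lamS (S.ends .sw) := g2 _
  have e2 : lam ((S.horiz (int k)).ends .ne) = lamS (S.ends .ne)
      + lamU ((int k).ends .ne) * (lamS (S.ends .se) - lamS (S.ends .ne)) := g3 _
  have hrel := hb.sum _ lamS hl.col.toPreCol hl.col.rel
  have hprod := hb.prod
  refine ⟨lam, ⟨g1, ?_, ?_, ?_, ?_⟩⟩
  · rw [e1]; exact hl.sw
  · have hv : algebraMap _ K (lamU ((int k).ends .ne)) = -b := hbv ▸ hU.values.eq_neg_zvInt
    have key : algebraMap _ K (lamS (S.ends .se)) - algebraMap _ K (lamS (S.ends .ne))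
        = (1 - sw) / (1 - se⁻¹) * z.1 + (ne⁻¹ - se) / (1 - se) * z.2 := by
      have s1 := congrArg (fun r => algebraMap ℤ[T;T⁻¹] K (((tUnit : ℤ[T;T⁻¹]) - 1) * r)) hrel
      simp only [boundarySum, hl.nw, smul_eq_mul, mul_zero, zero_add, map_zero] at s1
      have s2 := congrArg (fun r : ℤ[T;T⁻¹]ˣ => algebraMap _ K (r : ℤ[T;T⁻¹])) hprod
      simp only [boundaryProd, Units.val_mul, map_mul, algebraMap_mer, Units.val_one, map_one]
        at s2
      have f1 := fun b => congrArg (algebraMap _ K) (sub_one_mul_foxEnd tUnit b)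
      simp only [map_mul, map_sub, map_one] at f1
      simp only [map_mul, map_add, map_sub, map_one, algebraMap_mer, hl.sw, hl.ne] at s1
      rw [hl.ne]
      have f2 := f1 (out (inL S (int k) (S.ends .ne)))
      have f3 := f1 (out (inL S (int k) (S.ends .se)))
      have f4 := f1 (out (inL S (int k) (S.ends .sw)))
      rw [show algebraMap _ K (mer tUnit (out (inL S (int k) (S.ends .ne))) : ℤ[T;T⁻¹]ˣ).val
        = ne from hne ▸ algebraMap_mer (fun a => out (inL S (int k) a)) _] at f2
      rw [show algebraMap _ K (mer tUnit (out (inL S (int k) (S.ends .se))) : ℤ[T;T⁻¹]ˣ).val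
        = se from hse ▸ algebraMap_mer (fun a => out (inL S (int k) a)) _] at f3
      rw [show algebraMap _ K (mer tUnit (out (inL S (int k) (S.ends .sw))) : ℤ[T;T⁻¹]ˣ).val
        = sw from hsw ▸ algebraMap_mer (fun a => out (inL S (int k) a)) _] at f4
      have c1 : phi out (inL S (int k) (S.ends .ne)) = ne := hne.symm
      have c2 : phi out (inL S (int k) (S.ends .se)) = se := hse.symm
      have c3 : phi out (inL S (int k) (S.ends .sw)) = sw := hsw.symm
      rw [c1, c2] at s1
      rw [c1, c2, c3] at s2
      have hn0 : phi out (inL S (int k) (S.ends .nw)) ≠ 0 := phi_ne_zero _ _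
      generalize phi out (inL S (int k) (S.ends .nw)) = nw at *
      have n1 : ne ≠ 0 := hne ▸ phi_ne_zero _ _
      have n2 : se ≠ 0 := hse ▸ phi_ne_zero _ _
      have n3 : se ≠ 1 := hse ▸ phi_ne_one _ _
      have n4 : se - 1 ≠ 0 := sub_ne_zero.2 n3
      have n5 : 1 - se ≠ 0 := sub_ne_zero.2 n3.symm
      have n6 : 1 - se⁻¹ ≠ 0 := sub_ne_zero.2 (inv_ne_one.2 n3).symm
      generalize algebraMap _ K (lamS (S.ends .se)) = Y at *
      generalize algebraMap _ K (foxEnd tUnit (out (inL S (int k) (S.ends .ne))) : ℤ[T;T⁻¹]ˣ).val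
        = u2 at *
      generalize algebraMap _ K (foxEnd tUnit (out (inL S (int k) (S.ends .se))) : ℤ[T;T⁻¹]ˣ).val
        = u3 at *
      generalize algebraMap _ K (foxEnd tUnit (out (inL S (int k) (S.ends .sw))) : ℤ[T;T⁻¹]ˣ).val
        = u4 at *
      rw [algebraMap_tUnit] at *
      -- The relation between the ends multiplied by `t - 1`, with each `(t - 1) * foxEnd` replaced
      -- by the image of the arc minus `1`. It determines the colour `Y` at SE.
      have s3 : nw * ((ne - 1) * (-z.2) + ne * (se - 1) * Y + ne * se * (sw - 1) * z.1) = 0 := by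
        linear_combination s1 + nw * z.2 * f2 - nw * ne * Y * f3 - nw * ne * se * z.1 * f4
      have s4 := (mul_eq_zero.1 s3).resolve_left hn0
      have d1 : (1 - sw) / (1 - se⁻¹) = se * (1 - sw) / (se - 1) := by
        field_simp
      have d2 : (ne⁻¹ - se) / (1 - se) = (ne * se - 1) / (ne * (se - 1)) := by
        rw [div_eq_div_iff n5 (mul_ne_zero n1 n4)]
        field_simp
        ring
      rw [d1, d2]
      field_simp
      linear_combination s4
    rw [e2, map_add, map_mul, map_sub, hv, key, hl.ne]
    ring
  · rw [e1]; exact hl.eval_sw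
  -- At `t = -1` the relation says that the colour at SE is the sum of those at NE and SW, so adding
  -- `[k]` adds `k` to the fraction.
  · have s1 := congrArg evalNegOne hrel
    simp only [boundarySum, hl.nw, smul_eq_mul, mul_zero, zero_add, map_zero, map_add, map_mul,
      evalNegOne_mer, evalNegOne_foxEnd] at s1
    have s2 : evalNegOne (lamS (S.ends .se))
        = evalNegOne (lamS (S.ends .ne)) + evalNegOne (lamS (S.ends .sw)) := by
      linear_combination s1
    rw [e1, e2, map_add, map_mul, map_sub, s2, hU.eval_ne]
    have s3 := hl.eval_ne
    push_cast
    linear_combination s3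

theorem exists_isRatGen (l : List ℤ) : ∀ {x : ℚ}, IsContFrac l x →
    ∀ {out : (rational l).C × Corner → Bool}, IsOri (rational l) out →
    ∃ lam, IsRatGen (rational l) out (zPair l out) x lam := by
  induction l with
  | nil => exact fun h => h.elim
  | cons k l ih =>
    cases l with
    | nil =>
      rintro x ⟨hk, rfl⟩ out h
      obtain ⟨lam, hl⟩ := exists_isTwistGen hk h
      refine ⟨lam, ⟨hl.toIsGen, ?_, hl.values.eq_neg_zvInt, ?_, ?_⟩⟩
      · exact (congrArg _ hl.sw).trans (map_one _)
      · exact (congrArg _ hl.sw).trans_ne (by simp)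
      · have e1 : lam ((rational [k]).ends .sw) = 1 := hl.sw
        have e2 : evalNegOne (lam ((rational [k]).ends .ne)) = -k := hl.eval_ne
        rw [e1, e2]
        simp
    | cons k' l =>
      rintro x ⟨y, hy, hf, rfl⟩ out h
      match k with
      | .ofNat 0 =>
        have hS : IsOri (rational (k' :: l)).sigma out := h
        obtain ⟨lam, hl⟩ := ih hf hS.sigma
        have := hl.sigma hS hy
        refine ⟨_, ⟨this.toIsGen, this.sw, ?_, this.eval_sw, ?_⟩⟩
        -- No crossing is added for `[0]`, and `z_v([0]) = 0` removes both correction terms of the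
        -- recursion.
        · have hz : ∀ a b : K, zvInt (Int.ofNat 0) a b = 0 := by
            intro a b
            change zvInt 0 a b = 0
            simp [zvInt, qInt_zero]
          refine this.ne.trans ?_
          simp only [zPair, hz, mul_zero, add_zero]
          rfl
        · have h2 := this.eval_ne
          rw [show ((Int.ofNat 0 : ℤ) : ℚ) + 1 / y = y⁻¹ by simp]
          exact h2
      | .ofNat (n + 1) =>
        have h' : IsOri ((rational (k' :: l)).sigma.horiz (int (.ofNat (n + 1)))) out := h
        obtain ⟨hS, -, -, -⟩ := isOri_horiz.1 h'
        obtain ⟨lam, hl⟩ := ih hf hS.sigma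
        have := IsRatGen.horiz_int (k := Int.ofNat (n + 1)) (Int.ofNat_ne_zero.2 n.succ_ne_zero) h'
          (BoundaryRel.sigma _ hS (boundaryRel_rational _ _ hS.sigma)) (hl.sigma hS hy) rfl rfl rfl
          rfl
        rw [one_div]
        exact this
      | .negSucc n =>
        have h' : IsOri ((rational (k' :: l)).sigma.horiz (int (.negSucc n))) out := h
        obtain ⟨hS, -, -, -⟩ := isOri_horiz.1 h'
        obtain ⟨lam, hl⟩ := ih hf hS.sigma
        have := IsRatGen.horiz_int (Int.negSucc_ne_zero n) h'
          (BoundaryRel.sigma _ hS (boundaryRel_rational _ _ hS.sigma)) (hl.sigma hS hy) rfl rfl rfl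
          rfl
        rw [one_div]
        exact this

end Tangle

namespace Tangle

/-! ### How the strands of a rational tangle join its ends -/

/-- The orientation of the ends is compatible with the way in which a tangle of fraction `p / q`
joins them. -/
def EndsCompatible (o : Corner → Bool) (p q : ℤ) : Prop :=
  (Even p → o .ne = !o .nw ∧ o .se = !o .sw) ∧ (Even q → o .sw = !o .nw ∧ o .se = !o .ne) ∧
    (Odd p → Odd q → o .se = !o .nw ∧ o .sw = !o .ne)

/-- The fraction of the sum is `p / q + k = (p + q * k) / q`. Only parities enter, which leaves
finitely many cases. -/
theorem EndsCompatible.horiz {o₁ o₂ o : Corner → Bool} {p q k : ℤ} (hpq : Odd p ∨ Odd q)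
    (h₁ : EndsCompatible o₁ p q) (h₂ : EndsCompatible o₂ k 1)
    (hn : o₂ .nw = !o₁ .ne) (hs : o₂ .sw = !o₁ .se) (o1 : o .nw = o₁ .nw) (o2 : o .sw = o₁ .sw)
    (o3 : o .ne = o₂ .ne) (o4 : o .se = o₂ .se) : EndsCompatible o (p + q * k) q := by
  obtain ⟨a1, a2, a3⟩ := h₁
  obtain ⟨b1, -, b3⟩ := h₂
  have b3 := fun hk => b3 hk odd_one
  simp only [EndsCompatible, o1, o2, o3, o4]
  simp only [← Int.not_even_iff_odd, Int.even_add, Int.even_mul] at *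
  generalize Even p = P at *
  generalize Even q = Q at *
  generalize Even k = K at *
  by_cases hp : P <;> by_cases hq : Q <;> by_cases hk : K <;> simp_all

theorem EndsCompatible.diag {o : Corner → Bool} {p q : ℤ}
    (h : EndsCompatible (fun e => !o e.diag) p q) : EndsCompatible o q p := by
  obtain ⟨a1, a2, a3⟩ := h
  simp only [Corner.diag, Bool.not_not] at a1 a2 a3
  refine ⟨fun hq => ?_, fun hp => ?_, fun hq hp => ?_⟩
  · have := a2 hq; simp_all
  · have := a1 hp; simp_all
  · have := a3 hp hq; simp_all

theorem endsCompatible_cross (s : Bool) {out : (cross s).C × Corner → Bool}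
    (h : IsOri (cross s) out) {k : ℤ} (hk : Odd k) :
    EndsCompatible (fun e => out ((cross s).ends e)) k 1 :=
  ⟨fun h => absurd h (Int.not_even_iff_odd.2 hk), fun h => absurd h (by decide),
    fun _ _ => ⟨h.opp () .nw, h.opp () .ne⟩⟩

theorem EndsCompatible.congr {o : Corner → Bool} {p q p' q' : ℤ} (h : EndsCompatible o p q)
    (hp : Even p ↔ Even p') (hq : Even q ↔ Even q') : EndsCompatible o p' q' := by
  simpa only [EndsCompatible, ← Int.not_even_iff_odd, hp, hq] using h

theorem endsCompatible_twist (s : Bool) (n : ℕ) {out : (twist s n).C × Corner → Bool}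
    (h : IsOri (twist s n) out) : EndsCompatible (fun e => out ((twist s n).ends e)) (n + 1) 1 := by
  induction n with
  | zero => exact endsCompatible_cross s h (by decide)
  | succ n ih =>
    obtain ⟨o1, o2, o3, o4⟩ := isOri_horiz.1 h
    have := EndsCompatible.horiz (Or.inr odd_one) (ih o1)
      (endsCompatible_cross s o2 (k := 1) odd_one) o3 o4
      (o := fun e => out ((twist s (n + 1)).ends e)) rfl rfl rfl rfl
    simpa using this

theorem endsCompatible_int {k : ℤ} (hk : k ≠ 0) {out : (int k).C × Corner → Bool}
    (h : IsOri (int k) out) : EndsCompatible (fun e => out ((int k).ends e)) k 1 := by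
  match k with
  | .ofNat 0 => exact absurd rfl hk
  | .ofNat (n + 1) => exact endsCompatible_twist true n h
  | .negSucc n =>
    refine (endsCompatible_twist false n h).congr ?_ Iff.rfl
    rw [Int.negSucc_eq, even_neg]

/-- In lowest terms, `k + 1 / y` has the numerator `y.den + y.num * k` and the denominator `y.num`
up to a common sign, which parity does not see. -/
theorem even_add_one_div {y : ℚ} (hy : y ≠ 0) (k : ℤ) :
    (Even (y.den + y.num * k) ↔ Even ((k : ℚ) + 1 / y).num) ∧
      (Even y.num ↔ Even (((k : ℚ) + 1 / y).den : ℤ)) := by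
  have h1 : ((k : ℚ) + 1 / y).den = y.num.natAbs := by
    rw [Rat.intCast_add_den, one_div, Rat.den_inv_of_ne_zero hy]
  have hn : y.num ≠ 0 := Rat.num_ne_zero.2 hy
  have h2 : ((k : ℚ) + 1 / y).num * y.num = (k * y.num + y.den) * |y.num| := by
    have e1 := Rat.num_div_den ((k : ℚ) + 1 / y)
    have e2 := Rat.num_div_den y
    rw [h1] at e1
    have e3 : ((y.num.natAbs : ℕ) : ℚ) ≠ 0 := by
      rw [Nat.cast_ne_zero]; exact Int.natAbs_ne_zero.2 hn
    have e4 : (y.den : ℚ) ≠ 0 := by exact_mod_cast y.den_ne_zero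
    have e5 : (y.num : ℚ) ≠ 0 := by exact_mod_cast hn
    rw [div_eq_iff e3] at e1
    have : (((k : ℚ) + 1 / y).num : ℚ) * y.num = (k * y.num + y.den) * (y.num.natAbs : ℕ) := by
      rw [e1]
      have e6 : 1 / y = y.den / y.num := by
        nth_rw 1 [← e2]
        rw [one_div, inv_div]
      rw [e6]
      field_simp
    rw [← Int.natCast_natAbs]
    apply Int.cast_injective (α := ℚ)
    rw [Int.cast_mul, Int.cast_mul, Int.cast_add, Int.cast_mul, Int.cast_natCast, Int.cast_natCast]
    exact this
  constructor
  · rcases abs_choice y.num with h | h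
    · rw [h] at h2
      rw [mul_right_cancel₀ hn h2, add_comm, mul_comm]
    · rw [h, mul_neg, ← neg_mul] at h2
      rw [mul_right_cancel₀ hn h2, even_neg, add_comm, mul_comm]
  · rw [h1, Int.natCast_natAbs, even_abs]

theorem odd_num_or_odd_den (x : ℚ) : Odd x.num ∨ Odd (x.den : ℤ) := by
  by_contra! h
  rw [Int.not_odd_iff_even, Int.not_odd_iff_even, even_iff_two_dvd, even_iff_two_dvd] at h
  have h1 := x.reduced
  have h2 : 2 ∣ x.num.natAbs := Int.natCast_dvd.1 h.1
  have h3 : 2 ∣ x.den := by exact_mod_cast h.2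
  have := Nat.dvd_gcd h2 h3
  rw [h1] at this
  norm_num at this

theorem endsCompatible_rational (l : List ℤ) : ∀ {x : ℚ}, IsContFrac l x →
    ∀ {out : (rational l).C × Corner → Bool}, IsOri (rational l) out →
    EndsCompatible (fun e => out ((rational l).ends e)) x.num x.den := by
  induction l with
  | nil => exact fun h => h.elim
  | cons k l ih =>
    cases l with
    | nil =>
      rintro x ⟨hk, rfl⟩ out h
      exact (endsCompatible_int hk h).congr (by simp) (by simp)
    | cons k' l =>
      rintro x ⟨y, hy, hf, rfl⟩ out h
      have key : ∀ (k : ℤ), k ≠ 0 →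
          ∀ out : ((rational (k' :: l)).sigma.horiz (int k)).C × Corner → Bool, IsOri _ out →
          EndsCompatible (fun e => out (((rational (k' :: l)).sigma.horiz (int k)).ends e))
            ((k : ℚ) + 1 / y).num ((k : ℚ) + 1 / y).den := by
        intro k hk out h
        obtain ⟨hS, hU, hn, hs⟩ := isOri_horiz.1 h
        have h1 := EndsCompatible.diag (o := fun e => out (inL _ _ ((rational (k' :: l)).sigma.ends e)))
          (ih hf hS.sigma)
        have h2 := EndsCompatible.horiz ((odd_num_or_odd_den y).symm) h1
          (endsCompatible_int hk hU) hn hs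
          (o := fun e => out (((rational (k' :: l)).sigma.horiz (int k)).ends e)) rfl rfl rfl rfl
        exact h2.congr (even_add_one_div hy k).1 (even_add_one_div hy k).2
      match k with
      | .ofNat 0 =>
        have hS : IsOri (rational (k' :: l)).sigma out := h
        have h1 := EndsCompatible.diag (o := fun e => out ((rational (k' :: l)).sigma.ends e))
          (ih hf hS.sigma)
        refine h1.congr ?_ (even_add_one_div hy _).2
        have := (even_add_one_div hy 0).1
        rw [mul_zero, add_zero] at this
        exact this
      | .ofNat (n + 1) => exact key (.ofNat (n + 1)) (Int.ofNat_ne_zero.2 n.succ_ne_zero) out h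
      | .negSucc n => exact key (.negSucc n) (Int.negSucc_ne_zero n) out h

/-! ### Colourings of a closed vertical composition -/

section Closure

variable {m : ℕ} (T : Fin (m + 1) → Tangle)

/-- The link `D(T 0 ∗ ⋯ ∗ T m)`. -/
abbrev closure : LinkDiagram := (vertProd T).denominator

/-- A half-edge of the tangle `T i`, as a half-edge of `D(T 0 ∗ ⋯ ∗ T m)`. -/
def half (i : Fin (m + 1)) (h : (T i).C × Corner) : (closure T).C × Corner := port T i h

variable {T}

theorem closure_glue {i : Fin (m + 1)} {h h' : (T i).C × Corner} (hh : (T i).glue h = .inl h') :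
    (closure T).glue (half T i h) = half T i h' := by
  simp [closure, denominator, vertProd, half, port, hh]

/-- Addition in `Fin (m + 1)` is cyclic and `Fin.last m + 1 = 0`, so the arcs that close up the
denominator obey the same rule as the edges between consecutive tangles. -/
theorem closure_glue_sw (i : Fin (m + 1)) :
    (closure T).glue (half T i ((T i).ends .sw)) = half T (i + 1) ((T (i + 1)).ends .nw) := by
  have hend : ∀ j, 0 = j → port T 0 ((T 0).ends .nw) = port T j ((T j).ends .nw) := by
    rintro _ rfl; rfl
  by_cases hi : i = Fin.last m
  · subst hi
    simp only [closure, denominator, vertProd, half, port, Prod.mk.eta, glue_ends, if_true, Corner.flip]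
    exact hend _ (Fin.last_add_one m).symm
  · simp [closure, denominator, vertProd, half, port, glue_ends, hi]

theorem closure_glue_se (i : Fin (m + 1)) :
    (closure T).glue (half T i ((T i).ends .se)) = half T (i + 1) ((T (i + 1)).ends .ne) := by
  have hend : ∀ j, 0 = j → port T 0 ((T 0).ends .ne) = port T j ((T j).ends .ne) := by
    rintro _ rfl; rfl
  by_cases hi : i = Fin.last m
  · subst hi
    simp only [closure, denominator, vertProd, half, port, Prod.mk.eta, glue_ends, if_true, Corner.flip]
    exact hend _ (Fin.last_add_one m).symm
  · simp [closure, denominator, vertProd, half, port, glue_ends, hi]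

theorem closure_induction {P : (closure T).C × Corner → (closure T).C × Corner → Prop}
    (hsymm : ∀ a b, P a b → P b a)
    (hin : ∀ i h h', (T i).glue h = .inl h' → P (half T i h) (half T i h'))
    (hsw : ∀ i, P (half T i ((T i).ends .sw)) (half T (i + 1) ((T (i + 1)).ends .nw)))
    (hse : ∀ i, P (half T i ((T i).ends .se)) (half T (i + 1) ((T (i + 1)).ends .ne)))
    (h : (closure T).C × Corner) : P h ((closure T).glue h) := by
  obtain ⟨⟨i, c⟩, e⟩ := h
  change P (half T i (c, e)) ((closure T).glue (half T i (c, e)))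
  rcases hT : (T i).glue (c, e) with h' | e'
  · rw [closure_glue hT]; exact hin _ _ _ hT
  · rw [← ((T i).glue_eq_inr _ _).1 hT]
    have hi : i = i - 1 + 1 := by simp
    cases e'
    · rw [hi, ← closure_glue_sw, (closure T).glue_glue, closure_glue_sw]
      exact hsymm _ _ (hsw _)
    · rw [hi, ← closure_glue_se, (closure T).glue_glue, closure_glue_se]
      exact hsymm _ _ (hse _)
    · rw [closure_glue_sw]; exact hsw i
    · rw [closure_glue_se]; exact hse i

variable {R : Type} [CommRing R] (τ : Rˣ) {X : Type} [AddCommGroup X] [Module R X]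

/-- A function on the half-edges of a link diagram that is constant on the arcs. -/
structure _root_.MontesinosKnot.LinkDiagram.PreCol {X : Type} (D : LinkDiagram)
    (f : D.C × Corner → X) : Prop where
  glue : ∀ h, f (D.glue h) = f h
  strand : ∀ c e, e.onNWSE = D.overNWSE c → f (c, e.opp) = f (c, e)

theorem closure_preCol {X : Type} {f : (closure T).C × Corner → X} :
    (closure T).PreCol f ↔ (∀ i, PreCol (T i) fun h => f (half T i h)) ∧
      (∀ i, f (half T (i + 1) ((T (i + 1)).ends .nw)) = f (half T i ((T i).ends .sw))) ∧
      ∀ i, f (half T (i + 1) ((T (i + 1)).ends .ne)) = f (half T i ((T i).ends .se)) := by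
  constructor
  · intro h
    refine ⟨fun i => ⟨fun a b hab => ?_, fun c e he => h.strand ⟨i, c⟩ e he⟩, fun i => ?_, fun i => ?_⟩
    · rw [← closure_glue hab, h.glue]
    · rw [← closure_glue_sw, h.glue]
    · rw [← closure_glue_se, h.glue]
  · rintro ⟨h1, h2, h3⟩
    refine ⟨fun h => (closure_induction (P := fun a b => f b = f a) ?_ ?_ h2 h3 h), ?_⟩
    · intro a b hab; exact hab.symm
    · intro i a b hab; exact (h1 i).glue _ _ hab
    · rintro ⟨i, c⟩ e he
      exact (h1 i).strand c e he

variable (o : (closure T).Orientation)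

/-- The orientation of the `i`-th tangle. -/
def outAt (i : Fin (m + 1)) : (T i).C × Corner → Bool := fun h => o.out (half T i h)

theorem isOri_outAt (i : Fin (m + 1)) : IsOri (T i) (outAt o i) :=
  ⟨fun a b hab => by simp only [outAt]; rw [← closure_glue hab, o.out_glue],
    fun c e => o.out_opp ⟨i, c⟩ e⟩

theorem outAt_nw (i : Fin (m + 1)) :
    outAt o (i + 1) ((T (i + 1)).ends .nw) = !outAt o i ((T i).ends .sw) := by
  simp only [outAt]
  rw [← closure_glue_sw, o.out_glue]

theorem outAt_ne (i : Fin (m + 1)) :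
    outAt o (i + 1) ((T (i + 1)).ends .ne) = !outAt o i ((T i).ends .se) := by
  simp only [outAt]
  rw [← closure_glue_se, o.out_glue]

theorem sum_add_one (g : Fin (m + 1) → X) : ∑ i, g (i + 1) = ∑ i, g i :=
  Equiv.sum_comp (Equiv.addRight (1 : Fin (m + 1))) g

/-- The part of the boundary sum that belongs to two upper ends with the values `a` and `b`. -/
def topSum (nw ne : Bool) (a b : X) : X :=
  (foxEnd τ nw : R) • a + (mer τ nw * foxEnd τ ne : R) • b

/-- The boundary word is the product of its upper half `nw ne` and its lower half `se sw`. The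
inverse of the lower half is the upper word of the tangle below, and the total image is `1`; so the
derivative is a difference of two upper parts. -/
theorem boundarySum_eq_topSum_sub {out : Corner → Bool} (f : Corner → X)
    (h : boundaryProd τ out = 1) : boundarySum τ out f
      = topSum τ (out .nw) (out .ne) (f .nw) (f .ne)
        - topSum τ (!out .sw) (!out .se) (f .sw) (f .se) := by
  simp only [boundarySum, boundaryProd, topSum, mer_not, foxEnd_not] at h ⊢
  have h1 : ((mer τ (out .sw) : Rˣ) : R) * ((mer τ (out .sw))⁻¹ : Rˣ) = 1 := Units.mul_inv _
  have h2 : ((mer τ (out .se) : Rˣ) : R) * ((mer τ (out .se))⁻¹ : Rˣ) = 1 := Units.mul_inv _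
  have h4 := congrArg Units.val h
  push_cast at h4 ⊢
  generalize ((mer τ (out .se))⁻¹ : Rˣ).val = c' at *
  generalize ((mer τ (out .sw))⁻¹ : Rˣ).val = d' at *
  generalize (mer τ (out .ne)).val = b at *
  generalize (mer τ (out .se)).val = c at *
  generalize (mer τ (out .sw)).val = d at *
  generalize (mer τ (out .nw)).val = a at *
  have e1 : d' = a * b * c := by linear_combination -d' * h4 + a * b * c * h1
  have e2 : d' * c' = a * b := by rw [e1]; linear_combination a * b * h2
  match_scalars
  · ring
  · ring
  · linear_combination (-foxEnd τ (out .se) : R) * e2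
  · linear_combination (-foxEnd τ (out .sw) : R) * e1

/-- The boundary sums of the tangles telescope around the circle, hence add up to `0`. All of them
except the one containing `c₀` vanish, so that one vanishes too and implies the missing relation.
This makes the deletion of a row harmless. -/
theorem relAt_of_forall_ne {f : (closure T).C × Corner → X} (hf : (closure T).PreCol f)
    (hb : ∀ i, BoundaryRel τ (T i) (outAt o i)) (c₀ : (closure T).C)
    (h : ∀ c, c ≠ c₀ → RelAt τ o.out f c) : RelAt τ o.out f c₀ := by
  obtain ⟨f1, f2, f3⟩ := closure_preCol.1 hf
  obtain ⟨i₀, c₀⟩ := c₀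
  let bs : Fin (m + 1) → X := fun i => boundarySum τ (fun e => outAt o i ((T i).ends e))
    (fun e => f (half T i ((T i).ends e)))
  let top : Fin (m + 1) → X := fun i => topSum τ (outAt o i ((T i).ends .nw))
    (outAt o i ((T i).ends .ne)) (f (half T i ((T i).ends .nw))) (f (half T i ((T i).ends .ne)))
  have h1 : ∀ i, bs i = top i - top (i + 1) := by
    intro i
    simp only [bs, top]
    rw [boundarySum_eq_topSum_sub τ _ (hb i).prod, f2, f3, outAt_nw, outAt_ne]
  have h2 : ∑ i, bs i = 0 := by
    simp_rw [h1, Finset.sum_sub_distrib]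
    rw [sum_add_one top, sub_self]
  rw [Finset.sum_eq_single i₀] at h2
  · refine (hb i₀).rel X _ c₀ (f1 i₀) (fun c hc => h ⟨i₀, c⟩ ?_) h2
    intro h3
    cases h3
    exact hc rfl
  · intro i _ hi
    refine (hb i).sum X _ (f1 i) fun c => h ⟨i, c⟩ ?_
    intro h3
    exact hi (congrArg Sigma.fst h3)
  · simp

/-- The factor at the difference of the two upper ends of the `i`-th tangle in the boundary
sum. -/
def diffCoeff (i : Fin (m + 1)) : Rˣ :=
  -(mer τ (outAt o i ((T i).ends .nw)) * foxEnd τ (outAt o i ((T i).ends .ne)))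

/-- The factor at the value of the upper left end of the `i`-th tangle in the boundary sum. -/
def constCoeff (i : Fin (m + 1)) : R :=
  foxEnd τ (outAt o i ((T i).ends .nw))
    + mer τ (outAt o i ((T i).ends .nw)) * foxEnd τ (outAt o i ((T i).ends .ne))

/-- The relation between the ends of a tangle, applied to the constant colouring `1`, compares its
upper part with that of the next tangle. -/
theorem constCoeff_eq (hb : ∀ i, BoundaryRel τ (T i) (outAt o i)) (i : Fin (m + 1)) :
    constCoeff τ o i = constCoeff τ o 0 := by
  have step : ∀ i, constCoeff τ o (i + 1) = constCoeff τ o i := by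
    intro i
    have h1 := (hb i).sum R (fun _ => 1) ⟨fun _ _ _ => rfl, fun _ _ _ => rfl⟩
      fun c => relAt_const τ (isOri_outAt o i) 1 c
    rw [boundarySum_eq_topSum_sub τ _ (hb i).prod] at h1
    simp only [topSum, smul_eq_mul, mul_one] at h1
    rw [constCoeff, constCoeff, outAt_nw, outAt_ne]
    linear_combination -h1
  induction i using Fin.induction with
  | zero => rfl
  | succ i ih => rw [← ih, ← Fin.coeSucc_eq_succ, step]

/-- The relation between the ends eliminates the colour at SE, leaving only the values at SW and NE,
that is, `z_h` and `z_v`. -/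
theorem diffCoeff_succ_mul (hb : ∀ i, BoundaryRel τ (T i) (outAt o i)) (i : Fin (m + 1))
    {lam : (T i).C × Corner → R} (hl : IsGen τ (T i) (outAt o i) lam) :
    (diffCoeff τ o (i + 1) : R) * (lam ((T i).ends .sw) - lam ((T i).ends .se))
      = -(diffCoeff τ o i : R) * lam ((T i).ends .ne) - constCoeff τ o 0 * lam ((T i).ends .sw) := by
  have h1 := (hb i).sum R lam hl.col.toPreCol hl.col.rel
  rw [boundarySum_eq_topSum_sub τ _ (hb i).prod] at h1
  simp only [topSum, smul_eq_mul, hl.nw] at h1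
  have h2 := constCoeff_eq τ o hb (i + 1)
  rw [← h2]
  simp only [diffCoeff, constCoeff, outAt_nw, outAt_ne]
  push_cast
  linear_combination -h1

variable {lam : ∀ i, (T i).C × Corner → R}

/-- The matrix with which the differences of the colours of the tangles present the Alexander
module. -/
noncomputable def presentation (lam : ∀ i, (T i).C × Corner → R) :
    Matrix (Fin (m + 1)) (Fin (m + 1)) R :=
  chainMatrix
    (fun i => -(diffCoeff τ o i : R) * lam i ((T i).ends .ne)
      - constCoeff τ o 0 * lam i ((T i).ends .sw))
    (fun i => -(diffCoeff τ o i : R) * lam i ((T i).ends .ne))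
    (fun i => lam i ((T i).ends .sw))

theorem sum_presentation_last (u : Fin (m + 1) → X) :
    ∑ j, presentation τ o lam (Fin.last m) j • u j = ∑ j, lam j ((T j).ends .sw) • u j := by
  simp [presentation, chainMatrix]

/-- A row other than the last says that the right-hand ends of two consecutive tangles match,
multiplied by a unit. -/
theorem sum_presentation (hb : ∀ i, BoundaryRel τ (T i) (outAt o i))
    (hl : ∀ i, IsGen τ (T i) (outAt o i) (lam i)) (u : Fin (m + 1) → X) {i : Fin (m + 1)}
    (hi : i ≠ Fin.last m) :
    ∑ j, presentation τ o lam i j • u j = (diffCoeff τ o (i + 1) : R) •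
      ((lam i ((T i).ends .sw) - lam i ((T i).ends .se)) • u i
        + lam (i + 1) ((T (i + 1)).ends .ne) • u (i + 1)) := by
  simp only [presentation, chainMatrix, Matrix.of_apply, if_neg hi, sub_smul, ite_smul, zero_smul,
    Finset.sum_sub_distrib, Finset.sum_ite_eq', Finset.mem_univ, if_true]
  rw [← sub_smul, ← diffCoeff_succ_mul τ o hb i (hl i)]
  module

/-- The coefficients of a colouring satisfy the relations of the presentation matrix. -/
theorem sum_presentation_eq_zero (hb : ∀ i, BoundaryRel τ (T i) (outAt o i))
    (hl : ∀ i, IsGen τ (T i) (outAt o i) (lam i)) {f : (closure T).C × Corner → X}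
    (hf : (closure T).PreCol f) {u : Fin (m + 1) → X}
    (hu : ∀ i h, f (half T i h) = f (half T i ((T i).ends .nw)) + lam i h • u i) (i : Fin (m + 1)) :
    ∑ j, presentation τ o lam i j • u j = 0 := by
  obtain ⟨-, f2, f3⟩ := closure_preCol.1 hf
  by_cases hi : i = Fin.last m
  · subst hi
    -- The last row adds up the increments of the colour from one NW end to the next, which cancel
    -- around the circle.
    rw [sum_presentation_last]
    have h1 : ∀ j, lam j ((T j).ends .sw) • u j = f (half T (j + 1) ((T (j + 1)).ends .nw))
        - f (half T j ((T j).ends .nw)) := by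
      intro j
      rw [f2, hu j ((T j).ends .sw)]; abel
    simp_rw [h1, Finset.sum_sub_distrib]
    rw [sum_add_one (fun j => f (half T j ((T j).ends .nw))), sub_self]
  · rw [sum_presentation τ o hb hl u hi]
    have h1 := hu (i + 1) ((T (i + 1)).ends .ne)
    rw [f2, f3, hu i ((T i).ends .sw), hu i ((T i).ends .se)] at h1
    have h2 : (lam i ((T i).ends .sw) - lam i ((T i).ends .se)) • u i
        + lam (i + 1) ((T (i + 1)).ends .ne) • u (i + 1) = 0 := by
      rw [sub_smul, ← sub_eq_zero.2 h1.symm]; abel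
    rw [h2, smul_zero]

/-- The colours are combinations of the coefficients of a colouring and one colour. -/
theorem sub_mem_span {f : (closure T).C × Corner → X}
    (hf : (closure T).PreCol f) {u : Fin (m + 1) → X}
    (hu : ∀ i h, f (half T i h) = f (half T i ((T i).ends .nw)) + lam i h • u i)
    (h h' : (closure T).C × Corner) : f h - f h' ∈ Submodule.span R (Set.range u) := by
  obtain ⟨-, f2, -⟩ := closure_preCol.1 hf
  have hm : ∀ i, u i ∈ Submodule.span R (Set.range u) := fun i => Submodule.subset_span ⟨i, rfl⟩
  have h1 : ∀ i, f (half T i ((T i).ends .nw)) - f (half T 0 ((T 0).ends .nw))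
      ∈ Submodule.span R (Set.range u) := by
    intro i
    induction i using Fin.induction with
    | zero => rw [sub_self]; exact zero_mem _
    | succ i ih =>
      rw [← Fin.coeSucc_eq_succ, f2, hu _ ((T _).ends .sw), add_sub_right_comm]
      exact add_mem ih (Submodule.smul_mem _ _ (hm _))
  have h2 : ∀ h, f h - f (half T 0 ((T 0).ends .nw)) ∈ Submodule.span R (Set.range u) := by
    rintro ⟨⟨i, c⟩, e⟩
    change f (half T i (c, e)) - _ ∈ _
    rw [hu, add_sub_right_comm]
    exact add_mem (h1 i) (Submodule.smul_mem _ _ (hm i))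
  have := sub_mem (h2 h) (h2 h')
  rwa [sub_sub_sub_cancel_right] at this

/-- Solutions of the relations of the presentation matrix give colourings. -/
theorem exists_colouring (hb : ∀ i, BoundaryRel τ (T i) (outAt o i))
    (hl : ∀ i, IsGen τ (T i) (outAt o i) (lam i)) {u : Fin (m + 1) → X}
    (hu : ∀ i, ∑ j, presentation τ o lam i j • u j = 0) :
    ∃ f : (closure T).C × Corner → X, (closure T).PreCol f ∧ (∀ c, RelAt τ o.out f c) ∧
      ∀ i h, f (half T i h) = f (half T i ((T i).ends .nw)) + lam i h • u i := by
  -- `A i` is the colour at the NW end of the `i`-th tangle, normalised to `0` at the first. The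
  -- last row of the matrix makes it close up.
  let A : Fin (m + 1) → X := fun i => ∑ j ∈ Finset.Iio i, lam j ((T j).ends .sw) • u j
  let f : (closure T).C × Corner → X := fun h => A h.1.1 + lam h.1.1 (h.1.2, h.2) • u h.1.1
  have fA : ∀ i h, f (half T i h) = A i + lam i h • u i := fun i h => rfl
  have hlast : ∑ j, lam j ((T j).ends .sw) • u j = 0 := by
    rw [← sum_presentation_last (τ := τ) o u, hu]
  have hA : ∀ i, A (i + 1) = A i + lam i ((T i).ends .sw) • u i := by
    intro i
    by_cases hi : i = Fin.last m
    · subst hi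
      have h1 : A (Fin.last m + 1) = 0 := by
        simp only [A, Fin.last_add_one]
        rw [show Finset.Iio (0 : Fin (m + 1)) = ∅ by ext j; simp, Finset.sum_empty]
      rw [h1, ← hlast]
      have h2 : (Finset.univ : Finset (Fin (m + 1))) = insert (Fin.last m) (Finset.Iio (Fin.last m)) := by
        ext j
        simp only [Finset.mem_univ, Finset.mem_insert, Finset.mem_Iio, Fin.lt_last_iff_ne_last, em]
      rw [h2, Finset.sum_insert (by simp), add_comm]
    · have h2 : Finset.Iio (i + 1) = insert i (Finset.Iio i) := by
        ext j
        obtain ⟨i, rfl⟩ := Fin.exists_castSucc_eq.2 hi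
        rw [Fin.coeSucc_eq_succ]
        simp only [Finset.mem_Iio, Finset.mem_insert, Fin.lt_def, Fin.ext_iff, Fin.val_succ,
          Fin.val_castSucc]
        omega
      simp only [A]
      rw [h2, Finset.sum_insert (by simp), add_comm]
  let d : Fin (m + 1) → X := fun i =>
    (lam i ((T i).ends .sw) - lam i ((T i).ends .se)) • u i
        + lam (i + 1) ((T (i + 1)).ends .ne) • u (i + 1)
  have hd0 : ∀ i, i ≠ Fin.last m → d i = 0 := by
    intro i hi
    have h1 := hu i
    rwa [sum_presentation τ o hb hl u hi, ← Units.smul_def, smul_eq_zero_iff_eq] at h1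
  -- Weighted with the units `diffCoeff`, the defects `d i` of the matching at the right-hand ends
  -- telescope, up to a multiple of the closing relation on the left. Hence the last defect, for
  -- which the matrix has no row, vanishes with the others.
  have hdsum : ∑ i, (diffCoeff τ o (i + 1) : R) • d i = 0 := by
    let w : Fin (m + 1) → X := fun i => ((diffCoeff τ o i : R) * lam i ((T i).ends .ne)) • u i
    have h1 : ∀ i, (diffCoeff τ o (i + 1) : R) • d i
        = w (i + 1) - w i - constCoeff τ o 0 • lam i ((T i).ends .sw) • u i := by
      intro i
      simp only [d, w]
      rw [smul_add, smul_smul, diffCoeff_succ_mul τ o hb i (hl i)]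
      module
    simp_rw [h1, Finset.sum_sub_distrib]
    rw [sum_add_one w, sub_self, ← Finset.smul_sum, hlast]
    simp
  have hd : ∀ i, d i = 0 := by
    intro i
    by_cases hi : i = Fin.last m
    · subst hi
      rw [Finset.sum_eq_single (Fin.last m)] at hdsum
      · rwa [← Units.smul_def, smul_eq_zero_iff_eq] at hdsum
      · intro i _ hi
        rw [hd0 i hi, smul_zero]
      · simp
    · exact hd0 i hi
  have hcol : ∀ i, IsCol τ (T i) (outAt o i) (fun h => f (half T i h)) := fun i =>
    isCol_add_smul τ (isOri_outAt o i) (hl i).col (A i) (u i)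
  refine ⟨f, closure_preCol.2 ⟨fun i => (hcol i).toPreCol, fun i => ?_, fun i => ?_⟩,
    fun c => (hcol c.1).rel c.2, fun i h => ?_⟩
  · rw [fA, fA, hA, (hl (i + 1)).nw, zero_smul, add_zero]
  · rw [fA, fA, hA]
    have := hd i
    simp only [d, sub_smul] at this
    rw [sub_add_eq_add_sub, sub_eq_zero] at this
    rw [← this]; abel
  · rw [fA, fA, (hl i).nw, zero_smul, add_zero]

end Closure

end Tangle

/-! ### Wirtinger relators and the relations of colourings -/

section Wirtinger

variable {α X : Type} [AddCommGroup X] [Module ℤ[T;T⁻¹] X] {ι : Type} [Fintype ι]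

theorem foxSum_positive (x : ι ≃ α) (f : α → X) (a b c : α) :
    foxSum x f (FreeGroup.of a * FreeGroup.of b * (FreeGroup.of a)⁻¹ * (FreeGroup.of c)⁻¹)
      = (1 - (tUnit : ℤ[T;T⁻¹])) • f a + (tUnit : ℤ[T;T⁻¹]) • f b - f c := by
  simp only [foxSum_mul, foxSum_of, foxSum_inv, Phi_of_mul, Phi_of_of, Phi_of_inv]
  have h : (tUnit : ℤ[T;T⁻¹]) * ((tUnit⁻¹ : ℤ[T;T⁻¹]ˣ) : ℤ[T;T⁻¹]) = 1 := Units.mul_inv _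
  generalize ((tUnit⁻¹ : ℤ[T;T⁻¹]ˣ) : ℤ[T;T⁻¹]) = s at *
  generalize (tUnit : ℤ[T;T⁻¹]) = r at *
  match_scalars
  · linear_combination -r * h
  · ring
  · linear_combination (-r * s - 1) * h

theorem foxSum_negative (x : ι ≃ α) (f : α → X) (a b c : α) :
    foxSum x f ((FreeGroup.of a)⁻¹ * FreeGroup.of b * FreeGroup.of a * (FreeGroup.of c)⁻¹)
      = (1 - ((tUnit⁻¹ : ℤ[T;T⁻¹]ˣ) : ℤ[T;T⁻¹])) • f a
        + ((tUnit⁻¹ : ℤ[T;T⁻¹]ˣ) : ℤ[T;T⁻¹]) • f b - f c := by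
  simp only [foxSum_mul, foxSum_of, foxSum_inv, Phi_of_mul, Phi_of_of, Phi_of_inv]
  have h : (tUnit : ℤ[T;T⁻¹]) * ((tUnit⁻¹ : ℤ[T;T⁻¹]ˣ) : ℤ[T;T⁻¹]) = 1 := Units.mul_inv _
  generalize ((tUnit⁻¹ : ℤ[T;T⁻¹]ˣ) : ℤ[T;T⁻¹]) = s at *
  generalize (tUnit : ℤ[T;T⁻¹]) = r at *
  match_scalars
  · linear_combination h
  · ring
  · linear_combination (-r * s - 1) * h

end Wirtinger

namespace LinkDiagram

variable {D : LinkDiagram}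

theorem arc_glue (h : D.C × Corner) : D.arc (D.glue h) = D.arc h :=
  (Quot.sound (r := fun a b : D.C × Corner =>
    b = D.glue a ∨ (a.2.onNWSE = D.overNWSE a.1 ∧ b = (a.1, a.2.opp))) (Or.inl rfl)).symm

theorem arc_opp (c : D.C) (e : Corner) (he : e.onNWSE = D.overNWSE c) :
    D.arc (c, e.opp) = D.arc (c, e) :=
  (Quot.sound (r := fun a b : D.C × Corner =>
    b = D.glue a ∨ (a.2.onNWSE = D.overNWSE a.1 ∧ b = (a.1, a.2.opp)))
    (a := (c, e)) (Or.inr ⟨he, rfl⟩)).symm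

theorem preCol_arc {X : Type} (F : D.Arc → X) : D.PreCol (fun h => F (D.arc h)) :=
  ⟨fun h => congrArg F (arc_glue h), fun c e he => congrArg F (arc_opp c e he)⟩

theorem eq_zero_iff_of_eq_smul {R X : Type} [CommRing R] [AddCommGroup X] [Module R X] (w : Rˣ)
    {a b : X} (h : a = (w : R) • b) : a = 0 ↔ b = 0 := by
  rw [h, ← Units.smul_def, smul_eq_zero_iff_eq]

/-- The relator and the boundary word of the crossing express the same conjugation relation; their
Fox derivatives differ by a unit that depends on the over-strand and the two directions, hence the
eight cases. -/
theorem foxSum_relator_eq_zero_iff {X : Type} [AddCommGroup X] [Module ℤ[T;T⁻¹] X] {ι : Type}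
    [Fintype ι] (o : D.Orientation) (x : ι ≃ D.Arc) (F : D.Arc → X) (c : D.C) :
    foxSum x F (o.relator c) = 0 ↔ Tangle.RelAt tUnit o.out (fun h => F (D.arc h)) c := by
  have h : (tUnit : ℤ[T;T⁻¹]) * ((tUnit⁻¹ : ℤ[T;T⁻¹]ˣ) : ℤ[T;T⁻¹]) = 1 := Units.mul_inv _
  have hnw := o.out_opp c .nw
  have hne := o.out_opp c .ne
  simp only [Corner.opp] at hnw hne
  rcases hs : D.overNWSE c
  · have e1 : F (D.arc (c, .sw)) = F (D.arc (c, .ne)) := congrArg F (arc_opp c .ne (by rw [hs]; rfl))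
    rw [Tangle.RelAt, boundarySum_of_sw_eq_ne tUnit _ _ hnw hne e1,
      eq_zero_iff_of_eq_smul (foxEnd tUnit (o.out (c, .nw))) rfl]
    rcases h1 : o.out (c, .nw) <;> rcases h2 : o.out (c, .ne)
    all_goals
      have hp : o.Positive c ↔ o.underOut c = (o.overOut c).ccw := Iff.rfl
      simp only [Orientation.underOut, Orientation.overOut, hs, Orientation.outCorner, h1, h2,
        Bool.not_false, if_true, Bool.false_eq_true, if_false, Corner.ccw, reduceCtorEq] at hp
      simp only [Orientation.relator, Orientation.underOut, Orientation.overOut, hs,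
        Orientation.outCorner, h1, h2, hp,
        Bool.not_false, if_true, Bool.false_eq_true, if_false, Corner.opp]
    · rw [foxSum_positive, e1]
      refine eq_zero_iff_of_eq_smul tUnit ?_
      simp only [mer, cond_false]
      match_scalars
      · linear_combination -h
      · ring
      · linear_combination h
    · rw [foxSum_negative]
      refine eq_zero_iff_of_eq_smul tUnit⁻¹ ?_
      simp only [mer, cond_true]
      match_scalars
      · linear_combination -h
      · ring
      · linear_combination h
    · rw [foxSum_negative, e1]
      refine eq_zero_iff_of_eq_smul (-1 : ℤ[T;T⁻¹]ˣ) ?_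
      simp only [mer, cond_false, Units.val_neg, Units.val_one]
      module
    · rw [foxSum_positive]
      refine eq_zero_iff_of_eq_smul (-1 : ℤ[T;T⁻¹]ˣ) ?_
      simp only [mer, cond_true, Units.val_neg, Units.val_one]
      module
  · have e1 : F (D.arc (c, .se)) = F (D.arc (c, .nw)) := congrArg F (arc_opp c .nw (by rw [hs]; rfl))
    rw [Tangle.RelAt, boundarySum_of_se_eq_nw tUnit _ _ hnw hne e1, ← Units.val_mul,
      eq_zero_iff_of_eq_smul _ rfl, hnw]
    rcases h1 : o.out (c, .nw) <;> rcases h2 : o.out (c, .ne)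
    all_goals
      have hp : o.Positive c ↔ o.underOut c = (o.overOut c).ccw := Iff.rfl
      simp only [Orientation.underOut, Orientation.overOut, hs, Orientation.outCorner, h1, h2,
        Bool.not_true, if_true, Bool.false_eq_true, if_false, Corner.ccw, reduceCtorEq] at hp
      simp only [Orientation.relator, Orientation.underOut, Orientation.overOut, hs,
        Orientation.outCorner, h1, h2, hp,
        Bool.not_true, if_true, Bool.false_eq_true, if_false, Corner.opp]
    · rw [foxSum_negative, e1]
      refine eq_zero_iff_of_eq_smul tUnit⁻¹ ?_
      simp only [mer, Bool.not_false, cond_true]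
      match_scalars
      · linear_combination -h
      · ring
      · linear_combination h
    · rw [foxSum_positive, e1]
      refine eq_zero_iff_of_eq_smul (-1 : ℤ[T;T⁻¹]ˣ) ?_
      simp only [mer, Bool.not_false, cond_true, Units.val_neg, Units.val_one]
      module
    · rw [foxSum_positive]
      refine eq_zero_iff_of_eq_smul tUnit ?_
      simp only [mer, cond_false]
      match_scalars
      · linear_combination -h
      · ring
      · linear_combination h
    · rw [foxSum_negative]
      refine eq_zero_iff_of_eq_smul (-1 : ℤ[T;T⁻¹]ˣ) ?_
      simp only [mer, cond_false, Units.val_neg, Units.val_one]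
      module

/-! ### A knot diagram has as many arcs as crossings -/

section Arcs

variable (o : D.Orientation)

/-- The half-edges that are directed away from their crossings. -/
abbrev OutHalf : Type := {h : D.C × Corner // o.out h = true}

theorem _root_.MontesinosKnot.Corner.opp_opp (e : Corner) : e.opp.opp = e := by cases e <;> rfl

theorem opp_onNWSE (e : Corner) : e.opp.onNWSE = e.onNWSE := by cases e <;> rfl

/-- The half-edge at which the strand leaves the preceding crossing. -/
def prev : OutHalf o → OutHalf o := fun h =>
  ⟨D.glue (h.1.1, h.1.2.opp), by rw [o.out_glue, o.out_opp, Bool.not_not]; exact h.2⟩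

/-- The half-edge at which the strand leaves the next crossing. -/
def next : OutHalf o → OutHalf o := fun h =>
  ⟨((D.glue h.1).1, (D.glue h.1).2.opp), by
    rw [o.out_opp, show ((D.glue h.1).1, (D.glue h.1).2) = D.glue h.1 from rfl, o.out_glue,
      Bool.not_not]
    exact h.2⟩

theorem next_prev (h : OutHalf o) : next o (prev o h) = h := by
  apply Subtype.ext
  simp only [next, prev, D.glue_glue, Corner.opp_opp]

theorem prev_next (h : OutHalf o) : prev o (next o h) = h := by
  apply Subtype.ext
  simp only [next, prev, Corner.opp_opp, Prod.mk.eta, D.glue_glue]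

/-- Going back along the link, as a permutation. -/
def prevPerm : Equiv.Perm (OutHalf o) := ⟨prev o, next o, next_prev o, prev_next o⟩

/-- The half-edge is the beginning of an arc. -/
def IsStart (h : OutHalf o) : Prop := h.1.2 = o.underOut h.1.1

/-- The half of the edge of `h` that is directed away from its crossing. -/
def toOut (h : D.C × Corner) : OutHalf o :=
  if hh : o.out h = true then ⟨h, hh⟩ else ⟨D.glue h, by rw [o.out_glue]; simpa using hh⟩

theorem toOut_of_out {h : D.C × Corner} (hh : o.out h = true) : toOut o h = ⟨h, hh⟩ := dif_pos hh

theorem toOut_glue (h : D.C × Corner) : toOut o (D.glue h) = toOut o h := by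
  unfold toOut
  by_cases hh : o.out h = true
  · have h2 : ¬ o.out (D.glue h) = true := by rw [o.out_glue, hh]; simp
    rw [dif_neg h2, dif_pos hh]
    exact Subtype.ext (D.glue_glue h)
  · have h2 : o.out (D.glue h) = true := by rw [o.out_glue]; simpa using hh
    rw [dif_pos h2, dif_neg hh]

theorem prev_toOut {c : D.C} {e : Corner} (h : o.out (c, e) = true) :
    prev o (toOut o (c, e)) = toOut o (c, e.opp) := by
  have h2 : ¬ o.out (c, e.opp) = true := by rw [o.out_opp, h]; simp
  rw [toOut_of_out o h]
  unfold toOut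
  rw [dif_neg h2]
  rfl

theorem out_underOut (c : D.C) : o.out (c, o.underOut c) = true := by
  unfold Orientation.underOut Orientation.outCorner
  have h1 := o.out_opp c .nw
  have h2 := o.out_opp c .ne
  simp only [Corner.opp] at h1 h2
  cases D.overNWSE c <;> cases h3 : o.out (c, .nw) <;> cases h4 : o.out (c, .ne) <;> simp_all

/-- The half-edge at which an arc begins at the crossing `c`. -/
def start (c : D.C) : OutHalf o := ⟨(c, o.underOut c), out_underOut o c⟩

theorem onNWSE_of_not_isStart {h : OutHalf o} (hh : ¬ IsStart o h) :
    h.1.2.onNWSE = D.overNWSE h.1.1 := by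
  obtain ⟨⟨c, e⟩, he⟩ := h
  simp only [IsStart, Orientation.underOut, Orientation.outCorner] at hh ⊢
  have h1 := o.out_opp c .nw
  have h2 := o.out_opp c .ne
  simp only [Corner.opp] at h1 h2
  cases hs : D.overNWSE c <;> cases e <;> simp_all [Corner.onNWSE]

theorem not_isStart_of_onNWSE {h : OutHalf o} (hh : h.1.2.onNWSE = D.overNWSE h.1.1) :
    ¬ IsStart o h := by
  obtain ⟨⟨c, e⟩, he⟩ := h
  simp only [IsStart, Orientation.underOut, Orientation.outCorner] at hh ⊢
  cases hs : D.overNWSE c <;> cases e <;> simp_all [Corner.onNWSE] <;> split_ifs <;> simp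

theorem arc_toOut (h : D.C × Corner) : D.arc (toOut o h).1 = D.arc h := by
  unfold toOut
  split_ifs
  · rfl
  · exact arc_glue h

theorem arc_prev {h : OutHalf o} (hh : ¬ IsStart o h) : D.arc (prev o h).1 = D.arc h.1 :=
  (arc_glue _).trans (arc_opp _ _ (onNWSE_of_not_isStart o hh))

/-- A knot has one component, so walking backwards along it passes through all outgoing half-edges,
in particular through one at which an arc begins. -/
theorem exists_iterate_isStart (hD : D.IsKnot) (h : OutHalf o) : ∃ n, IsStart o ((prev o)^[n] h) := by
  obtain ⟨⟨c⟩, hconn⟩ := hD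
  have hfin : Finite (OutHalf o) := by
    have := D.finite
    have : Finite Corner := Finite.of_injective (fun e : Corner => (e.onNWSE, (e = .nw ∨ e = .ne : Bool)))
      (by intro a b; cases a <;> cases b <;> simp [Corner.onNWSE])
    exact Subtype.finite
  have step : ∀ a b : D.C × Corner, (b = D.glue a ∨ b = (a.1, a.2.opp)) →
      (prevPerm o).SameCycle (toOut o a) (toOut o b) := by
    rintro a _ (rfl | rfl)
    · rw [toOut_glue]
    · by_cases ha : o.out a = true
      · have : prevPerm o (toOut o a) = toOut o (a.1, a.2.opp) := prev_toOut o ha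
        rw [← this]
        exact (Equiv.Perm.SameCycle.refl _ _).apply_right
      · have h1 : o.out (a.1, a.2.opp) = true := by
          rw [o.out_opp]; simpa using ha
        have : prevPerm o (toOut o (a.1, a.2.opp)) = toOut o a := by
          have := prev_toOut o h1
          rwa [Corner.opp_opp] at this
        rw [← this]
        exact (Equiv.Perm.SameCycle.refl _ _).apply_left
  have hcyc : ∀ a b : D.C × Corner, (prevPerm o).SameCycle (toOut o a) (toOut o b) := by
    intro a b
    induction hconn a b with
    | rel a b hab => exact step a b hab
    | refl a => exact Equiv.Perm.SameCycle.refl _ _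
    | symm a b _ ih => exact ih.symm
    | trans a b c _ _ ih1 ih2 => exact ih1.trans ih2
  have h1 := hcyc h.1 (c, o.underOut c)
  rw [toOut_of_out o h.2, toOut_of_out o (out_underOut o c)] at h1
  obtain ⟨n, -, hn⟩ := h1.exists_pow_eq'
  refine ⟨n, ?_⟩
  rw [← Equiv.Perm.iterate_eq_pow] at hn
  have hn' : (prev o)^[n] h = start o c := hn
  rw [hn']
  rfl

-- Each crossing starts one arc, at its outgoing under-strand; walking back along an arc to its
-- beginning recovers the crossing. A component without undercrossings would break this count, which
-- is where the knot hypothesis enters.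
open Classical in
theorem card_arc (o : D.Orientation) (hD : D.IsKnot) : Nat.card D.Arc = Nat.card D.C := by
  have hex := exists_iterate_isStart o hD
  -- `s h` is the crossing at which the walk back from `h` first meets the beginning of an arc. It
  -- is constant along arcs.
  let s : OutHalf o → D.C := fun h => ((prev o)^[Nat.find (hex h)] h).1.1
  have hs0 : ∀ h, IsStart o h → s h = h.1.1 := by
    intro h hh
    have : Nat.find (hex h) = 0 := (Nat.find_eq_zero _).2 hh
    simp only [s, this, Function.iterate_zero, id]
  have hs1 : ∀ h, ¬ IsStart o h → s h = s (prev o h) := by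
    intro h hh
    have : Nat.find (hex h) = Nat.find (hex (prev o h)) + 1 :=
      Nat.find_comp_succ (hex h) (hex (prev o h)) hh
    simp only [s, this, Function.iterate_succ, Function.comp]
  let S : D.Arc → D.C := Quot.lift (fun h => s (toOut o h)) (by
    rintro a _ (rfl | ⟨ha, rfl⟩)
    · simp only [toOut_glue]
    · by_cases h1 : o.out a = true
      · have h2 := prev_toOut o h1
        change s (toOut o (a.1, a.2)) = _
        rw [← h2]
        refine hs1 _ (not_isStart_of_onNWSE o ?_)
        rw [toOut_of_out o h1]
        exact ha
      · have h1 : o.out (a.1, a.2.opp) = true := by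
          rw [o.out_opp]; simpa using h1
        have h2 := prev_toOut o h1
        rw [Corner.opp_opp] at h2
        change s (toOut o (a.1, a.2)) = _
        rw [← h2]
        refine (hs1 _ (not_isStart_of_onNWSE o ?_)).symm
        rw [toOut_of_out o h1]
        exact (opp_onNWSE a.2).trans ha)
  have hit : ∀ n h, (∀ j < n, ¬ IsStart o ((prev o)^[j] h)) →
      D.arc ((prev o)^[n] h).1 = D.arc h.1 := by
    intro n
    induction n with
    | zero => intro h _; rfl
    | succ n ih =>
      intro h hh
      rw [Function.iterate_succ_apply', arc_prev o (hh n n.lt_succ_self)]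
      exact ih h fun j hj => hh j (hj.trans n.lt_succ_self)
  refine (Nat.card_eq_of_bijective (fun c => D.arc (start o c).1) ⟨?_, ?_⟩).symm
  · refine Function.LeftInverse.injective (g := S) fun c => ?_
    change s (toOut o (start o c).1) = c
    rw [toOut_of_out o (start o c).2]
    exact hs0 _ rfl
  · rintro ⟨h⟩
    refine ⟨s (toOut o h), ?_⟩
    change D.arc _ = D.arc h
    rw [← arc_toOut o h, ← hit (Nat.find (hex (toOut o h))) (toOut o h) fun j hj => Nat.find_min _ hj]
    have h1 : IsStart o _ := Nat.find_spec (hex (toOut o h))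
    exact congrArg D.arc (Prod.ext rfl h1.symm)

end Arcs

end LinkDiagram

/-! ### Comparison of the presentation matrix with the Alexander minors -/

namespace Tangle

section Closure

variable {m : ℕ} {T : Fin (m + 1) → Tangle} (o : (closure T).Orientation)
  {lam : ∀ i, (T i).C × Corner → ℤ[T;T⁻¹]}

theorem foxSum_eq_sum_succAbove {α X : Type} [AddCommGroup X] [Module ℤ[T;T⁻¹] X] {n : ℕ}
    (x : Fin (n + 1) ≃ α) (F : α → X) {j₀ : Fin (n + 1)} (hF : F (x j₀) = 0) (w : FreeGroup α) :
    foxSum x F w = ∑ j, Phi (foxDeriv (x (j₀.succAbove j)) w) • F (x (j₀.succAbove j)) := by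
  rw [foxSum, Fin.sum_univ_succAbove _ j₀, hF, smul_zero, zero_add]

variable {n : ℕ} (x : Fin (n + 1) ≃ (closure T).Arc) (c : Fin (n + 1) ≃ (closure T).C)

/-- The matrix obtained from the matrix of the Fox derivatives of the Wirtinger relators by
deleting a row and a column. -/
noncomputable def alexanderMinor (i₀ j₀ : Fin (n + 1)) : Matrix (Fin n) (Fin n) ℤ[T;T⁻¹] :=
  (Matrix.of fun i j => Phi (foxDeriv (x j) (o.relator (c i)))).submatrix i₀.succAbove j₀.succAbove

/-- The generators of the module presented by `presentation` are the coefficients of a colouring of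
the knot. Its colours satisfy the rows of the Alexander minor and generate the same module. -/
theorem det_presentation_dvd (hb : ∀ i, BoundaryRel tUnit (T i) (outAt o i))
    (hl : ∀ i, IsGen tUnit (T i) (outAt o i) (lam i)) (i₀ j₀ : Fin (n + 1)) :
    (presentation tUnit o lam).det ∣ (alexanderMinor o x c i₀ j₀).det := by
  set N := presentation tUnit o lam
  obtain ⟨f, hf, hrel, hfu⟩ := exists_colouring tUnit o hb hl (u := RowQuotient.gen N)
    fun i => RowQuotient.sum_row N i
  let F : (closure T).Arc → RowQuotient N := Quot.lift f (by
    rintro a _ (rfl | ⟨ha, rfl⟩)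
    · exact (hf.glue a).symm
    · exact (hf.strand a.1 a.2 ha).symm)
  -- Subtracting the colour of the arc whose column is deleted makes that colour `0`; constants
  -- satisfy every relation, so `G` is still a colouring.
  let G : (closure T).Arc → RowQuotient N := fun a => F a - F (x j₀)
  have hG0 : G (x j₀) = 0 := sub_self _
  have hGrel : ∀ c, RelAt tUnit o.out (fun h => G ((closure T).arc h)) c := by
    intro c
    have h1 := hrel c
    have h2 : RelAt tUnit o.out (fun _ => -F (x j₀)) c :=
      relAt_const tUnit (isOri_outAt o c.1) (-F (x j₀)) c.2
    unfold RelAt at h1 h2 ⊢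
    have h3 := boundarySum_add tUnit (fun e => o.out (c, e)) (fun e => f (c, e))
      (fun _ => -F (x j₀))
    rw [h1, h2, add_zero] at h3
    simp only [G, sub_eq_add_neg]
    exact h3
  refine det_dvd_det_of_relations _ N (fun j => G (x (j₀.succAbove j))) (RowQuotient.gen N)
    (fun i => ?_) (RowQuotient.relation_of_sum_eq_zero N)
    (fun i => RowQuotient.exists_eq_sum N _) (fun i => ?_)
  · have h1 := (LinkDiagram.foxSum_relator_eq_zero_iff o x G (c (i₀.succAbove i))).2 (hGrel _)
    rwa [foxSum_eq_sum_succAbove x G hG0] at h1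
  · have hspan : ∀ a, G a ∈ Submodule.span ℤ[T;T⁻¹]
        (Set.range fun j => G (x (j₀.succAbove j))) := by
      intro a
      obtain ⟨j, rfl⟩ := x.surjective a
      by_cases hj : j = j₀
      · rw [hj, hG0]; exact zero_mem _
      · obtain ⟨j, rfl⟩ := Fin.exists_succAbove_eq hj
        exact Submodule.subset_span ⟨j, rfl⟩
    -- Two values of `lam i` that differ by `1` exhibit the coefficient of the tangle as a
    -- difference of two colours.
    obtain ⟨h₁, h₂, h12⟩ := (hl i).unit
    have h3 : RowQuotient.gen N i
        = G ((closure T).arc (half T i h₁)) - G ((closure T).arc (half T i h₂)) := by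
      change _ = (f (half T i h₁) - F (x j₀)) - (f (half T i h₂) - F (x j₀))
      rw [hfu i h₁, hfu i h₂, sub_sub_sub_cancel_right, add_sub_add_left_eq_sub, ← sub_smul, h12,
        one_smul]
    have h4 := sub_mem (hspan ((closure T).arc (half T i h₁))) (hspan ((closure T).arc (half T i h₂)))
    rw [← h3, Submodule.mem_span_range_iff_exists_fun] at h4
    obtain ⟨y, hy⟩ := h4
    exact ⟨y, hy.symm⟩

/-- Conversely, the generators of the module presented by the minor, with `0` on the arc of the
deleted column, colour the knot. The relation of the deleted row holds by `relAt_of_forall_ne`, and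
the coefficients of the tangles satisfy the rows of `presentation`. -/
theorem dvd_det_presentation (hb : ∀ i, BoundaryRel tUnit (T i) (outAt o i))
    (hl : ∀ i, IsGen tUnit (T i) (outAt o i) (lam i)) (i₀ j₀ : Fin (n + 1)) :
    (alexanderMinor o x c i₀ j₀).det ∣ (presentation tUnit o lam).det := by
  set A := alexanderMinor o x c i₀ j₀
  let G : (closure T).Arc → RowQuotient A := fun a =>
    (Fin.insertNth j₀ 0 (RowQuotient.gen A) : Fin (n + 1) → RowQuotient A) (x.symm a)
  have hG0 : G (x j₀) = 0 := by simp [G]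
  have hG1 : ∀ j, G (x (j₀.succAbove j)) = RowQuotient.gen A j := by intro j; simp [G]
  let f : (closure T).C × Corner → RowQuotient A := fun h => G ((closure T).arc h)
  have hf : (closure T).PreCol f := LinkDiagram.preCol_arc G
  have hrel : ∀ d, RelAt tUnit o.out f d := by
    have h1 : ∀ d, d ≠ c i₀ → RelAt tUnit o.out f d := by
      intro d hd
      obtain ⟨i, rfl⟩ := c.surjective d
      obtain ⟨i, rfl⟩ := Fin.exists_succAbove_eq (fun h => hd (congrArg c h))
      refine (LinkDiagram.foxSum_relator_eq_zero_iff o x G _).1 ?_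
      rw [foxSum_eq_sum_succAbove x G hG0]
      simp_rw [hG1]
      exact RowQuotient.sum_row A i
    intro d
    by_cases hd : d = c i₀
    · rw [hd]; exact relAt_of_forall_ne tUnit o hf hb _ h1
    · exact h1 d hd
  have hcol : ∀ i, IsCol tUnit (T i) (outAt o i) (fun h => f (half T i h)) := fun i =>
    ⟨(closure_preCol.1 hf).1 i, fun d => hrel ⟨i, d⟩⟩
  choose u hu using fun i => (hl i).gen _ _ (hcol i)
  refine det_dvd_det_of_relations _ A u (RowQuotient.gen A)
    (sum_presentation_eq_zero tUnit o hb hl hf hu) (RowQuotient.relation_of_sum_eq_zero A)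
    (fun i => RowQuotient.exists_eq_sum A _) (fun j => ?_)
  obtain ⟨h₁, e₁⟩ := Quot.exists_rep (x (j₀.succAbove j))
  obtain ⟨h₂, e₂⟩ := Quot.exists_rep (x j₀)
  have h3 : f h₁ - f h₂ = RowQuotient.gen A j := by
    change G (Quot.mk _ h₁) - G (Quot.mk _ h₂) = _
    rw [e₁, e₂, hG0, hG1, sub_zero]
  have h4 := sub_mem_span hf hu h₁ h₂
  rw [h3, Submodule.mem_span_range_iff_exists_fun] at h4
  obtain ⟨y, hy⟩ := h4
  exact ⟨y, hy.symm⟩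

theorem isAlexanderPolynomial_of_dotEq (hD : (closure T).IsKnot)
    (hb : ∀ i, BoundaryRel tUnit (T i) (outAt o i))
    (hl : ∀ i, IsGen tUnit (T i) (outAt o i) (lam i)) {f : K}
    (hf : DotEq f (algebraMap _ K (presentation tUnit o lam).det)) :
    IsAlexanderPolynomial (closure T) o f :=
  ⟨LinkDiagram.card_arc o hD, fun _ x c i₀ j₀ => dotEq_of_associated
    (associated_of_dvd_dvd (dvd_det_presentation o x c hb hl i₀ j₀)
      (det_presentation_dvd o x c hb hl i₀ j₀)) hf⟩

theorem map_det_presentation {R S : Type} [CommRing R] [CommRing S] (e : R →+* S) (τ : Rˣ)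
    (lam : ∀ i, (T i).C × Corner → R) {d a b : Fin (m + 1) → S} {c : S}
    (hd : ∀ i, e (diffCoeff τ o i : R) = d i) (hc : e (constCoeff τ o 0) = c)
    (ha : ∀ i, e (lam i ((T i).ends .sw)) = a i) (hb : ∀ i, e (lam i ((T i).ends .ne)) = -b i) :
    e (presentation τ o lam).det
      = (chainMatrix (fun i => d i * b i - c * a i) (fun i => d i * b i) a).det := by
  rw [RingHom.map_det, presentation, RingHom.mapMatrix_apply, chainMatrix_map]
  congr 2
  · funext i
    simp only [Function.comp, map_sub, map_mul, map_neg, hd, hc, ha, hb, neg_mul_neg]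
  · funext i
    simp only [Function.comp, map_mul, map_neg, hd, hb, neg_mul_neg]
  · funext i
    exact ha i

end Closure

end Tangle

theorem dotEq_of_unit_mul (w : ℤ[T;T⁻¹]ˣ) {f g : K} (h : g = algebraMap _ K (w : ℤ[T;T⁻¹]) * f) :
    DotEq f g := by
  obtain ⟨k, hk | hk⟩ := eq_T_or_neg_of_isUnit w⁻¹.isUnit
  all_goals
    have h1 : f = algebraMap _ K ((w⁻¹ : ℤ[T;T⁻¹]ˣ) : ℤ[T;T⁻¹]) * g := by
      rw [h, ← mul_assoc, ← map_mul, Units.inv_mul, map_one, one_mul]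
    rw [hk] at h1
    simp only [map_neg, algebraMap_T] at h1
    refine ⟨k, ?_⟩
    rw [h1]
  · exact Or.inl rfl
  · right; ring

theorem t_add_one_ne_zero : t + 1 ≠ 0 := by
  intro h
  have : (tUnit : ℤ[T;T⁻¹]ˣ) + (1 : ℤ[T;T⁻¹]) = 0 :=
    algebraMap_injective (by rw [map_add, algebraMap_tUnit, map_one, h, map_zero])
  have h2 := congrArg (LaurentPolynomial.eval₂ (RingHom.id ℤ) (1 : ℤˣ)) this
  rw [map_add, map_one, map_zero] at h2
  simp [tUnit, LaurentPolynomial.eval₂_T] at h2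

/-! ### Directions of the strands in a Montesinos knot and the two formulas -/

section Montesinos

open Tangle

variable {m : ℕ} {x : Fin (m + 1) → ℚ} {k : Fin (m + 1) → List ℤ}
  (o : (montesinos k).Orientation)

/-- The orientation of the upper left end of the `i`-th tangle. -/
def outNW (i : Fin (m + 1)) : Bool := outAt (T := tangles k) o i ((tangles k i).ends .nw)

/-- The orientation of the upper right end of the `i`-th tangle. -/
def outNE (i : Fin (m + 1)) : Bool := outAt (T := tangles k) o i ((tangles k i).ends .ne)

theorem outNW_succ (i : Fin (m + 1)) :
    outNW o (i + 1) = !outAt (T := tangles k) o i ((tangles k i).ends .sw) :=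
  outAt_nw (T := tangles k) o i

theorem outNE_succ (i : Fin (m + 1)) :
    outNE o (i + 1) = !outAt (T := tangles k) o i ((tangles k i).ends .se) :=
  outAt_ne (T := tangles k) o i

theorem endsCompatible_tangles (hk : ∀ i, IsContFrac (k i) (x i)) (i : Fin (m + 1)) :
    EndsCompatible (fun e => outAt (T := tangles k) o i ((tangles k i).ends e))
      (x i).num (x i).den :=
  endsCompatible_rational (k i) (hk i) (isOri_outAt (T := tangles k) o i)

theorem out_succ_of_even_den (hk : ∀ i, IsContFrac (k i) (x i)) {i : Fin (m + 1)}
    (hq : Even (x i).den) : outNW o (i + 1) = outNW o i ∧ outNE o (i + 1) = outNE o i := by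
  obtain ⟨h1, h2⟩ := (endsCompatible_tangles o hk i).2.1 (by exact_mod_cast hq)
  exact ⟨(outNW_succ o i).trans ((congrArg not h1).trans (Bool.not_not _)),
    (outNE_succ o i).trans ((congrArg not h2).trans (Bool.not_not _))⟩

theorem out_succ_of_odd (hk : ∀ i, IsContFrac (k i) (x i)) {i : Fin (m + 1)}
    (hp : Odd (x i).num) (hq : Odd (x i).den) :
    outNW o (i + 1) = outNE o i ∧ outNE o (i + 1) = outNW o i := by
  obtain ⟨h1, h2⟩ := (endsCompatible_tangles o hk i).2.2 hp (by exact_mod_cast hq)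
  exact ⟨(outNW_succ o i).trans ((congrArg not h2).trans (Bool.not_not _)),
    (outNE_succ o i).trans ((congrArg not h1).trans (Bool.not_not _))⟩

theorem out_succ_of_even_num (hk : ∀ i, IsContFrac (k i) (x i)) {i : Fin (m + 1)}
    (hp : Even (x i).num) : outNW o (i + 1) = !outNE o (i + 1) := by
  have h2 := ((endsCompatible_tangles o hk i).1 hp).2
  rw [outNW_succ, outNE_succ, Bool.not_not]
  exact h2.symm

/-- If the strands are antiparallel at the top of the first tangle, they are so everywhere, up to
the last tangle. -/
theorem outNW_eq (hk : ∀ i, IsContFrac (k i) (x i)) (hp : ∀ i, i ≠ Fin.last m → Odd (x i).num)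
    (hnw : outNW o 0 = true) (hne : outNE o 0 = false) (i : Fin (m + 1)) :
    outNW o i = decide (Even (∑ j ∈ Finset.Iio i, (x j).den)) ∧ outNE o i = !outNW o i := by
  induction i using Fin.induction with
  | zero =>
    rw [show Finset.Iio (0 : Fin (m + 1)) = ∅ by ext j; simp, Finset.sum_empty, hnw, hne]
    simp
  | succ i ih =>
    obtain ⟨ih1, ih2⟩ := ih
    have hS : Finset.Iio i.succ = insert i.castSucc (Finset.Iio i.castSucc) := by
      ext j
      simp only [Finset.mem_Iio, Finset.mem_insert, Fin.lt_def, Fin.ext_iff, Fin.val_succ,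
        Fin.val_castSucc]
      omega
    rw [hS, Finset.sum_insert (by simp), ← Fin.coeSucc_eq_succ]
    rcases Nat.even_or_odd (x i.castSucc).den with hq | hq
    · obtain ⟨h1, h2⟩ := out_succ_of_even_den o hk hq
      rw [h1, h2]
      refine ⟨?_, ih2⟩
      rw [ih1]
      simp [Nat.even_add, hq]
    · obtain ⟨h1, h2⟩ := out_succ_of_odd o hk (hp _ (Fin.castSucc_lt_last i).ne) hq
      rw [h1, h2, ih2, Bool.not_not]
      refine ⟨?_, rfl⟩
      rw [ih1]
      simp [Nat.even_add, Nat.not_even_iff_odd.2 hq, -Nat.not_even_iff_odd]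

theorem outNE_zero (ho : outOn o 0 ((tangles k 0).ends .ne) = false) : outNE o 0 = false := ho

/-- If all strands go down and there is an odd number of transpositions, then both strands at the
top of each tangle are directed into it. -/
theorem outNW_eq_false (hk : ∀ i, IsContFrac (k i) (x i)) (hp : ∀ i, Odd (x i).num)
    (hq : Odd (∑ i, (x i).den)) (hne : outNE o 0 = false) (i : Fin (m + 1)) :
    outNW o i = false ∧ outNE o i = false := by
  -- If the upper strands were antiparallel, each odd denominator would interchange their
  -- directions. An odd number of interchanges contradicts the return to the first tangle.
  have h0 : outNW o 0 = false := by
    by_contra hnw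
    rw [Bool.not_eq_false] at hnw
    obtain ⟨h1, h2⟩ := outNW_eq o hk (fun i _ => hp i) hnw hne (Fin.last m)
    have hU : (Finset.univ : Finset (Fin (m + 1))) = insert (Fin.last m) (Finset.Iio (Fin.last m)) := by
      ext j
      simp only [Finset.mem_univ, Finset.mem_insert, Finset.mem_Iio, Fin.lt_last_iff_ne_last, em]
    rw [hU, Finset.sum_insert (by simp)] at hq
    rcases Nat.even_or_odd (x (Fin.last m)).den with hq' | hq'
    · obtain ⟨h3, -⟩ := out_succ_of_even_den o hk hq'
      rw [Fin.last_add_one, hnw, h1] at h3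
      have h4 := of_decide_eq_true h3.symm
      exact (Nat.not_even_iff_odd.2 hq) (hq'.add h4)
    · obtain ⟨h3, -⟩ := out_succ_of_odd o hk (hp _) hq'
      rw [Fin.last_add_one, hnw, h2, h1] at h3
      have h4 : ¬ Even (∑ j ∈ Finset.Iio (Fin.last m), (x j).den) := by
        intro h; rw [decide_eq_true h] at h3; simp at h3
      exact (Nat.not_even_iff_odd.2 hq) (hq'.add_odd (Nat.not_even_iff_odd.1 h4))
  induction i using Fin.induction with
  | zero => exact ⟨h0, hne⟩
  | succ i ih =>
    rw [← Fin.coeSucc_eq_succ]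
    rcases Nat.even_or_odd (x i.castSucc).den with hq' | hq'
    · rw [(out_succ_of_even_den o hk hq').1, (out_succ_of_even_den o hk hq').2]
      exact ih
    · rw [(out_succ_of_odd o hk (hp _) hq').1, (out_succ_of_odd o hk (hp _) hq').2]
      exact ih.symm

end Montesinos

-- Both strands enter each tangle at the top, so every `diffCoeff` is `t⁻¹ ^ 2` and `constCoeff` is
-- `-(t⁻¹ ^ 2 * (t + 1))`. Being nonzero, the latter can be cancelled in `mul_det_chainMatrix`.
open Tangle in
theorem isAlexanderPolynomial_of_parallel {m : ℕ} {x : Fin (m + 1) → ℚ}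
    {k : Fin (m + 1) → List ℤ} (hk : ∀ i, IsContFrac (k i) (x i)) (hknot : (montesinos k).IsKnot)
    (o : (montesinos k).Orientation) (hnw : ∀ i, outNW o i = false) (hne : ∀ i, outNE o i = false) :
    IsAlexanderPolynomial (montesinos k) o
      (1 / (t + 1) * (∏ i, ((t + 1) * zh o i + zv o i) - ∏ i, zv o i)) := by
  have hb : ∀ i, BoundaryRel tUnit (tangles k i) (outAt (T := tangles k) o i) := fun i =>
    boundaryRel_rational tUnit (k i) (isOri_outAt (T := tangles k) o i)
  choose lam hl using fun i => exists_isRatGen (k i) (hk i) (isOri_outAt (T := tangles k) o i)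
  refine isAlexanderPolynomial_of_dotEq (T := tangles k) o hknot hb (fun i => (hl i).toIsGen) ?_
  have hd : ∀ i, algebraMap _ K (diffCoeff tUnit (T := tangles k) o i : ℤ[T;T⁻¹]ˣ).val
      = t⁻¹ ^ 2 := by
    intro i
    have h1 : diffCoeff tUnit (T := tangles k) o i
      = -(mer tUnit (outNW o i) * foxEnd tUnit (outNE o i)) := rfl
    rw [h1, hnw, hne]
    simp [mer, foxEnd, algebraMap_tUnit, pow_two]
  have hc : algebraMap _ K (constCoeff tUnit (T := tangles k) o 0) = -(t⁻¹ ^ 2 * (t + 1)) := by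
    have h1 : constCoeff tUnit (T := tangles k) o 0
      = foxEnd tUnit (outNW o 0) + mer tUnit (outNW o 0) * foxEnd tUnit (outNE o 0) := rfl
    rw [h1, hnw, hne]
    simp only [mer, foxEnd, cond_false, map_add, map_mul, Units.val_neg, map_neg,
      algebraMap_unit_inv, algebraMap_tUnit]
    have := t_ne_zero
    field_simp
    ring
  have hsw : ∀ i, algebraMap _ K (lam i ((tangles k i).ends .sw)) = zh o i := fun i => (hl i).sw
  have hneg : ∀ i, algebraMap _ K (lam i ((tangles k i).ends .ne)) = -zv o i := fun i => (hl i).ne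
  have hN : algebraMap _ K (presentation tUnit (T := tangles k) o lam).det
      = (chainMatrix (fun i => t⁻¹ ^ 2 * zv o i - -(t⁻¹ ^ 2 * (t + 1)) * zh o i)
        (fun i => t⁻¹ ^ 2 * zv o i) (zh o)).det :=
    map_det_presentation (T := tangles k) o _ tUnit lam hd hc hsw hneg
  have hdet := mul_det_chainMatrix (t⁻¹ ^ 2 * (t + 1))
    (fun i => t⁻¹ ^ 2 * zv o i - -(t⁻¹ ^ 2 * (t + 1)) * zh o i) (fun i => t⁻¹ ^ 2 * zv o i) (zh o)
    (fun i => by ring)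
  have hprod : ∏ i, (t⁻¹ ^ 2 * zv o i - -(t⁻¹ ^ 2 * (t + 1)) * zh o i)
      = ∏ i, t⁻¹ ^ 2 * ((t + 1) * zh o i + zv o i) :=
    Finset.prod_congr rfl fun i _ => by ring
  rw [hprod, Finset.prod_mul_distrib, Finset.prod_mul_distrib, Finset.prod_const, ← mul_sub,
    Finset.card_univ, Fintype.card_fin, pow_succ (t⁻¹ ^ 2), ← pow_mul] at hdet
  rw [hN]
  have ht1 := t_add_one_ne_zero
  have h2 : t⁻¹ ^ 2 ≠ 0 := pow_ne_zero _ (inv_ne_zero t_ne_zero)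
  -- Each of the `m + 1` tangles contributes `t⁻¹ ^ 2` to the products; one such factor cancels
  -- against the constant.
  refine dotEq_of_unit_mul (tUnit⁻¹ ^ (2 * m)) ?_
  rw [Units.val_pow_eq_pow_val, map_pow, algebraMap_unit_inv, algebraMap_tUnit]
  apply mul_left_cancel₀ (mul_ne_zero h2 ht1)
  rw [hdet]
  generalize t⁻¹ ^ (2 * m) = w
  generalize t⁻¹ ^ 2 = v
  field_simp

-- For antiparallel strands at the top of each tangle `constCoeff` vanishes, so the chain matrix has
-- `p = v` and `det_chainMatrix_self` applies.
open Tangle in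
theorem isAlexanderPolynomial_of_antiparallel {m : ℕ} {x : Fin (m + 1) → ℚ}
    {k : Fin (m + 1) → List ℤ} (hk : ∀ i, IsContFrac (k i) (x i)) (hx : ∀ i, x i ≠ 0)
    (hknot : (montesinos k).IsKnot)
    (o : (montesinos k).Orientation) (ε : Fin (m + 1) → ℤ)
    (hnw : ∀ i, phi (outNW o) i = t ^ ε i) (hne : ∀ i, outNE o i = !outNW o i) :
    IsAlexanderPolynomial (montesinos k) o
      ((1 - t) * (∏ i, zv o i) * ∑ i, zh o i / ((1 - t ^ ε i) * zv o i)) := by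
  have hb : ∀ i, BoundaryRel tUnit (tangles k i) (outAt (T := tangles k) o i) := fun i =>
    boundaryRel_rational tUnit (k i) (isOri_outAt (T := tangles k) o i)
  choose lam hl using fun i => exists_isRatGen (k i) (hk i) (isOri_outAt (T := tangles k) o i)
  refine isAlexanderPolynomial_of_dotEq (T := tangles k) o hknot hb (fun i => (hl i).toIsGen) ?_
  have hd : ∀ i, diffCoeff tUnit (T := tangles k) o i = foxEnd tUnit (outNW o i) := by
    intro i
    have h1 : diffCoeff tUnit (T := tangles k) o i
      = -(mer tUnit (outNW o i) * foxEnd tUnit (outNE o i)) := rfl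
    rw [h1, hne, foxEnd_not, mul_neg, neg_neg, mul_inv_cancel_left]
  have hc : constCoeff tUnit (T := tangles k) o 0 = 0 := by
    have h1 : constCoeff tUnit (T := tangles k) o 0
      = foxEnd tUnit (outNW o 0) + mer tUnit (outNW o 0) * foxEnd tUnit (outNE o 0) := rfl
    rw [h1, hne, foxEnd_not, Units.val_neg, mul_neg, ← Units.val_mul, mul_inv_cancel_left,
      add_neg_cancel]
  have ht1 : 1 - t ≠ 0 := sub_ne_zero.2 t_ne_one.symm
  -- `θ i` is the unit `(1 - t ^ ε i) / (1 - t)`. The product of all `θ i` is absorbed into `± t ^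
  -- k`, while those in the sum produce the denominators `1 - t ^ ε i` and the factor `1 - t`.
  let θ : Fin (m + 1) → K := fun i => algebraMap _ K (foxEnd tUnit (outNW o i) : ℤ[T;T⁻¹]ˣ).val
  have hθ : ∀ i, (1 - t) * θ i = 1 - t ^ ε i := by
    intro i
    have h1 := congrArg (algebraMap ℤ[T;T⁻¹] K) (sub_one_mul_foxEnd tUnit (outNW o i))
    rw [map_mul, map_sub, map_sub, map_one, algebraMap_tUnit, algebraMap_mer, hnw] at h1
    linear_combination -h1
  have hθ0 : ∀ i, θ i ≠ 0 := fun i h0 =>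
    (foxEnd tUnit (outNW o i)).ne_zero (algebraMap_injective (h0.trans (map_zero _).symm))
  have hsw : ∀ i, algebraMap _ K (lam i ((tangles k i).ends .sw)) = zh o i := fun i => (hl i).sw
  have hneg : ∀ i, algebraMap _ K (lam i ((tangles k i).ends .ne)) = -zv o i := fun i => (hl i).ne
  -- At `t = -1` the function `z_v` takes the value `x i` times the nonzero value of `z_h`.
  have hzv : ∀ i, zv o i ≠ 0 := by
    intro i h0
    have h1 := hneg i
    rw [h0, neg_zero] at h1
    have h2 : lam i ((tangles k i).ends .ne) = 0 := algebraMap_injective (h1.trans (map_zero _).symm)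
    have h3 := (hl i).eval_ne
    rw [h2, map_zero, Int.cast_zero, neg_zero] at h3
    exact mul_ne_zero (hx i) (Int.cast_ne_zero.2 (hl i).eval_sw) h3.symm
  have hN : algebraMap _ K (presentation tUnit (T := tangles k) o lam).det
      = (chainMatrix (fun i => θ i * zv o i - 0 * zh o i) (fun i => θ i * zv o i) (zh o)).det :=
    map_det_presentation (T := tangles k) o _ tUnit lam (fun i => by rw [hd]) (by rw [hc, map_zero])
      hsw hneg
  simp only [zero_mul, sub_zero] at hN
  rw [hN, det_chainMatrix_self _ _ fun i => mul_ne_zero (hθ0 i) (hzv i)]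
  refine dotEq_of_unit_mul (∏ i, foxEnd tUnit (outNW o i)) ?_
  have hsum : ∑ i, zh o i / (θ i * zv o i)
      = (1 - t) * ∑ i, zh o i / ((1 - t ^ ε i) * zv o i) := by
    rw [Finset.mul_sum]
    refine Finset.sum_congr rfl fun i _ => ?_
    rw [← hθ i]
    have := hθ0 i
    have := hzv i
    field_simp
  rw [hsum, Units.coe_prod, map_prod, Finset.prod_mul_distrib]
  ring

end MontesinosKnot

theorem theorem3p1 (m : ℕ) (x : Fin (m + 1) → ℚ) (k : Fin (m + 1) → List ℤ)
    (hk : ∀ i, MontesinosKnot.IsContFrac (k i) (x i))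
    (hknot : (MontesinosKnot.montesinos k).IsKnot)
    (o : (MontesinosKnot.montesinos k).Orientation)
    (ho : MontesinosKnot.outOn o 0 ((MontesinosKnot.tangles k 0).ends .ne) = false) :
    (MontesinosKnot.n₀ x = 0 → Odd (MontesinosKnot.n₁ x) →
      MontesinosKnot.IsAlexanderPolynomial (MontesinosKnot.montesinos k) o
        (1 / (MontesinosKnot.t + 1) *
          (∏ i, ((MontesinosKnot.t + 1) * MontesinosKnot.zh o i + MontesinosKnot.zv o i)
            - ∏ i, MontesinosKnot.zv o i))) ∧
    (MontesinosKnot.n₀ x = 1 → Even (x (Fin.last m)).num → x (Fin.last m) ≠ 0 →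
      MontesinosKnot.IsAlexanderPolynomial (MontesinosKnot.montesinos k) o
        ((1 - MontesinosKnot.t) * (∏ i, MontesinosKnot.zv o i) *
          ∑ i, MontesinosKnot.zh o i /
            ((1 - MontesinosKnot.t ^ ((-1 : ℤ) ^ ∑ j ∈ Finset.Iio i, (x j).den)) *
              MontesinosKnot.zv o i))) := by
  constructor
  · intro h0 h1
    have hp : ∀ i, Odd (x i).num := by
      intro i
      rw [← Int.not_even_iff_odd]
      intro h
      have : i ∈ Finset.univ.filter fun i => Even (x i).num := by simpa using h
      rw [Finset.card_eq_zero.1 h0] at this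
      simp at this
    -- All numerators are odd, so `n₁` counts the odd denominators and has the parity of their sum.
    have hq : Odd (∑ i, (x i).den) := by
      rw [Finset.odd_sum_iff_odd_card_odd]
      simpa only [MontesinosKnot.n₁, hp, true_and] using h1
    have h := MontesinosKnot.outNW_eq_false o hk hp hq (MontesinosKnot.outNE_zero o ho)
    exact MontesinosKnot.isAlexanderPolynomial_of_parallel hk hknot o (fun i => (h i).1)
      fun i => (h i).2
  · intro h0 he hx
    have hp : ∀ i, i ≠ Fin.last m → Odd (x i).num := by
      intro i hi
      rw [← Int.not_even_iff_odd]
      intro h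
      exact hi (Finset.card_le_one.1 (le_of_eq h0) i (by simpa using h) _ (by simpa using he))
    have hx' : ∀ i, x i ≠ 0 := by
      intro i
      by_cases hi : i = Fin.last m
      · rw [hi]; exact hx
      · intro h
        have := hp i hi
        rw [h] at this
        simp at this
    have hne := MontesinosKnot.outNE_zero o ho
    -- An even numerator gives the lower ends of the last tangle opposite directions, and these ends
    -- are joined to the upper ends of the first tangle.
    have hnw : MontesinosKnot.outNW o 0 = true := by
      have h := MontesinosKnot.out_succ_of_even_num o hk he
      rwa [Fin.last_add_one, hne] at h
    have h := MontesinosKnot.outNW_eq o hk hp hnw hne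
    refine MontesinosKnot.isAlexanderPolynomial_of_antiparallel hk hx' hknot o _ (fun i => ?_)
      fun i => (h i).2
    rw [MontesinosKnot.phi, (h i).1]
    rcases Nat.even_or_odd (∑ j ∈ Finset.Iio i, (x j).den) with hs | hs
    · rw [hs.neg_one_pow, if_pos (decide_eq_true hs), zpow_one]
    · rw [hs.neg_one_pow, if_neg (by simpa using hs), zpow_neg_one]
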